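/- **Conventions.** A *computable metric space* is a complete metric space $(X,d)$ with a dense sequence $(x_i)_{i\in\mathbb N}$ of *basic points* such that $(i,j)\mapsto d(x_i,x_j)$ is computable. Here $f\colon\mathbb N\to\mathbb R$ is computable if there is a computable $g\colon\mathbb N\times\mathbb N\to\mathbb Q$ with $|g(n,j)-g(n,i)|\le 2^{-i}$ for all $j\ge i$ and $f(n)=\lim_i g(n,i)$. A *Cauchy name* of $y\in X$ is $h\in\mathbb N^{\mathbb N}$ with $d(x_{h(j)},x_{h(i)})\le 2^{-i}$ for all $j\ge i$ and $\lim_i x_{h(i)}=y$; the point $y$ is *computable* if it has a computable Cauchy name. A map $f\colon X\to Y$ is *computable* if some partial computable $F\colon{\subseteq}\,\mathbb N^{\mathbb N}\to\mathbb N^{\mathbb N}$ is defined on every Cauchy name of every $x\in X$ and sends it to a Cauchy name of $f(x)$. A function $f\colon X\to(-\infty,\infty]$ is *lower semicomputable* if $f(x)=\sup_n g(n,x)$ for a computable $g\colon\mathbb N\times X\to\mathbb R$. A set is *effectively open* if it is the union of a computable set of open balls with basic centres and positive rational radii (under a standard enumeration of these balls). Products carry the maximum metric, with pairs of basic points as basic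 points; $\mathbb N$ and $\mathbb R$ carry their usual metrics, with all natural numbers, respectively an enumeration of $\mathbb Q$, as basic points. Let $\mathbb X$ be a computable metric space. Let $(f_i)_{i\in\mathbb N}$ be a natural enumeration of the closure, under $\max$, $\min$ and rational linear combinations, of the constant $1$ and the functions $f_{c,r,s}$ ($c$ a basic point, $0<r<s$ rational) that are $1$ where $d(c,y)\le r$, $\frac{s-d(c,y)}{s-r}$ where $r<d(c,y)\le s$, and $0$ elsewhere. The space $\mathcal M(\mathbb X)$ of finite Borel measures carries the metric $$d(\mu,\nu)=\sum_i 2^{-i}\Bigl(1-\exp\bigl(-\bigl|\textstyle\int f_i\,d\mu-\int f_i\,d\nu\bigr|\bigr)\Bigr),$$ and its basic points are the measures $q_1\delta_{c_1}+\dots+q_n\delta_{c_n}$ with $n\ge1$, $q_j$ positive rationals and $c_j$ basic points of $\mathbb X$. The space $\mathcal M_1(\mathbb X)$ of Borel probability measures carries the same metric, and its basic points are those of the above measures with $q_1+\dots+q_n=1$. Cauchy names, computable points and computable maps for these spaces are defined as above, from the metric and the basic points. * For a computable $\mu\in\mathcal M_1(\mathbb X)$, a *Schnorr sequential $\mu$-test*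 is a sequence $(U_n)_{n\in\mathbb N}$ of subsets of $\mathbb X$ with $U_n=\{y:(n,y)\in V\}$ for some effectively open $V\subseteq\mathbb N\times\mathbb X$, with $\mu(U_n)\le 2^{-n}$ for all $n$, and with $n\mapsto\mu(U_n)$ computable. A point $x\in\mathbb X$ is *Schnorr $\mu$-random* if $x\notin\bigcap_nU_n$ for every Schnorr sequential $\mu$-test $(U_n)$. * For computable metric spaces $\mathbb A,\mathbb X$, a *uniform Schnorr integral test* is a lower semicomputable function $t\colon\mathbb A\times\mathcal M(\mathbb X)\times\mathbb X\to[0,\infty]$ such that $\int t(a,\mu,x)\,d\mu(x)<\infty$ for all $a\in\mathbb A$ and $\mu\in\mathcal M(\mathbb X)$, and such that $(a,\mu)\mapsto\int t(a,\mu,x)\,d\mu(x)$ is a computable map $\mathbb A\times\mathcal M(\mathbb X)\to\mathbb R$. For $a\in\mathbb A$ and $\mu\in\mathcal M(\mathbb X)$, a point $x\in\mathbb X$ is *uniformly Schnorr $\mu$-random relative to the oracle $a$*, written $x\in\mathsf{SR}^a_\mu$, if $t(a,\mu,x)<\infty$ for every uniform Schnorr integral test $t$. **Proposition.** Let $\mathbb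 A$ and $\mathbb X$ be computable metric spaces, and let $\mu\in\mathcal M_1(\mathbb X)$ and $a\in\mathbb A$ be computable. Then for every $x\in\mathbb X$, $x\in\mathsf{SR}^a_\mu$ if and only if $x$ is Schnorr $\mu$-random. -/

import Mathlib

open MeasureTheory Filter Topology
open scoped ENNReal

namespace CompAnalysis

noncomputable section

universe u v

/-! ### Codings -/

/-- A fixed enumeration of the rational numbers. -/
def ratOfNat (k : ℕ) : ℚ :=
  ((k.unpair.1 : ℚ) - (k.unpair.2.unpair.1 : ℚ)) / ((k.unpair.2.unpair.2 : ℚ) + 1)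

/-- A fixed enumeration of the positive rational numbers. -/
def posRat (k : ℕ) : ℚ :=
  ((k.unpair.1 : ℚ) + 1) / ((k.unpair.2 : ℚ) + 1)

/-- The partial computable maps from Baire space to Baire space: the values of the output are
read off, monotonically and computably, from finite initial segments of the input. The domain
consists of those inputs for which every output value is eventually produced. -/
def IsPartialComputable (F : (ℕ → ℕ) →. (ℕ → ℕ)) : Prop :=
  ∃ φ : List ℕ → ℕ → Option ℕ, Computable₂ φ ∧
    (∀ (σ τ : List ℕ) (n v : ℕ), σ <+: τ → φ σ n = some v → φ τ n = some v) ∧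
    ∀ h g : ℕ → ℕ, g ∈ F h ↔ ∀ n, ∃ k, φ ((List.range k).map h) n = some (g n)

/-! ### Computable metric spaces -/

/-- A distinguished sequence of basic points. -/
class BasicPoints (X : Type u) where
  /-- The `i`-th basic point. -/
  pt : ℕ → X

instance : BasicPoints ℕ := ⟨fun n => n⟩

instance : BasicPoints ℝ := ⟨fun n => (ratOfNat n : ℝ)⟩

/-- The product carries the maximum metric, and the pairs of basic points as basic points. -/
instance {X : Type u} {Y : Type v} [BasicPoints X] [BasicPoints Y] : BasicPoints (X × Y) :=
  ⟨fun n => (BasicPoints.pt n.unpair.1, BasicPoints.pt n.unpair.2)⟩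

/-- `h` is a Cauchy name for `y`. -/
def IsCauchyName {X : Type u} [PseudoMetricSpace X] [BasicPoints X] (h : ℕ → ℕ) (y : X) : Prop :=
  (∀ i j : ℕ, i ≤ j →
    dist (BasicPoints.pt (h j) : X) (BasicPoints.pt (h i)) ≤ (2 : ℝ)⁻¹ ^ i) ∧
  Tendsto (fun i => (BasicPoints.pt (h i) : X)) atTop (𝓝 y)

/-- A point is computable if it has a computable Cauchy name. -/
def IsComputablePoint {X : Type u} [PseudoMetricSpace X] [BasicPoints X] (y : X) : Prop :=
  ∃ h : ℕ → ℕ, Computable h ∧ IsCauchyName h y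

/-- A computable function `ℕ → ℝ`: there is a computable double sequence of rationals `g n i`
with `|g n j - g n i| ≤ 2⁻ⁱ` for `i ≤ j` and `f n = limᵢ g n i`. -/
def IsComputableRealSeq (f : ℕ → ℝ) : Prop :=
  ∃ g : ℕ → ℕ → ℕ, Computable₂ g ∧ ∀ n, IsCauchyName (g n) (f n)

/-- A computable metric space: a complete metric space with a dense sequence of basic points
whose mutual distances are uniformly computable real numbers. -/
class ComputableMetricSpace (X : Type u) [MetricSpace X] [BasicPoints X] : Prop
    extends CompleteSpace X where
  dense_pt : DenseRange (BasicPoints.pt : ℕ → X)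
  dist_computable : IsComputableRealSeq
    fun n => dist (BasicPoints.pt n.unpair.1 : X) (BasicPoints.pt n.unpair.2)

section Maps

variable {X : Type u} {Y : Type v} [PseudoMetricSpace X] [BasicPoints X]
  [PseudoMetricSpace Y] [BasicPoints Y]

/-- A (total) function is computable if some partial computable map on Baire space sends every
Cauchy name of a point to a Cauchy name of its image. -/
def IsComputableMap (f : X → Y) : Prop :=
  ∃ F : (ℕ → ℕ) →. (ℕ → ℕ), IsPartialComputable F ∧
    ∀ (x : X) (h : ℕ → ℕ), IsCauchyName h x → ∃ g ∈ F h, IsCauchyName g (f x)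

/-- Lower semicomputable functions: suprema of computable sequences of computable real-valued
functions. (Such a function never takes the value `-∞`.) -/
def IsLowerSemicomputable (f : X → EReal) : Prop :=
  ∃ g : ℕ × X → ℝ, IsComputableMap g ∧ ∀ x, f x = ⨆ n : ℕ, ((g (n, x) : ℝ) : EReal)

/-- The `n`-th basic open ball. -/
def basicBall (X : Type u) [PseudoMetricSpace X] [BasicPoints X] (n : ℕ) : Set X :=
  Metric.ball (BasicPoints.pt n.unpair.1) (posRat n.unpair.2 : ℝ)

/-- Effectively open sets: unions of computable sets of basic open balls. -/
def IsEffectivelyOpen (U : Set X) : Prop :=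
  ∃ S : Set ℕ, ComputablePred (fun n => n ∈ S) ∧ U = ⋃ n ∈ S, basicBall X n

/-- A sequence of sets `U n` that is effectively open uniformly in `n`: the sections of an
effectively open subset of `ℕ × X`. -/
def IsEffectivelyOpenSeq (U : ℕ → Set X) : Prop :=
  ∃ V : Set (ℕ × X), IsEffectivelyOpen V ∧ ∀ n, U n = {y | (n, y) ∈ V}

end Maps

/-! ### The spaces of finite measures and of probability measures -/

/-- The basic bump function that is `1` on the closed ball of radius `r` around `c`, `0` outside
the ball of radius `s`, and is linear in the distance in between. -/
def bump {X : Type u} [PseudoMetricSpace X] (c : X) (r s : ℝ) (y : X) : ℝ :=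
  if dist c y ≤ r then 1 else if dist c y ≤ s then (s - dist c y) / (s - r) else 0

/-- The enumeration of the basic functions, i.e. of the closure of the set of all
`bump c r s` (with `c` a basic point and `0 < r < s` rational) and the constant `1` under
maxima, minima and rational linear combinations. Index `0` codes the constant `1`; index `n + 1`
codes a bump function, a maximum, a minimum or a linear combination, according to `n % 4`, with
parameters coded by `n / 4`. -/
def basicFun (X : Type u) [PseudoMetricSpace X] [BasicPoints X] : ℕ → X → ℝ
  | 0 => fun _ => 1
  | n + 1 =>
    have _h₁ : (n / 4).unpair.1 < n + 1 :=
      Nat.lt_succ_of_le ((Nat.unpair_left_le _).trans (Nat.div_le_self _ _))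
    have h₂ : (n / 4).unpair.2 < n + 1 :=
      Nat.lt_succ_of_le ((Nat.unpair_right_le _).trans (Nat.div_le_self _ _))
    have _h₃ : (n / 4).unpair.2.unpair.1 < n + 1 := (Nat.unpair_left_le _).trans_lt h₂
    have _h₄ : (n / 4).unpair.2.unpair.2 < n + 1 := (Nat.unpair_right_le _).trans_lt h₂
    match n % 4 with
    | 0 =>
      bump (BasicPoints.pt (n / 4).unpair.1) (posRat (n / 4).unpair.2.unpair.1 : ℝ)
        ((posRat (n / 4).unpair.2.unpair.1 : ℝ) + (posRat (n / 4).unpair.2.unpair.2 : ℝ))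
    | 1 => fun y => max (basicFun X (n / 4).unpair.1 y) (basicFun X (n / 4).unpair.2 y)
    | 2 => fun y => min (basicFun X (n / 4).unpair.1 y) (basicFun X (n / 4).unpair.2 y)
    | _ => fun y =>
      (ratOfNat (n / 4).unpair.1.unpair.1 : ℝ) * basicFun X (n / 4).unpair.2.unpair.1 y +
        (ratOfNat (n / 4).unpair.1.unpair.2 : ℝ) * basicFun X (n / 4).unpair.2.unpair.2 y

/-- The space `𝓜(X)` of finite measures (a copy of Mathlib's type, to carry the metric below). -/
def FinMeas (X : Type u) [MeasurableSpace X] : Type u := FiniteMeasure X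

/-- The space `𝓜₁(X)` of probability measures. -/
def ProbMeas (X : Type u) [MeasurableSpace X] : Type u := ProbabilityMeasure X

section Measures

variable {X : Type u} [MeasurableSpace X]

/-- The underlying measure. -/
def FinMeas.toMeasure (μ : FinMeas X) : Measure X := Subtype.val (p := IsFiniteMeasure) μ

/-- The underlying measure. -/
def ProbMeas.toMeasure (μ : ProbMeas X) : Measure X := Subtype.val (p := IsProbabilityMeasure) μ

/-- The inclusion of `𝓜₁(X)` in `𝓜(X)`. -/
def ProbMeas.toFinMeas (μ : ProbMeas X) : FinMeas X :=
  ProbabilityMeasure.toFiniteMeasure (show ProbabilityMeasure X from μ)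

variable [BasicPoints X]

/-- The nonempty finite list of (codes of) weighted atoms coded by `n`. -/
def atoms (n : ℕ) : List ℕ := n.unpair.1 :: Denumerable.ofNat (List ℕ) n.unpair.2

/-- The measure `q₁ δ_{x₁} + ⋯ + qₘ δ_{xₘ}` coded by a list: the `j`-th entry codes the basic
point `xⱼ` and the positive rational `qⱼ`. -/
def atomicMeasure (X : Type u) [MeasurableSpace X] [BasicPoints X] (l : List ℕ) : Measure X :=
  (l.map fun k => ENNReal.ofReal (posRat k.unpair.2 : ℝ) •
    Measure.dirac (BasicPoints.pt k.unpair.1 : X)).sum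

theorem isFiniteMeasure_atomicMeasure (l : List ℕ) : IsFiniteMeasure (atomicMeasure X l) := by
  induction l with
  | nil => simpa [atomicMeasure] using (inferInstance : IsFiniteMeasure (0 : Measure X))
  | cons k l ih =>
    have h₁ : IsFiniteMeasure (ENNReal.ofReal (posRat k.unpair.2 : ℝ) •
        Measure.dirac (BasicPoints.pt k.unpair.1 : X)) :=
      Measure.smul_finite _ ENNReal.ofReal_ne_top
    have h₂ : IsFiniteMeasure (atomicMeasure X l) := ih
    have h₃ : atomicMeasure X (k :: l) = ENNReal.ofReal (posRat k.unpair.2 : ℝ) •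
        Measure.dirac (BasicPoints.pt k.unpair.1 : X) + atomicMeasure X l := by
      simp [atomicMeasure]
    rw [h₃]
    infer_instance

theorem atomicMeasure_atoms_ne_zero (n : ℕ) : atomicMeasure X (atoms n) ≠ 0 := by
  intro h
  have h₁ := congrArg (fun m : Measure X => m Set.univ) h
  have this : (0 : ℚ) < posRat n.unpair.1.unpair.2 := by unfold posRat; positivity
  simp [atomicMeasure, atoms] at h₁
  exact absurd h₁.1 (not_le.2 this)

/-- The basic points of `𝓜(X)` are the measures `q₁ δ_{x₁} + ⋯ + qₘ δ_{xₘ}` with `qⱼ` positive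
rationals and `xⱼ` basic points. -/
instance : BasicPoints (FinMeas X) :=
  ⟨fun n => (⟨atomicMeasure X (atoms n), isFiniteMeasure_atomicMeasure _⟩ : FiniteMeasure X)⟩

theorem isProbabilityMeasure_normalized (n : ℕ) : IsProbabilityMeasure
    ((atomicMeasure X (atoms n) Set.univ)⁻¹ • atomicMeasure X (atoms n)) :=
  haveI := isFiniteMeasure_atomicMeasure (X := X) (atoms n)
  haveI : NeZero (atomicMeasure X (atoms n)) := ⟨atomicMeasure_atoms_ne_zero n⟩
  isProbabilityMeasureSMul

/-- The basic points of `𝓜₁(X)` are the same sums with `q₁ + ⋯ + qₘ = 1`; they are enumerated by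
dividing the basic points of `𝓜(X)` by their total mass. -/
instance : BasicPoints (ProbMeas X) :=
  ⟨fun n => (⟨(atomicMeasure X (atoms n) Set.univ)⁻¹ • atomicMeasure X (atoms n),
    isProbabilityMeasure_normalized n⟩ : ProbabilityMeasure X)⟩

variable [PseudoMetricSpace X]

/-- The `i`-th summand, without its weight, of the distance of two measures. -/
def measTerm (μ ν : FinMeas X) (i : ℕ) : ℝ :=
  1 - Real.exp (-|(∫ x, basicFun X i x ∂μ.toMeasure) - ∫ x, basicFun X i x ∂ν.toMeasure|)

/-- The distance `∑ᵢ 2⁻ⁱ (1 - exp (-|∫ fᵢ dμ - ∫ fᵢ dν|))`, with `fᵢ` the basic functions. -/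
def measDist (μ ν : FinMeas X) : ℝ := ∑' i : ℕ, (2 : ℝ)⁻¹ ^ i * measTerm μ ν i

theorem measTerm_nonneg (μ ν : FinMeas X) (i : ℕ) : 0 ≤ measTerm μ ν i := by
  unfold measTerm
  have := Real.exp_le_one_iff.2 (neg_nonpos.2 (abs_nonneg
    ((∫ x, basicFun X i x ∂μ.toMeasure) - ∫ x, basicFun X i x ∂ν.toMeasure)))
  linarith

theorem summable_measTerm (μ ν : FinMeas X) :
    Summable fun i : ℕ => (2 : ℝ)⁻¹ ^ i * measTerm μ ν i := by
  refine Summable.of_nonneg_of_le (fun i => mul_nonneg (by positivity) (measTerm_nonneg μ ν i))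
    (fun i => ?_) (summable_geometric_of_lt_one (r := (2 : ℝ)⁻¹) (by norm_num) (by norm_num))
  have h : measTerm μ ν i ≤ 1 := by
    unfold measTerm
    linarith [Real.exp_pos (-|(∫ x, basicFun X i x ∂μ.toMeasure) -
      ∫ x, basicFun X i x ∂ν.toMeasure|)]
  have hp : (0 : ℝ) ≤ (2 : ℝ)⁻¹ ^ i := by positivity
  nlinarith

theorem one_sub_exp_subadd {a b c : ℝ} (ha : 0 ≤ a) (hb : 0 ≤ b) (h : c ≤ a + b) :
    1 - Real.exp (-c) ≤ (1 - Real.exp (-a)) + (1 - Real.exp (-b)) := by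
  have h₁ : Real.exp (-a) * Real.exp (-b) ≤ Real.exp (-c) := by
    rw [← Real.exp_add]
    exact Real.exp_le_exp.2 (by linarith)
  have h₂ : Real.exp (-a) ≤ 1 := Real.exp_le_one_iff.2 (by linarith)
  have h₃ : Real.exp (-b) ≤ 1 := Real.exp_le_one_iff.2 (by linarith)
  nlinarith

theorem measTerm_triangle (μ ν ρ : FinMeas X) (i : ℕ) :
    measTerm μ ρ i ≤ measTerm μ ν i + measTerm ν ρ i :=
  one_sub_exp_subadd (abs_nonneg _) (abs_nonneg _) (abs_sub_le _ _ _)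

instance : PseudoMetricSpace (FinMeas X) where
  dist := measDist
  dist_self μ := by simp [measDist, measTerm]
  dist_comm μ ν := by simp only [measDist, measTerm, abs_sub_comm]
  dist_triangle μ ν ρ := by
    unfold measDist
    rw [← (summable_measTerm μ ν).tsum_add (summable_measTerm ν ρ)]
    refine (summable_measTerm μ ρ).tsum_le_tsum (fun i => ?_)
      ((summable_measTerm μ ν).add (summable_measTerm ν ρ))
    rw [← mul_add]
    exact mul_le_mul_of_nonneg_left (measTerm_triangle μ ν ρ i) (by positivity)

instance : PseudoMetricSpace (ProbMeas X) :=
  PseudoMetricSpace.induced ProbMeas.toFinMeas inferInstance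

end Measures

/-! ### Schnorr randomness -/

section Randomness

variable {A : Type u} {X : Type v} [MetricSpace A] [BasicPoints A]
  [MetricSpace X] [BasicPoints X] [MeasurableSpace X]

/-- Schnorr sequential `μ`-tests. -/
structure IsSchnorrSequentialTest (μ : Measure X) (U : ℕ → Set X) : Prop where
  effectivelyOpen : IsEffectivelyOpenSeq U
  measure_le : ∀ n, μ (U n) ≤ ENNReal.ofReal ((2 : ℝ)⁻¹ ^ n)
  measure_computable : IsComputableRealSeq fun n => (μ (U n)).toReal

/-- Schnorr `μ`-randomness in the classical sense of sequential tests. -/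
def IsSchnorrRandom (μ : Measure X) (x : X) : Prop :=
  ∀ U : ℕ → Set X, IsSchnorrSequentialTest μ U → x ∉ ⋂ n, U n

/-- Uniform Schnorr integral tests `t : A × 𝓜(X) × X → [0, ∞]`. -/
structure IsUniformSchnorrIntegralTest (t : A × FinMeas X × X → ℝ≥0∞) : Prop where
  lowerSemicomputable : IsLowerSemicomputable fun z => (t z : EReal)
  lintegral_lt_top : ∀ (a : A) (μ : FinMeas X), ∫⁻ x, t (a, μ, x) ∂μ.toMeasure < ∞
  lintegral_computable : IsComputableMap
    fun p : A × FinMeas X => (∫⁻ x, t (p.1, p.2, x) ∂p.2.toMeasure).toReal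

/-- `x` is uniformly Schnorr `μ`-random relative to the oracle `a`. -/
def IsUniformlySchnorrRandom (a : A) (μ : FinMeas X) (x : X) : Prop :=
  ∀ t : A × FinMeas X × X → ℝ≥0∞, IsUniformSchnorrIntegralTest t → t (a, μ, x) < ∞

end Randomness

end

end CompAnalysis

namespace CompAnalysis

universe u v w

/-! ### Computable functions -/

attribute [fun_prop] Computable
attribute [fun_prop] Computable.id Computable.const Computable.comp

section Computability

variable {α β γ σ : Type*} [Primcodable α] [Primcodable β] [Primcodable γ] [Primcodable σ]

/-! Write `ν` for the measure. Both implications reduce to statements about one function `T ≥ 0` on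
`X` that is the supremum of a computable increasing sequence of basic functions (`IsLowerApprox`)
and has a computable integral. The metric on measures controls the integral of each basic function,
so these integrals are computable at a computable `ν`.

Schnorr random points are uniformly Schnorr random: for a uniform test `t`, the section `T = t(a, ν,
·)` has such an approximation, because every output of a computation depends on a finite part of a
name (`IsLowerSemicomputable.exists_isLowerApprox`). By Markov's inequality the sets `{T > q}` are
small for large `q`, but their measures need not be computable. However, `q ↦ ∫ min(T, q) dν` is
computable at nonnegative rationals, and its difference quotient over `[p, q]` lies between `ν{T ≥
q}` and `ν{T > p}`. The distribution function of `T` has at most countably many jumps, so a search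
finds nested rational intervals on which these quotients nearly agree. The union of the superlevel
sets at the upper ends has computable measure. Starting above a multiple of `2ⁿ` yields a Schnorr
sequential test that contains all points with `T = ∞` (`IsLowerApprox.lt_top_of_isSchnorrRandom`).

Conversely, for a sequential test `(Uₙ)` the function `T = ∑ 1_{Uₙ}` has the computable integral `∑
ν(Uₙ)`. Hence a subsequence of the approximation whose integrals converge at the rate `2⁻ˡ` can be
computed. The positive parts of its successive differences are basic functions `w l` with `∫ w l dν
≤ 2⁻ˡ`, and their sum is infinite wherever `T` is (`IsLowerApprox.exists_series`). At other measures
`ρ` this series may have infinite integral. Its `l`-th term is therefore multiplied by a continuous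
cutoff in `∫ w l dρ` that is `1` up to `2⁻ˡ` and `0` beyond `2 * 2⁻ˡ`. Now the `l`-th term has
integral at most `2 * 2⁻ˡ` for every `ρ`, so the total is finite and computable on all of `𝓜(X)`,
while at `ν` nothing has changed (`isUniformSchnorrIntegralTest_seriesTest`). -/

@[fun_prop]
theorem computable_fst {f : α → β × γ} (hf : Computable f) : Computable fun a => (f a).1 :=
  Computable.fst.comp hf

@[fun_prop]
theorem computable_snd {f : α → β × γ} (hf : Computable f) : Computable fun a => (f a).2 :=
  Computable.snd.comp hf

@[fun_prop]
theorem computable_prodMk {f : α → β} {g : α → γ} (hf : Computable f) (hg : Computable g) :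
    Computable fun a => (f a, g a) :=
  hf.pair hg

@[fun_prop]
theorem computable_add {f g : α → ℕ} (hf : Computable f) (hg : Computable g) :
    Computable fun a => f a + g a :=
  Primrec.nat_add.to_comp.comp hf hg

@[fun_prop]
theorem computable_sub {f g : α → ℕ} (hf : Computable f) (hg : Computable g) :
    Computable fun a => f a - g a :=
  Primrec.nat_sub.to_comp.comp hf hg

@[fun_prop]
theorem computable_mul {f g : α → ℕ} (hf : Computable f) (hg : Computable g) :
    Computable fun a => f a * g a :=
  Primrec.nat_mul.to_comp.comp hf hg

@[fun_prop]
theorem computable_div {f g : α → ℕ} (hf : Computable f) (hg : Computable g) :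
    Computable fun a => f a / g a :=
  Primrec.nat_div.to_comp.comp hf hg

@[fun_prop]
theorem computable_mod {f g : α → ℕ} (hf : Computable f) (hg : Computable g) :
    Computable fun a => f a % g a :=
  Primrec.nat_mod.to_comp.comp hf hg

@[fun_prop]
theorem computable_pow {f g : α → ℕ} (hf : Computable f) (hg : Computable g) :
    Computable fun a => f a ^ g a :=
  (Primrec₂.unpaired'.1 Nat.Primrec.pow).to_comp.comp hf hg

@[fun_prop]
theorem computable_natPair {f g : α → ℕ} (hf : Computable f) (hg : Computable g) :
    Computable fun a => Nat.pair (f a) (g a) :=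
  Primrec₂.natPair.to_comp.comp hf hg

@[fun_prop]
theorem computable_unpair {f : α → ℕ} (hf : Computable f) : Computable fun a => (f a).unpair :=
  Computable.unpair.comp hf

@[fun_prop]
theorem computable_decide_le {f g : α → ℕ} (hf : Computable f) (hg : Computable g) :
    Computable fun a => decide (f a ≤ g a) :=
  (Primrec.nat_le.decide.to_comp).comp hf hg

@[fun_prop]
theorem computable_decide_lt {f g : α → ℕ} (hf : Computable f) (hg : Computable g) :
    Computable fun a => decide (f a < g a) :=
  (Primrec.nat_lt.decide.to_comp).comp hf hg

@[fun_prop]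
theorem computable_decide_eq {f g : α → ℕ} (hf : Computable f) (hg : Computable g) :
    Computable fun a => decide (f a = g a) :=
  ((Primrec.eq (α := ℕ)).decide.to_comp).comp hf hg

@[fun_prop]
theorem computable_and {f g : α → Bool} (hf : Computable f) (hg : Computable g) :
    Computable fun a => (f a && g a) :=
  Primrec.and.to_comp.comp hf hg

@[fun_prop]
theorem computable_or {f g : α → Bool} (hf : Computable f) (hg : Computable g) :
    Computable fun a => (f a || g a) :=
  Primrec.or.to_comp.comp hf hg

@[fun_prop]
theorem computable_cond {c : α → Bool} {f g : α → σ} (hc : Computable c) (hf : Computable f)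
    (hg : Computable g) : Computable fun a => bif c a then f a else g a :=
  Computable.cond hc hf hg

@[fun_prop]
theorem computable_ite {c : α → Prop} [DecidablePred c] {f g : α → σ}
    (hc : Computable fun a => decide (c a)) (hf : Computable f) (hg : Computable g) :
    Computable fun a => if c a then f a else g a :=
  (Computable.cond hc hf hg).of_eq fun a => by by_cases h : c a <;> simp [h]

@[fun_prop]
theorem computable_list_length {f : α → List β} (hf : Computable f) :
    Computable fun a => (f a).length :=
  Computable.list_length.comp hf

@[fun_prop]
theorem computable_list_getD {f : α → List β} {g : α → ℕ} {d : α → β} (hf : Computable f)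
    (hg : Computable g) (hd : Computable d) : Computable fun a => (f a).getD (g a) (d a) :=
  (Computable.option_getD (Computable.list_getElem?.comp hf hg) hd).of_eq fun a => by
    simp [List.getD_eq_getElem?_getD]

@[fun_prop]
theorem computable_list_append {f g : α → List β} (hf : Computable f) (hg : Computable g) :
    Computable fun a => f a ++ g a :=
  Computable.list_append.comp hf hg

@[fun_prop]
theorem computable_list_cons {f : α → β} {g : α → List β} (hf : Computable f)
    (hg : Computable g) : Computable fun a => f a :: g a :=
  Computable.list_cons.comp hf hg

@[fun_prop]
theorem computable_isSome {f : α → Option β} (hf : Computable f) :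
    Computable fun a => (f a).isSome :=
  Primrec.option_isSome.to_comp.comp hf

@[fun_prop]
theorem computable_getD {f : α → Option β} {g : α → β} (hf : Computable f) (hg : Computable g) :
    Computable fun a => (f a).getD (g a) :=
  Computable.option_getD hf hg

@[fun_prop]
theorem computable_ofNat_list {f : α → ℕ} (hf : Computable f) :
    Computable fun a => (Denumerable.ofNat (List ℕ) (f a)) :=
  (Computable.ofNat (List ℕ)).comp hf

@[fun_prop]
theorem computable_encode {f : α → β} (hf : Computable f) :
    Computable fun a => Encodable.encode (f a) :=
  Computable.encode.comp hf

/-- A function defined by recursion on its last argument is computable. -/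
theorem computable_of_rec {f : α → ℕ → σ} {g : α → σ} {h : α → ℕ → σ → σ} (hg : Computable g)
    (hh : Computable fun p : α × ℕ × σ => h p.1 p.2.1 p.2.2) (h0 : ∀ a, f a 0 = g a)
    (hs : ∀ a n, f a (n + 1) = h a n (f a n)) : Computable fun p : α × ℕ => f p.1 p.2 := by
  have h1 : Computable fun p : α × ℕ => (Nat.rec (g p.1) (fun n s => h p.1 n s) p.2 : σ) :=
    Computable.nat_rec (f := fun p : α × ℕ => p.2) (g := fun p : α × ℕ => g p.1)
      (h := fun p q => h p.1 q.1 q.2) (by fun_prop) (by fun_prop)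
      (by show Computable fun q : (α × ℕ) × (ℕ × σ) => h q.1.1 q.2.1 q.2.2
          exact hh.comp (g := fun q : (α × ℕ) × (ℕ × σ) => (q.1.1, q.2.1, q.2.2)) (by fun_prop))
  refine h1.of_eq fun p => ?_
  obtain ⟨a, n⟩ := p
  induction n with
  | zero => simp [h0]
  | succ n ih => simp only [hs] at ih ⊢; rw [← ih]

theorem computable_list_range_map {f : α → ℕ → β} (hf : Computable fun p : α × ℕ => f p.1 p.2) :
    Computable fun p : α × ℕ => (List.range p.2).map (f p.1) := by
  refine computable_of_rec (f := fun a n => (List.range n).map (f a)) (g := fun _ => [])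
    (h := fun a n l => l ++ [f a n]) (by fun_prop) ?_ (by simp) ?_
  · have : Computable fun p : α × ℕ × List β => f p.1 p.2.1 :=
      hf.comp (g := fun p : α × ℕ × List β => (p.1, p.2.1)) (by fun_prop)
    fun_prop
  · intro a n
    simp [List.range_succ]

/-- Bounded existential quantification of a Boolean predicate. -/
def existsLt (q : ℕ → Bool) : ℕ → Bool
  | 0 => false
  | n + 1 => existsLt q n || q n

/-- Bounded universal quantification of a Boolean predicate. -/
def forallLt (q : ℕ → Bool) : ℕ → Bool
  | 0 => true
  | n + 1 => forallLt q n && q n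

theorem existsLt_iff (q : ℕ → Bool) (n : ℕ) : existsLt q n = true ↔ ∃ i < n, q i = true := by
  induction n with
  | zero => simp [existsLt]
  | succ n ih => rw [existsLt, Bool.or_eq_true, ih, Nat.exists_lt_succ_right]

theorem forallLt_iff (q : ℕ → Bool) (n : ℕ) : forallLt q n = true ↔ ∀ i < n, q i = true := by
  induction n with
  | zero => simp [forallLt]
  | succ n ih => rw [forallLt, Bool.and_eq_true, ih, Nat.forall_lt_succ_right]

theorem computable_existsLt {q : α → ℕ → Bool} (hq : Computable fun p : α × ℕ => q p.1 p.2) :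
    Computable fun p : α × ℕ => existsLt (q p.1) p.2 :=
  computable_of_rec (f := fun a n => existsLt (q a) n) (g := fun _ => false)
    (h := fun a n b => b || q a n) (by fun_prop)
    (computable_or (by fun_prop) (hq.comp (g := fun p : α × ℕ × Bool => (p.1, p.2.1))
      (by fun_prop))) (fun _ => rfl) (fun _ _ => rfl)

theorem computable_forallLt {q : α → ℕ → Bool} (hq : Computable fun p : α × ℕ => q p.1 p.2) :
    Computable fun p : α × ℕ => forallLt (q p.1) p.2 :=
  computable_of_rec (f := fun a n => forallLt (q a) n) (g := fun _ => true)
    (h := fun a n b => b && q a n) (by fun_prop)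
    (computable_and (by fun_prop) (hq.comp (g := fun p : α × ℕ × Bool => (p.1, p.2.1))
      (by fun_prop))) (fun _ => rfl) (fun _ _ => rfl)

/-- Course-of-values recursion: the list of the first `n` values. -/
def courseOfValues {σ : Type*} (F : List σ → σ) : ℕ → List σ
  | 0 => []
  | n + 1 => courseOfValues F n ++ [F (courseOfValues F n)]

theorem length_courseOfValues {σ : Type*} (F : List σ → σ) (n : ℕ) :
    (courseOfValues F n).length = n := by
  induction n with
  | zero => rfl
  | succ n ih => simp [courseOfValues, ih]

theorem getD_courseOfValues {σ : Type*} (F : List σ → σ) {i n : ℕ} (h : i < n) (d : σ) :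
    (courseOfValues F n).getD i d = F (courseOfValues F i) := by
  induction n with
  | zero => omega
  | succ n ih =>
    rw [courseOfValues]
    rcases Nat.lt_succ_iff_lt_or_eq.1 h with h | rfl
    · rw [List.getD_append _ _ _ _ (by rwa [length_courseOfValues]), ih h]
    · rw [List.getD_append_right _ _ _ _ (by rw [length_courseOfValues])]
      simp [length_courseOfValues]

theorem computable_courseOfValues {F : α → List σ → σ}
    (hF : Computable fun p : α × List σ => F p.1 p.2) :
    Computable fun p : α × ℕ => courseOfValues (F p.1) p.2 := by
  refine computable_of_rec (f := fun a n => courseOfValues (F a) n) (g := fun _ => [])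
    (h := fun a _ l => l ++ [F a l]) (by fun_prop) ?_ (fun _ => rfl) (fun _ _ => rfl)
  have : Computable fun p : α × ℕ × List σ => F p.1 p.2.2 :=
    hF.comp (g := fun p : α × ℕ × List σ => (p.1, p.2.2)) (by fun_prop)
  fun_prop

/-- Natural-number valued finite sums of computable functions are computable. -/
theorem computable_natSum {f : α → ℕ → ℕ} (hf : Computable fun p : α × ℕ => f p.1 p.2) :
    Computable fun p : α × ℕ => ∑ i ∈ Finset.range p.2, f p.1 i :=
  computable_of_rec (f := fun a n => ∑ i ∈ Finset.range n, f a i) (g := fun _ => 0)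
    (h := fun a n s => s + f a n) (by fun_prop)
    (computable_add (by fun_prop) (hf.comp (g := fun p : α × ℕ × ℕ => (p.1, p.2.1))
      (by fun_prop))) (fun _ => by simp) (fun _ _ => Finset.sum_range_succ _ _)

/-! ### Semidecidable predicates -/

/-- A predicate is semidecidable if it is the projection of a computable one. -/
def Semidecidable (p : α → Prop) : Prop :=
  ∃ q : α → ℕ → Bool, (Computable fun x : α × ℕ => q x.1 x.2) ∧ ∀ a, p a ↔ ∃ k, q a k = true

theorem Semidecidable.of_bool {q : α → Bool} (hq : Computable q) :
    Semidecidable fun a => q a = true :=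
  ⟨fun a _ => q a, by fun_prop, fun a => by simp⟩

theorem Semidecidable.and {p r : α → Prop} (hp : Semidecidable p) (hr : Semidecidable r) :
    Semidecidable fun a => p a ∧ r a := by
  obtain ⟨q, hq, h⟩ := hp
  obtain ⟨s, hs, h'⟩ := hr
  refine ⟨fun a k => q a k.unpair.1 && s a k.unpair.2, computable_and
    (hq.comp (g := fun x : α × ℕ => (x.1, x.2.unpair.1)) (by fun_prop))
    (hs.comp (g := fun x : α × ℕ => (x.1, x.2.unpair.2)) (by fun_prop)), fun a => ?_⟩
  refine (and_congr (h a) (h' a)).trans ?_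
  constructor
  · rintro ⟨⟨k, hk⟩, l, hl⟩
    exact ⟨Nat.pair k l, by simp [hk, hl]⟩
  · rintro ⟨k, hk⟩
    simp only [Bool.and_eq_true] at hk
    exact ⟨⟨_, hk.1⟩, _, hk.2⟩

/-- The search runs through all numbers as codes of `b`; a number that codes nothing is rejected. -/
theorem Semidecidable.exists {p : α → β → Prop} (hp : Semidecidable fun x : α × β => p x.1 x.2) :
    Semidecidable fun a => ∃ b, p a b := by
  obtain ⟨q, hq, h⟩ := hp
  refine ⟨fun a k => Option.casesOn (Encodable.decode (α := β) k.unpair.1) false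
    fun b => q (a, b) k.unpair.2, ?_, fun a => ?_⟩
  · exact Computable.option_casesOn (o := fun x : α × ℕ =>
      (Encodable.decode (α := β) x.2.unpair.1)) (f := fun _ => false)
      (g := fun (x : α × ℕ) b => q (x.1, b) x.2.unpair.2)
      (Computable.decode.comp (by fun_prop)) (by fun_prop)
      (hq.comp (g := fun y : (α × ℕ) × β => ((y.1.1, y.2), y.1.2.unpair.2)) (by fun_prop))
  · constructor
    · rintro ⟨b, hb⟩
      obtain ⟨k, hk⟩ := (h (a, b)).1 hb
      exact ⟨Nat.pair (Encodable.encode b) k, by simpa using hk⟩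
    · rintro ⟨k, hk⟩
      cases hb : (Encodable.decode (α := β) k.unpair.1) with
      | none => simp [hb] at hk
      | some b => exact ⟨b, (h (a, b)).2 ⟨k.unpair.2, by simpa [hb] using hk⟩⟩

/-- Finitely many witnesses have a common bound, so a single number can bound all the searches at
once. -/
theorem Semidecidable.forall_lt {p : α → ℕ → Prop}
    (hp : Semidecidable fun x : α × ℕ => p x.1 x.2) {n : α → ℕ} (hn : Computable n) :
    Semidecidable fun a => ∀ i < n a, p a i := by
  obtain ⟨q, hq, h⟩ := hp
  have h1 : Computable fun x : (α × ℕ) × ℕ => existsLt (q (x.1.1, x.2)) x.1.2 :=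
    (computable_existsLt (q := q) hq).comp
      (g := fun x : (α × ℕ) × ℕ => ((x.1.1, x.2), x.1.2)) (by fun_prop)
  have h2 := computable_forallLt (q := fun (x : α × ℕ) i => existsLt (q (x.1, i)) x.2) h1
  refine ⟨fun a k => forallLt (fun i => existsLt (q (a, i)) k) (n a),
    h2.comp (g := fun x : α × ℕ => (x, n x.1)) (by fun_prop), fun a => ?_⟩
  simp only [forallLt_iff, existsLt_iff]
  constructor
  · intro H
    choose! w hw using fun i hi => (h (a, i)).1 (H i hi)
    refine ⟨(Finset.range (n a)).sup w + 1, fun i hi => ⟨w i, ?_, hw i hi⟩⟩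
    exact Nat.lt_succ_of_le (Finset.le_sup (f := w) (Finset.mem_range.2 hi))
  · rintro ⟨K, hK⟩ i hi
    obtain ⟨j, _, hj⟩ := hK i hi
    exact (h (a, i)).2 ⟨j, hj⟩

/-- A semidecidable relation that is total has a computable choice function. -/
theorem Semidecidable.choice {p : α → ℕ → Prop} (hp : Semidecidable fun x : α × ℕ => p x.1 x.2)
    (h : ∀ a, ∃ n, p a n) : ∃ f : α → ℕ, Computable f ∧ ∀ a, p a (f a) := by
  obtain ⟨q, hq, hpq⟩ := hp
  have hex : ∀ a, ∃ w : ℕ, q (a, w.unpair.1) w.unpair.2 = true := fun a => by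
    obtain ⟨n, hn⟩ := h a
    obtain ⟨k, hk⟩ := (hpq (a, n)).1 hn
    exact ⟨Nat.pair n k, by simpa using hk⟩
  have hc : Computable fun x : α × ℕ => q (x.1, x.2.unpair.1) x.2.unpair.2 :=
    hq.comp (g := fun x : α × ℕ => ((x.1, x.2.unpair.1), x.2.unpair.2)) (by fun_prop)
  -- The relation cannot be decided, so the search runs over pairs of a value and a witness for it.
  have hf : Computable fun a => Nat.find (hex a) :=
    Computable.find (P := fun a w => q (a, w.unpair.1) w.unpair.2 = true)
      (Computable.computablePred (hc.of_eq fun x => by simp)) hex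
  exact ⟨fun a => (Nat.find (hex a)).unpair.1, by fun_prop,
    fun a => (hpq (a, _)).2 ⟨_, Nat.find_spec (hex a)⟩⟩

end Computability

/-! ### Arithmetic on codes of rational numbers -/

/-- The code of `(a - b) / (c + 1)`. -/
def qmk (a b c : ℕ) : ℕ := Nat.pair a (Nat.pair b c)

/-- Addition on codes. -/
def qadd (x y : ℕ) : ℕ :=
  qmk (x.unpair.1 * (y.unpair.2.unpair.2 + 1) + y.unpair.1 * (x.unpair.2.unpair.2 + 1))
    (x.unpair.2.unpair.1 * (y.unpair.2.unpair.2 + 1) +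
      y.unpair.2.unpair.1 * (x.unpair.2.unpair.2 + 1))
    (x.unpair.2.unpair.2 * y.unpair.2.unpair.2 + x.unpair.2.unpair.2 + y.unpair.2.unpair.2)

/-- Negation on codes. -/
def qneg (x : ℕ) : ℕ := qmk x.unpair.2.unpair.1 x.unpair.1 x.unpair.2.unpair.2

/-- Multiplication on codes. -/
def qmul (x y : ℕ) : ℕ :=
  qmk (x.unpair.1 * y.unpair.1 + x.unpair.2.unpair.1 * y.unpair.2.unpair.1)
    (x.unpair.1 * y.unpair.2.unpair.1 + x.unpair.2.unpair.1 * y.unpair.1)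
    (x.unpair.2.unpair.2 * y.unpair.2.unpair.2 + x.unpair.2.unpair.2 + y.unpair.2.unpair.2)

/-- Comparison of codes. -/
def qlt (x y : ℕ) : Bool :=
  decide (x.unpair.1 * (y.unpair.2.unpair.2 + 1) +
      y.unpair.2.unpair.1 * (x.unpair.2.unpair.2 + 1) <
    y.unpair.1 * (x.unpair.2.unpair.2 + 1) + x.unpair.2.unpair.1 * (y.unpair.2.unpair.2 + 1))

/-- Maximum on codes. -/
def qmax (x y : ℕ) : ℕ := bif qlt x y then y else x

/-- Minimum on codes. -/
def qmin (x y : ℕ) : ℕ := bif qlt x y then x else y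

/-- The code of `2⁻ᵏ`. -/
def qhalfPow (k : ℕ) : ℕ := qmk 1 0 (2 ^ k - 1)

/-- The code, as a rational, of a positive rational. -/
def qpos (k : ℕ) : ℕ := qmk (k.unpair.1 + 1) 0 k.unpair.2

@[simp]
theorem ratOfNat_qmk (a b c : ℕ) : ratOfNat (qmk a b c) = ((a : ℚ) - b) / (c + 1) := by
  simp [ratOfNat, qmk]

@[simp]
theorem ratOfNat_qadd (x y : ℕ) : ratOfNat (qadd x y) = ratOfNat x + ratOfNat y := by
  rw [qadd, ratOfNat_qmk, ratOfNat, ratOfNat]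
  have h1 : ((x.unpair.2.unpair.2 : ℚ) + 1) ≠ 0 := by positivity
  have h2 : ((y.unpair.2.unpair.2 : ℚ) + 1) ≠ 0 := by positivity
  -- Denominators are stored minus one, and `(c + 1)(c' + 1) - 1 = cc' + c + c'`.
  have h3 : ((x.unpair.2.unpair.2 * y.unpair.2.unpair.2 + x.unpair.2.unpair.2 +
      y.unpair.2.unpair.2 : ℕ) : ℚ) + 1 =
      ((x.unpair.2.unpair.2 : ℚ) + 1) * ((y.unpair.2.unpair.2 : ℚ) + 1) := by push_cast; ring
  rw [h3, div_add_div _ _ h1 h2]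
  push_cast
  ring

@[simp]
theorem ratOfNat_qneg (x : ℕ) : ratOfNat (qneg x) = - ratOfNat x := by
  rw [qneg, ratOfNat_qmk, ratOfNat]
  ring

@[simp]
theorem ratOfNat_qmul (x y : ℕ) : ratOfNat (qmul x y) = ratOfNat x * ratOfNat y := by
  rw [qmul, ratOfNat_qmk, ratOfNat, ratOfNat]
  have h3 : ((x.unpair.2.unpair.2 * y.unpair.2.unpair.2 + x.unpair.2.unpair.2 +
      y.unpair.2.unpair.2 : ℕ) : ℚ) + 1 =
      ((x.unpair.2.unpair.2 : ℚ) + 1) * ((y.unpair.2.unpair.2 : ℚ) + 1) := by push_cast; ring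
  rw [h3, div_mul_div_comm]
  push_cast
  ring

theorem qlt_iff (x y : ℕ) : qlt x y = true ↔ ratOfNat x < ratOfNat y := by
  rw [qlt, decide_eq_true_iff, ratOfNat, ratOfNat, div_lt_div_iff₀ (by positivity) (by positivity),
    ← Nat.cast_lt (α := ℚ)]
  push_cast
  constructor <;> intro h <;> linarith

@[simp]
theorem ratOfNat_qmax (x y : ℕ) : ratOfNat (qmax x y) = max (ratOfNat x) (ratOfNat y) := by
  rw [qmax]
  by_cases h : ratOfNat x < ratOfNat y
  · rw [(qlt_iff x y).2 h, max_eq_right h.le, cond_true]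
  · rw [Bool.eq_false_iff.2 (fun h' => h ((qlt_iff x y).1 h')), max_eq_left (not_lt.1 h),
      cond_false]

@[simp]
theorem ratOfNat_qmin (x y : ℕ) : ratOfNat (qmin x y) = min (ratOfNat x) (ratOfNat y) := by
  rw [qmin]
  by_cases h : ratOfNat x < ratOfNat y
  · rw [(qlt_iff x y).2 h, min_eq_left h.le, cond_true]
  · rw [Bool.eq_false_iff.2 (fun h' => h ((qlt_iff x y).1 h')), min_eq_right (not_lt.1 h),
      cond_false]

@[simp]
theorem ratOfNat_qhalfPow (k : ℕ) : ratOfNat (qhalfPow k) = 2⁻¹ ^ k := by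
  rw [qhalfPow, ratOfNat_qmk, Nat.cast_sub (Nat.one_le_two_pow)]
  simp

@[simp]
theorem ratOfNat_qpos (k : ℕ) : ratOfNat (qpos k) = posRat k := by
  simp [qpos, posRat]

theorem posRat_pos (k : ℕ) : 0 < posRat k := by
  unfold posRat; positivity

theorem posRat_natPair (a b : ℕ) : posRat (Nat.pair a b) = ((a : ℚ) + 1) / (b + 1) := by
  simp [posRat]

theorem exists_posRat {q : ℚ} (hq : 0 < q) : ∃ k, posRat k = q := by
  refine ⟨Nat.pair (q.num.toNat - 1) (q.den - 1), ?_⟩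
  have h1 : 0 < q.num := Rat.num_pos.2 hq
  have h2 : 0 < q.den := q.den_pos
  have h3 : ((q.num.toNat - 1 : ℕ) : ℚ) + 1 = q.num := by
    have : ((q.num.toNat - 1 : ℕ) : ℤ) + 1 = q.num := by omega
    exact_mod_cast this
  have h4 : ((q.den - 1 : ℕ) : ℚ) + 1 = q.den := by
    have : (q.den - 1 : ℕ) + 1 = q.den := by omega
    exact_mod_cast this
  rw [posRat_natPair, h3, h4, Rat.num_div_den]

theorem exists_ratOfNat (q : ℚ) : ∃ k, ratOfNat k = q := by
  rcases lt_trichotomy q 0 with h | rfl | h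
  · obtain ⟨k, hk⟩ := exists_posRat (neg_pos.2 h)
    exact ⟨qneg (qpos k), by simp [hk]⟩
  · exact ⟨qmk 0 0 0, by simp⟩
  · obtain ⟨k, hk⟩ := exists_posRat h
    exact ⟨qpos k, by simp [hk]⟩

/-- The code of the inverse of a positive rational. -/
def posInv (k : ℕ) : ℕ := Nat.pair k.unpair.2 k.unpair.1

theorem posRat_posInv (k : ℕ) : posRat (posInv k) = (posRat k)⁻¹ := by
  simp [posRat, posInv]

/-- Dropping the denominator, which is at least one, leaves a bound that can be read off the code.
-/
theorem abs_ratOfNat_le (k : ℕ) :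
    |ratOfNat k| ≤ ((k.unpair.1 + k.unpair.2.unpair.1 : ℕ) : ℚ) := by
  rw [ratOfNat, abs_div, abs_of_pos (by positivity : (0 : ℚ) < (k.unpair.2.unpair.2 : ℚ) + 1)]
  refine (div_le_self (abs_nonneg _) (by simp)).trans ((abs_sub _ _).trans ?_)
  simp

section

variable {α : Type*} [Primcodable α]

@[fun_prop]
theorem computable_qmk {f g h : α → ℕ} (hf : Computable f) (hg : Computable g)
    (hh : Computable h) : Computable fun a => qmk (f a) (g a) (h a) := by
  unfold qmk; fun_prop

@[fun_prop]
theorem computable_qadd {f g : α → ℕ} (hf : Computable f) (hg : Computable g) :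
    Computable fun a => qadd (f a) (g a) := by
  unfold qadd; fun_prop

@[fun_prop]
theorem computable_qneg {f : α → ℕ} (hf : Computable f) : Computable fun a => qneg (f a) := by
  unfold qneg; fun_prop

@[fun_prop]
theorem computable_qmul {f g : α → ℕ} (hf : Computable f) (hg : Computable g) :
    Computable fun a => qmul (f a) (g a) := by
  unfold qmul; fun_prop

@[fun_prop]
theorem computable_qlt {f g : α → ℕ} (hf : Computable f) (hg : Computable g) :
    Computable fun a => qlt (f a) (g a) :=
  computable_decide_lt (by fun_prop) (by fun_prop)

@[fun_prop]
theorem computable_qmax {f g : α → ℕ} (hf : Computable f) (hg : Computable g) :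
    Computable fun a => qmax (f a) (g a) := by
  unfold qmax; fun_prop

@[fun_prop]
theorem computable_qmin {f g : α → ℕ} (hf : Computable f) (hg : Computable g) :
    Computable fun a => qmin (f a) (g a) := by
  unfold qmin; fun_prop

@[fun_prop]
theorem computable_qhalfPow {f : α → ℕ} (hf : Computable f) :
    Computable fun a => qhalfPow (f a) :=
  computable_qmk (Computable.const 1) (Computable.const 0)
    (computable_sub (computable_pow (Computable.const 2) hf) (Computable.const 1))

@[fun_prop]
theorem computable_qpos {f : α → ℕ} (hf : Computable f) : Computable fun a => qpos (f a) := by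
  unfold qpos; fun_prop

@[fun_prop]
theorem computable_posInv {f : α → ℕ} (hf : Computable f) :
    Computable fun a => posInv (f a) := by
  unfold posInv; fun_prop

end

/-! ### Uniformly computable families of real numbers -/

section ComputableReals

variable {α β : Type*} [Primcodable α] [Primcodable β]

/-- A family of real numbers is computable if rational approximations to any prescribed precision
can be computed uniformly. -/
def ComputableReals (f : α → ℝ) : Prop :=
  ∃ g : α → ℕ → ℕ, (Computable fun p : α × ℕ => g p.1 p.2) ∧
    ∀ a k, |(ratOfNat (g a k) : ℝ) - f a| ≤ (2 : ℝ)⁻¹ ^ k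

theorem half_pow_add_half_pow (k : ℕ) :
    (2 : ℝ)⁻¹ ^ (k + 1) + (2 : ℝ)⁻¹ ^ (k + 1) = (2 : ℝ)⁻¹ ^ k := by
  rw [pow_succ]; ring

/-- As `n ≤ 2ⁿ`, raising the precision by `n` absorbs an error factor `n`. All later precisions are
chosen in this way. -/
theorem natCast_mul_half_pow_le (n k : ℕ) : (n : ℝ) * (2 : ℝ)⁻¹ ^ (k + n) ≤ (2 : ℝ)⁻¹ ^ k := by
  have h : (n : ℝ) ≤ 2 ^ n := by exact_mod_cast (Nat.lt_two_pow_self (n := n)).le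
  rw [pow_add, mul_comm, mul_assoc]
  refine mul_le_of_le_one_right (by positivity) ?_
  rw [inv_pow, inv_mul_le_iff₀ (by positivity), mul_one]
  exact h

theorem half_pow_le_half_pow {k l : ℕ} (h : k ≤ l) : (2 : ℝ)⁻¹ ^ l ≤ (2 : ℝ)⁻¹ ^ k :=
  pow_le_pow_of_le_one (by norm_num) (by norm_num) h

theorem exists_half_pow_lt {ε : ℝ} (hε : 0 < ε) : ∃ k : ℕ, (2 : ℝ)⁻¹ ^ k < ε :=
  exists_pow_lt_of_lt_one hε (by norm_num)

theorem ComputableReals.of_eq {f g : α → ℝ} (hf : ComputableReals f) (h : ∀ a, f a = g a) :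
    ComputableReals g :=
  funext h ▸ hf

theorem ComputableReals.comp {f : β → ℝ} (hf : ComputableReals f) {g : α → β}
    (hg : Computable g) : ComputableReals fun a => f (g a) := by
  obtain ⟨F, hF, h⟩ := hf
  exact ⟨fun a k => F (g a) k, hF.comp (g := fun p : α × ℕ => (g p.1, p.2)) (by fun_prop),
    fun a k => h _ k⟩

theorem ComputableReals.ratOfNat {c : α → ℕ} (hc : Computable c) :
    ComputableReals fun a => (ratOfNat (c a) : ℝ) :=
  ⟨fun a _ => c a, by fun_prop, fun a k => by simp⟩

theorem ComputableReals.posRat {c : α → ℕ} (hc : Computable c) :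
    ComputableReals fun a => (posRat (c a) : ℝ) :=
  (ComputableReals.ratOfNat (c := fun a => qpos (c a)) (by fun_prop)).of_eq fun a => by simp

theorem ComputableReals.half_pow {c : α → ℕ} (hc : Computable c) :
    ComputableReals fun a => (2 : ℝ)⁻¹ ^ c a :=
  (ComputableReals.ratOfNat (c := fun a => qhalfPow (c a)) (by fun_prop)).of_eq fun a => by simp

theorem ComputableReals.natCast {c : α → ℕ} (hc : Computable c) :
    ComputableReals fun a => (c a : ℝ) :=
  (ComputableReals.ratOfNat (c := fun a => qmk (c a) 0 0) (by fun_prop)).of_eq fun a => by simp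

theorem ComputableReals.ratCast (q : ℚ) : ComputableReals fun _ : α => (q : ℝ) := by
  obtain ⟨k, rfl⟩ := exists_ratOfNat q
  exact ComputableReals.ratOfNat (by fun_prop)

/-- A family of real numbers is computable if it is a fast limit of a computable family. -/
theorem ComputableReals.of_approx {f : α → ℝ} {F : α → ℕ → ℝ}
    (hF : ComputableReals fun p : α × ℕ => F p.1 p.2)
    (h : ∀ a k, |F a k - f a| ≤ (2 : ℝ)⁻¹ ^ k) : ComputableReals f := by
  obtain ⟨g, hg, hgF⟩ := hF
  refine ⟨fun a k => g (a, k + 1) (k + 1),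
    hg.comp (g := fun p : α × ℕ => ((p.1, p.2 + 1), p.2 + 1)) (by fun_prop), fun a k => ?_⟩
  refine (abs_sub_le _ (F a (k + 1)) _).trans ?_
  rw [← half_pow_add_half_pow k]
  exact add_le_add (hgF (a, k + 1) (k + 1)) (h a (k + 1))

theorem ComputableReals.neg {f : α → ℝ} (hf : ComputableReals f) :
    ComputableReals fun a => - f a := by
  obtain ⟨F, hF, h⟩ := hf
  refine ⟨fun a k => qneg (F a k), by fun_prop, fun a k => ?_⟩
  rw [ratOfNat_qneg, Rat.cast_neg, ← abs_neg]
  convert h a k using 2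
  ring

theorem ComputableReals.add {f g : α → ℝ} (hf : ComputableReals f) (hg : ComputableReals g) :
    ComputableReals fun a => f a + g a := by
  obtain ⟨F, hF, h⟩ := hf
  obtain ⟨G, hG, h'⟩ := hg
  refine ⟨fun a k => qadd (F a (k + 1)) (G a (k + 1)), computable_qadd
    (hF.comp (g := fun p : α × ℕ => (p.1, p.2 + 1)) (by fun_prop))
    (hG.comp (g := fun p : α × ℕ => (p.1, p.2 + 1)) (by fun_prop)), fun a k => ?_⟩
  rw [ratOfNat_qadd, Rat.cast_add, ← half_pow_add_half_pow k, add_sub_add_comm]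
  exact (abs_add_le _ _).trans (add_le_add (h a _) (h' a _))

theorem ComputableReals.sub {f g : α → ℝ} (hf : ComputableReals f) (hg : ComputableReals g) :
    ComputableReals fun a => f a - g a :=
  (hf.add hg.neg).of_eq fun _ => (sub_eq_add_neg _ _).symm

theorem ComputableReals.max {f g : α → ℝ} (hf : ComputableReals f) (hg : ComputableReals g) :
    ComputableReals fun a => max (f a) (g a) := by
  obtain ⟨F, hF, h⟩ := hf
  obtain ⟨G, hG, h'⟩ := hg
  refine ⟨fun a k => qmax (F a k) (G a k), by fun_prop, fun a k => ?_⟩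
  rw [ratOfNat_qmax, Rat.cast_max]
  exact (abs_max_sub_max_le_max _ _ _ _).trans (max_le (h a k) (h' a k))

theorem ComputableReals.min {f g : α → ℝ} (hf : ComputableReals f) (hg : ComputableReals g) :
    ComputableReals fun a => min (f a) (g a) := by
  obtain ⟨F, hF, h⟩ := hf
  obtain ⟨G, hG, h'⟩ := hg
  refine ⟨fun a k => qmin (F a k) (G a k), by fun_prop, fun a k => ?_⟩
  rw [ratOfNat_qmin, Rat.cast_min]
  exact (abs_min_sub_min_le_max _ _ _ _).trans (max_le (h a k) (h' a k))

/-- A computable family of real numbers has computable bounds. -/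
theorem ComputableReals.exists_bound {f : α → ℝ} (hf : ComputableReals f) :
    ∃ B : α → ℕ, Computable B ∧ ∀ a, |f a| ≤ B a := by
  obtain ⟨F, hF, h⟩ := hf
  have hF0 : Computable fun a => F a 0 := hF.comp (g := fun a => (a, 0)) (by fun_prop)
  -- The approximation of precision `0` has error at most `1`, which accounts for the last summand.
  refine ⟨fun a => (F a 0).unpair.1 + (F a 0).unpair.2.unpair.1 + 1, by fun_prop, fun a => ?_⟩
  have h1 := h a 0
  have h2 : |(CompAnalysis.ratOfNat (F a 0) : ℝ)| ≤
      ((F a 0).unpair.1 + (F a 0).unpair.2.unpair.1 : ℕ) := by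
    exact_mod_cast abs_ratOfNat_le (F a 0)
  have h3 := abs_sub_abs_le_abs_sub (f a) (CompAnalysis.ratOfNat (F a 0) : ℝ)
  rw [abs_sub_comm] at h3
  push_cast at h2 ⊢
  norm_num at h1
  linarith

/-- If both factors have error at most `ε ≤ 1` and are bounded by `B` and `C`, the product has error
at most `(B + C + 1) * ε`. -/
theorem ComputableReals.mul {f g : α → ℝ} (hf : ComputableReals f) (hg : ComputableReals g) :
    ComputableReals fun a => f a * g a := by
  obtain ⟨B, hB, hfB⟩ := hf.exists_bound
  obtain ⟨C, hC, hgC⟩ := hg.exists_bound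
  obtain ⟨F, hF, h⟩ := hf
  obtain ⟨G, hG, h'⟩ := hg
  refine ⟨fun a k => qmul (F a (k + (B a + C a + 1))) (G a (k + (B a + C a + 1))), computable_qmul
    (hF.comp (g := fun p : α × ℕ => (p.1, p.2 + (B p.1 + C p.1 + 1))) (by fun_prop))
    (hG.comp (g := fun p : α × ℕ => (p.1, p.2 + (B p.1 + C p.1 + 1))) (by fun_prop)),
    fun a k => ?_⟩
  rw [ratOfNat_qmul, Rat.cast_mul]
  refine le_trans ?_ (natCast_mul_half_pow_le (B a + C a + 1) k)
  set ε : ℝ := (2 : ℝ)⁻¹ ^ (k + (B a + C a + 1)) with hε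
  have hε0 : 0 ≤ ε := by positivity
  have hε1 : ε ≤ 1 := pow_le_one₀ (by norm_num) (by norm_num)
  have e1 := h a (k + (B a + C a + 1))
  have e2 := h' a (k + (B a + C a + 1))
  rw [← hε] at e1 e2
  set x : ℝ := (CompAnalysis.ratOfNat (F a (k + (B a + C a + 1))) : ℝ)
  set y : ℝ := (CompAnalysis.ratOfNat (G a (k + (B a + C a + 1))) : ℝ)
  have e3 : x * y - f a * g a = (x - f a) * (y - g a) + f a * (y - g a) + (x - f a) * g a := by
    ring
  rw [e3]
  have i1 : |(x - f a) * (y - g a)| ≤ 1 * ε := by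
    rw [abs_mul]; exact mul_le_mul (e1.trans hε1) e2 (abs_nonneg _) zero_le_one
  have i2 : |f a * (y - g a)| ≤ B a * ε := by
    rw [abs_mul]; exact mul_le_mul (hfB a) e2 (abs_nonneg _) (Nat.cast_nonneg _)
  have i3 : |(x - f a) * g a| ≤ ε * C a := by
    rw [abs_mul]; exact mul_le_mul e1 (hgC a) (abs_nonneg _) hε0
  refine (abs_add_three _ _ _).trans ?_
  push_cast
  linarith

theorem ComputableReals.sum {f : α → ℕ → ℝ} (hf : ComputableReals fun p : α × ℕ => f p.1 p.2) :
    ComputableReals fun p : α × ℕ => ∑ i ∈ Finset.range p.2, f p.1 i := by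
  obtain ⟨F, hF, h⟩ := hf
  have h1 : Computable fun p : (α × ℕ) × ℕ =>
      Nat.rec (motive := fun _ => ℕ) (qmk 0 0 0) (fun i s => qadd s (F (p.1.1, i) p.1.2)) p.2 := by
    refine computable_of_rec (α := α × ℕ)
      (f := fun a n => Nat.rec (motive := fun _ => ℕ) (qmk 0 0 0)
        (fun i s => qadd s (F (a.1, i) a.2)) n)
      (g := fun _ => qmk 0 0 0) (h := fun a i s => qadd s (F (a.1, i) a.2)) (by fun_prop)
      (computable_qadd (by fun_prop)
        (hF.comp (g := fun p : (α × ℕ) × ℕ × ℕ => ((p.1.1, p.2.1), p.1.2)) (by fun_prop)))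
      (fun _ => rfl) (fun _ _ => rfl)
  have h2 : ∀ a k n, (CompAnalysis.ratOfNat (Nat.rec (motive := fun _ => ℕ) (qmk 0 0 0)
      (fun i s => qadd s (F (a, i) k)) n) : ℝ) =
      ∑ i ∈ Finset.range n, (CompAnalysis.ratOfNat (F (a, i) k) : ℝ) := by
    intro a k n
    induction n with
    | zero => simp
    | succ n ih => rw [Finset.sum_range_succ, ← ih]; simp
  -- The `n` summands are each taken with error `2⁻¹ ^ (k + n)`.
  refine ⟨fun p k => Nat.rec (motive := fun _ => ℕ) (qmk 0 0 0)
    (fun i s => qadd s (F (p.1, i) (k + p.2))) p.2,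
    h1.comp (g := fun q : (α × ℕ) × ℕ => ((q.1.1, q.2 + q.1.2), q.1.2)) (by fun_prop), ?_⟩
  rintro ⟨a, n⟩ k
  simp only [h2, ← Finset.sum_sub_distrib]
  refine (Finset.abs_sum_le_sum_abs _ _).trans ?_
  refine (Finset.sum_le_card_nsmul _ _ _ fun i _ => h (a, i) (k + n)).trans ?_
  simpa using natCast_mul_half_pow_le n k

/-- A strict inequality is confirmed as soon as an approximation to `f - g` lies below zero by more
than its error. -/
theorem ComputableReals.semidecidable_lt {f g : α → ℝ} (hf : ComputableReals f)
    (hg : ComputableReals g) : Semidecidable fun a => f a < g a := by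
  obtain ⟨F, hF, h⟩ := hf.sub hg
  refine ⟨fun a k => qlt (qadd (F a k) (qhalfPow k)) (qmk 0 0 0), by fun_prop, fun a => ?_⟩
  simp only [qlt_iff, ratOfNat_qadd, ratOfNat_qhalfPow, ratOfNat_qmk]
  constructor
  · intro hlt
    -- Half of the gap pays for the error of the approximation, the other half for the margin
    -- required by the test.
    obtain ⟨k, hk⟩ := exists_half_pow_lt (ε := (g a - f a) / 2) (by linarith)
    refine ⟨k, ?_⟩
    have := (abs_le.1 (h a k)).2
    have h3 : ((CompAnalysis.ratOfNat (F a k) + 2⁻¹ ^ k : ℚ) : ℝ) < 0 := by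
      push_cast; linarith
    simpa using (by exact_mod_cast h3 : (CompAnalysis.ratOfNat (F a k) + 2⁻¹ ^ k : ℚ) < 0)
  · rintro ⟨k, hk⟩
    have h3 : ((CompAnalysis.ratOfNat (F a k) + 2⁻¹ ^ k : ℚ) : ℝ) < 0 := by
      have : (CompAnalysis.ratOfNat (F a k) + 2⁻¹ ^ k : ℚ) < 0 := by simpa using hk
      exact_mod_cast this
    push_cast at h3
    have := (abs_le.1 (h a k)).1
    linarith

end ComputableReals

/-! ### Cauchy names and computable points -/

section CauchyNames

variable {X : Type u} [PseudoMetricSpace X] [BasicPoints X]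

/-- The exponent `i + 1` leaves room for the two errors in the triangle inequality between two
entries. -/
theorem isCauchyName_of_dist_le {h : ℕ → ℕ} {y : X}
    (H : ∀ i, dist (BasicPoints.pt (h i) : X) y ≤ (2 : ℝ)⁻¹ ^ (i + 1)) : IsCauchyName h y := by
  refine ⟨fun i j hij => ?_, ?_⟩
  · refine (dist_triangle_right _ _ y).trans ?_
    rw [← half_pow_add_half_pow i]
    exact add_le_add ((H j).trans (half_pow_le_half_pow (by omega))) (H i)
  · rw [tendsto_iff_dist_tendsto_zero]
    refine squeeze_zero (fun _ => dist_nonneg) H ?_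
    exact (tendsto_pow_atTop_nhds_zero_of_lt_one (by norm_num) (by norm_num)).comp
      (tendsto_add_atTop_nat 1)

theorem IsCauchyName.dist_le {h : ℕ → ℕ} {y : X} (H : IsCauchyName h y) (i : ℕ) :
    dist (BasicPoints.pt (h i) : X) y ≤ (2 : ℝ)⁻¹ ^ i := by
  have h1 : Tendsto (fun j => dist (BasicPoints.pt (h i) : X) (BasicPoints.pt (h j))) atTop
      (𝓝 (dist (BasicPoints.pt (h i) : X) y)) := tendsto_const_nhds.dist H.2
  refine le_of_tendsto h1 ?_
  filter_upwards [eventually_ge_atTop i] with j hj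
  rw [dist_comm]
  exact H.1 i j hj

theorem computableReals_iff_isComputableRealSeq {f : ℕ → ℝ} :
    ComputableReals f ↔ IsComputableRealSeq f := by
  constructor
  · rintro ⟨g, hg, h⟩
    exact ⟨fun n k => g n (k + 1),
      hg.comp (g := fun p : ℕ × ℕ => (p.1, p.2 + 1)) (by fun_prop),
      fun n => isCauchyName_of_dist_le fun i => h n (i + 1)⟩
  · rintro ⟨g, hg, h⟩
    exact ⟨g, hg, fun n k => (h n).dist_le k⟩

theorem IsComputablePoint.computableReals {r : ℝ} (hr : IsComputablePoint r) {α : Type*}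
    [Primcodable α] : ComputableReals fun _ : α => r := by
  obtain ⟨h, hh, H⟩ := hr
  exact ⟨fun _ k => h k, by fun_prop, fun _ k => H.dist_le k⟩

theorem IsCauchyName.prod {Y : Type v} [PseudoMetricSpace Y] [BasicPoints Y] {h k : ℕ → ℕ}
    {x : X} {y : Y} (hx : IsCauchyName h x) (hy : IsCauchyName k y) :
    IsCauchyName (fun i => Nat.pair (h i) (k i)) (x, y) := by
  have e : ∀ i, (BasicPoints.pt (Nat.pair (h i) (k i)) : X × Y) =
      (BasicPoints.pt (h i), BasicPoints.pt (k i)) := fun i => by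
    show (BasicPoints.pt (Nat.pair (h i) (k i)).unpair.1,
      BasicPoints.pt (Nat.pair (h i) (k i)).unpair.2) = _
    simp
  simp only [IsCauchyName, e, Prod.dist_eq]
  exact ⟨fun i j hij => max_le (hx.1 i j hij) (hy.1 i j hij), hx.2.prodMk_nhds hy.2⟩

theorem isCauchyName_natConst (n : ℕ) : IsCauchyName (fun _ => n) n :=
  isCauchyName_of_dist_le fun i => by
    show dist n n ≤ _
    rw [dist_self]; positivity

/-- The image of a computable point under a computable map is computable. -/
theorem IsComputableMap.isComputablePoint {Y : Type v} [PseudoMetricSpace Y] [BasicPoints Y]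
    {f : X → Y} (hf : IsComputableMap f) {x : X} (hx : IsComputablePoint x) :
    IsComputablePoint (f x) := by
  obtain ⟨F, ⟨φ, hφ, -, hF⟩, H⟩ := hf
  obtain ⟨h, hh, hhx⟩ := hx
  obtain ⟨g, hg, hgy⟩ := H x h hhx
  rw [hF] at hg
  have hp : Computable fun p : ℕ × ℕ => (List.range p.2).map h :=
    (computable_list_range_map (f := fun _ : Unit => h) (by fun_prop)).comp
      (g := fun p : ℕ × ℕ => ((), p.2)) (by fun_prop)
  have hφ' : Computable fun p : ℕ × ℕ => φ ((List.range p.2).map h) p.1 :=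
    Computable.comp (f := fun p : List ℕ × ℕ => φ p.1 p.2)
      (g := fun p : ℕ × ℕ => ((List.range p.2).map h, p.1)) hφ
      (computable_prodMk hp (by fun_prop))
  -- For each output position, search for an initial segment of the name that is long enough to
  -- determine it.
  obtain ⟨K, hK, hKs⟩ := Semidecidable.choice
    (p := fun n k => (φ ((List.range k).map h) n).isSome = true)
    (Semidecidable.of_bool (computable_isSome hφ')) fun n => by
      obtain ⟨k, hk⟩ := hg n
      exact ⟨k, by simp [hk]⟩
  refine ⟨fun n => (φ ((List.range (K n)).map h) n).getD 0, computable_getD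
    (hφ'.comp (g := fun n => (n, K n)) (by fun_prop)) (by fun_prop), ?_⟩
  obtain ⟨v, hv⟩ : ∃ v : ℕ → ℕ, ∀ n, φ ((List.range (K n)).map h) n = some (v n) :=
    ⟨fun n => (φ ((List.range (K n)).map h) n).get (hKs n), fun n => by simp⟩
  have hvF : v ∈ F h := (hF h v).2 fun n => ⟨K n, hv n⟩
  -- The segment found may differ from the one that witnesses `g`, but `F h` has at most one value.
  have : v = g := Part.mem_unique hvF ((hF h g).2 hg)
  simpa [hv, this] using hgy

end CauchyNames

/-! ### Indices of basic functions -/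

/-- The index of a bump function. -/
def idxBump (c k w : ℕ) : ℕ := 4 * Nat.pair c (Nat.pair k w) + 1

/-- The index of a maximum. -/
def idxMax (i j : ℕ) : ℕ := 4 * Nat.pair i j + 2

/-- The index of a minimum. -/
def idxMin (i j : ℕ) : ℕ := 4 * Nat.pair i j + 3

/-- The index of a rational linear combination. -/
def idxLin (p q i j : ℕ) : ℕ := 4 * Nat.pair (Nat.pair p q) (Nat.pair i j) + 4

section

variable {α : Type*} [Primcodable α]

@[fun_prop]
theorem computable_idxBump {f g h : α → ℕ} (hf : Computable f) (hg : Computable g)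
    (hh : Computable h) : Computable fun a => idxBump (f a) (g a) (h a) := by
  unfold idxBump; fun_prop

@[fun_prop]
theorem computable_idxMax {f g : α → ℕ} (hf : Computable f) (hg : Computable g) :
    Computable fun a => idxMax (f a) (g a) := by
  unfold idxMax; fun_prop

@[fun_prop]
theorem computable_idxMin {f g : α → ℕ} (hf : Computable f) (hg : Computable g) :
    Computable fun a => idxMin (f a) (g a) := by
  unfold idxMin; fun_prop

@[fun_prop]
theorem computable_idxLin {f g h k : α → ℕ} (hf : Computable f) (hg : Computable g)
    (hh : Computable h) (hk : Computable k) :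
    Computable fun a => idxLin (f a) (g a) (h a) (k a) := by
  unfold idxLin; fun_prop

end

/-- Every positive index has exactly one of the four forms, by its residue modulo 4, and refers only
to smaller indices. -/
theorem basicFun_induction {P : ℕ → Prop} (h0 : P 0) (hbump : ∀ c k w, P (idxBump c k w))
    (hmax : ∀ i j, P i → P j → P (idxMax i j)) (hmin : ∀ i j, P i → P j → P (idxMin i j))
    (hlin : ∀ p q i j, P i → P j → P (idxLin p q i j)) (i : ℕ) : P i := by
  induction i using Nat.strong_induction_on with
  | _ n ih =>
    rcases n with _ | n
    · exact h0
    have hs1 := Nat.unpair_left_le (n / 4)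
    have hs2 := Nat.unpair_right_le (n / 4)
    have hs3 := Nat.unpair_left_le (n / 4).unpair.2
    have hs4 := Nat.unpair_right_le (n / 4).unpair.2
    have hn : n = 4 * (n / 4) + n % 4 := (Nat.div_add_mod n 4).symm
    have hlt : n % 4 < 4 := Nat.mod_lt _ (by norm_num)
    have hcases : n % 4 = 0 ∨ n % 4 = 1 ∨ n % 4 = 2 ∨ n % 4 = 3 := by omega
    rcases hcases with h | h | h | h
    · have e : n + 1 = idxBump (n / 4).unpair.1 (n / 4).unpair.2.unpair.1
          (n / 4).unpair.2.unpair.2 := by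
        simp only [idxBump, Nat.pair_unpair]; omega
      rw [e]
      exact hbump _ _ _
    · have e : n + 1 = idxMax (n / 4).unpair.1 (n / 4).unpair.2 := by
        simp only [idxMax, Nat.pair_unpair]; omega
      rw [e]
      exact hmax _ _ (ih _ (by omega)) (ih _ (by omega))
    · have e : n + 1 = idxMin (n / 4).unpair.1 (n / 4).unpair.2 := by
        simp only [idxMin, Nat.pair_unpair]; omega
      rw [e]
      exact hmin _ _ (ih _ (by omega)) (ih _ (by omega))
    · have e : n + 1 = idxLin (n / 4).unpair.1.unpair.1 (n / 4).unpair.1.unpair.2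
          (n / 4).unpair.2.unpair.1 (n / 4).unpair.2.unpair.2 := by
        simp only [idxLin, Nat.pair_unpair]; omega
      rw [e]
      exact hlin _ _ _ _ (ih _ (by omega)) (ih _ (by omega))

/-! ### Bounds, Lipschitz constants and evaluation of basic functions -/

section BasicFun

variable (X : Type u) [PseudoMetricSpace X] [BasicPoints X]

theorem basicFun_zero : basicFun X 0 = fun _ => 1 := by
  rw [basicFun]

theorem basicFun_idxBump (c k w : ℕ) : basicFun X (idxBump c k w) =
    bump (BasicPoints.pt c) (posRat k : ℝ) ((posRat k : ℝ) + (posRat w : ℝ)) := by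
  have h1 : 4 * Nat.pair c (Nat.pair k w) % 4 = 0 := by omega
  have h2 : 4 * Nat.pair c (Nat.pair k w) / 4 = Nat.pair c (Nat.pair k w) := by omega
  rw [idxBump, basicFun, h1, h2]
  simp

theorem basicFun_idxMax (i j : ℕ) : basicFun X (idxMax i j) =
    fun y => max (basicFun X i y) (basicFun X j y) := by
  have h1 : (4 * Nat.pair i j + 1) % 4 = 1 := by omega
  have h2 : (4 * Nat.pair i j + 1) / 4 = Nat.pair i j := by omega
  rw [idxMax, basicFun, h1, h2]
  simp

theorem basicFun_idxMin (i j : ℕ) : basicFun X (idxMin i j) =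
    fun y => min (basicFun X i y) (basicFun X j y) := by
  have h1 : (4 * Nat.pair i j + 2) % 4 = 2 := by omega
  have h2 : (4 * Nat.pair i j + 2) / 4 = Nat.pair i j := by omega
  rw [idxMin, basicFun, h1, h2]
  simp

theorem basicFun_idxLin (p q i j : ℕ) : basicFun X (idxLin p q i j) =
    fun y => (ratOfNat p : ℝ) * basicFun X i y + (ratOfNat q : ℝ) * basicFun X j y := by
  have h1 : (4 * Nat.pair (Nat.pair p q) (Nat.pair i j) + 3) % 4 = 3 := by omega
  have h2 : (4 * Nat.pair (Nat.pair p q) (Nat.pair i j) + 3) / 4 =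
    Nat.pair (Nat.pair p q) (Nat.pair i j) := by omega
  rw [idxLin, basicFun, h1, h2]
  simp

variable {X}

/-- As a clamped affine function of the distance, the bump is visibly Lipschitz and can be evaluated
approximately without deciding comparisons of real numbers. -/
theorem bump_eq {X : Type u} [PseudoMetricSpace X] (c : X) (r : ℝ) {w : ℝ} (hw : 0 < w) (y : X) :
    bump c r (r + w) y = max 0 (min 1 (w⁻¹ * (r + w - dist c y))) := by
  unfold bump
  split_ifs with h1 h2
  · rw [min_eq_left, max_eq_right zero_le_one]
    rw [← div_eq_inv_mul, le_div_iff₀ hw]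
    linarith
  · rw [min_eq_right, max_eq_right]
    · rw [← div_eq_inv_mul]; congr 1; ring
    · exact mul_nonneg (inv_nonneg.2 hw.le) (by linarith)
    · rw [← div_eq_inv_mul, div_le_one hw]; linarith
  · rw [max_eq_left]
    refine (min_le_right _ _).trans (mul_nonpos_of_nonneg_of_nonpos (inv_nonneg.2 hw.le) ?_)
    linarith

/-- The part of the recursion for basic functions that concerns lattice operations and linear
combinations. -/
structure IsBasicRec (u : ℕ → ℝ) : Prop where
  max : ∀ i j, u (idxMax i j) = max (u i) (u j)
  min : ∀ i j, u (idxMin i j) = min (u i) (u j)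
  lin : ∀ p q i j, u (idxLin p q i j) = ratOfNat p * u i + ratOfNat q * u j

theorem isBasicRec_basicFun (y : X) : IsBasicRec fun i => basicFun X i y :=
  ⟨fun i j => by rw [basicFun_idxMax], fun i j => by rw [basicFun_idxMin],
    fun p q i j => by rw [basicFun_idxLin]⟩

/-- One step in the computation of `gauge`. -/
def gaugeStep (L : List ℕ) : ℕ :=
  if L.length = 0 then 1
  else if (L.length - 1) % 4 = 0 then
    ((L.length - 1) / 4).unpair.2.unpair.2.unpair.2 + 2
  else if (L.length - 1) % 4 = 1 then
    L.getD ((L.length - 1) / 4).unpair.1 0 + L.getD ((L.length - 1) / 4).unpair.2 0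
  else if (L.length - 1) % 4 = 2 then
    L.getD ((L.length - 1) / 4).unpair.1 0 + L.getD ((L.length - 1) / 4).unpair.2 0
  else
    (((L.length - 1) / 4).unpair.1.unpair.1.unpair.1 +
        ((L.length - 1) / 4).unpair.1.unpair.1.unpair.2.unpair.1) *
      L.getD ((L.length - 1) / 4).unpair.2.unpair.1 0 +
    (((L.length - 1) / 4).unpair.1.unpair.2.unpair.1 +
        ((L.length - 1) / 4).unpair.1.unpair.2.unpair.2.unpair.1) *
      L.getD ((L.length - 1) / 4).unpair.2.unpair.2 0

/-- A common bound for the absolute value and the Lipschitz constant of a basic function. -/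
def gauge (i : ℕ) : ℕ := gaugeStep (courseOfValues gaugeStep i)

theorem computable_gaugeStep : Computable gaugeStep := by
  unfold gaugeStep
  refine computable_ite (by fun_prop) (by fun_prop) (computable_ite (by fun_prop) (by fun_prop)
    (computable_ite (by fun_prop) (by fun_prop) (computable_ite (by fun_prop) (by fun_prop)
    (computable_add (by fun_prop) (by fun_prop)))))

@[fun_prop]
theorem computable_gauge {α : Type*} [Primcodable α] {f : α → ℕ} (hf : Computable f) :
    Computable fun a => gauge (f a) :=
  computable_gaugeStep.comp ((computable_courseOfValues (F := fun _ : Unit => gaugeStep)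
    (computable_gaugeStep.comp (by fun_prop))).comp (g := fun a => ((), f a))
      (by fun_prop))

theorem gauge_zero : gauge 0 = 1 := rfl

theorem gauge_idxBump (c k w : ℕ) : gauge (idxBump c k w) = w.unpair.2 + 2 := by
  have h1 : (4 * Nat.pair c (Nat.pair k w)) % 4 = 0 := by omega
  have h2 : (4 * Nat.pair c (Nat.pair k w)) / 4 = Nat.pair c (Nat.pair k w) := by omega
  simp [gauge, gaugeStep, idxBump, length_courseOfValues, h1, h2]

theorem le_four_mul_natPair_left (i j : ℕ) : i ≤ 4 * Nat.pair i j := by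
  have := Nat.left_le_pair i j; omega

theorem le_four_mul_natPair_right (i j : ℕ) : j ≤ 4 * Nat.pair i j := by
  have := Nat.right_le_pair i j; omega

theorem gauge_idxMax (i j : ℕ) : gauge (idxMax i j) = gauge i + gauge j := by
  have h1 : (4 * Nat.pair i j + 1) % 4 = 1 := by omega
  have h2 : (4 * Nat.pair i j + 1) / 4 = Nat.pair i j := by omega
  have h3 := le_four_mul_natPair_left i j
  have h4 := le_four_mul_natPair_right i j
  rw [gauge, gaugeStep]
  simp only [length_courseOfValues, idxMax,
    show 4 * Nat.pair i j + 2 - 1 = 4 * Nat.pair i j + 1 by omega, h1, h2, Nat.unpair_pair]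
  -- Both arguments are smaller than the index, so their values are in the list and the default `0`
  -- is never read.
  rw [if_neg (by omega), if_neg (by omega), if_pos trivial,
    getD_courseOfValues _ (by omega), getD_courseOfValues _ (by omega)]
  rfl

theorem gauge_idxMin (i j : ℕ) : gauge (idxMin i j) = gauge i + gauge j := by
  have h1 : (4 * Nat.pair i j + 2) % 4 = 2 := by omega
  have h2 : (4 * Nat.pair i j + 2) / 4 = Nat.pair i j := by omega
  have h3 := le_four_mul_natPair_left i j
  have h4 := le_four_mul_natPair_right i j
  rw [gauge, gaugeStep]
  simp only [length_courseOfValues, idxMin,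
    show 4 * Nat.pair i j + 3 - 1 = 4 * Nat.pair i j + 2 by omega, h1, h2, Nat.unpair_pair]
  rw [if_neg (by omega), if_neg (by omega), if_neg (by omega), if_pos trivial,
    getD_courseOfValues _ (by omega), getD_courseOfValues _ (by omega)]
  rfl

theorem gauge_idxLin (p q i j : ℕ) : gauge (idxLin p q i j) =
    (p.unpair.1 + p.unpair.2.unpair.1) * gauge i +
      (q.unpair.1 + q.unpair.2.unpair.1) * gauge j := by
  have h1 : (4 * Nat.pair (Nat.pair p q) (Nat.pair i j) + 3) % 4 = 3 := by omega
  have h2 : (4 * Nat.pair (Nat.pair p q) (Nat.pair i j) + 3) / 4 =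
    Nat.pair (Nat.pair p q) (Nat.pair i j) := by omega
  have h3 := Nat.left_le_pair i j
  have h4 := Nat.right_le_pair i j
  have h5 := le_four_mul_natPair_right (Nat.pair p q) (Nat.pair i j)
  rw [gauge, gaugeStep]
  simp only [length_courseOfValues, idxLin,
    show ∀ n, 4 * n + 4 - 1 = 4 * n + 3 from fun n => by omega, h1, h2, Nat.unpair_pair]
  rw [if_neg (by omega), if_neg (by omega), if_neg (by omega), if_neg (by omega),
    getD_courseOfValues _ (by omega), getD_courseOfValues _ (by omega)]
  rfl

/-- The numerator of `posRat w` is at least one. This bounds the slope of a bump by a natural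
number. -/
theorem inv_posRat_le (w : ℕ) : ((posRat w : ℝ))⁻¹ ≤ (w.unpair.2 : ℝ) + 1 := by
  unfold posRat
  push_cast
  rw [inv_div]
  exact div_le_self (by positivity) (by simp)

/-- Two solutions of the recursion for basic functions with nearby values at the generators are
close to each other. -/
theorem IsBasicRec.abs_sub_le {u v : ℕ → ℝ} (hu : IsBasicRec u) (hv : IsBasicRec v) {ε : ℝ}
    (hε : 0 ≤ ε) (h0 : |u 0 - v 0| ≤ ε)
    (hb : ∀ c k w, |u (idxBump c k w) - v (idxBump c k w)| ≤ ((w.unpair.2 : ℝ) + 2) * ε) (i : ℕ) :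
    |u i - v i| ≤ gauge i * ε := by
  induction i using basicFun_induction with
  | h0 => simpa [gauge_zero] using h0
  | hbump c k w => rw [gauge_idxBump]; simpa using hb c k w
  | hmax i j hi hj =>
    rw [hu.max, hv.max, gauge_idxMax]
    refine (abs_max_sub_max_le_max _ _ _ _).trans (max_le (hi.trans ?_) (hj.trans ?_)) <;>
    · push_cast
      have : (0 : ℝ) ≤ gauge i * ε := by positivity
      have : (0 : ℝ) ≤ gauge j * ε := by positivity
      linarith
  | hmin i j hi hj =>
    rw [hu.min, hv.min, gauge_idxMin]
    refine (abs_min_sub_min_le_max _ _ _ _).trans (max_le (hi.trans ?_) (hj.trans ?_)) <;>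
    · push_cast
      have : (0 : ℝ) ≤ gauge i * ε := by positivity
      have : (0 : ℝ) ≤ gauge j * ε := by positivity
      linarith
  | hlin p q i j hi hj =>
    rw [hu.lin, hv.lin, gauge_idxLin]
    have e : (ratOfNat p : ℝ) * u i + ratOfNat q * u j - (ratOfNat p * v i + ratOfNat q * v j) =
      ratOfNat p * (u i - v i) + ratOfNat q * (u j - v j) := by ring
    have hp : |(ratOfNat p : ℝ)| ≤ ((p.unpair.1 + p.unpair.2.unpair.1 : ℕ) : ℝ) := by
      exact_mod_cast abs_ratOfNat_le p
    have hq : |(ratOfNat q : ℝ)| ≤ ((q.unpair.1 + q.unpair.2.unpair.1 : ℕ) : ℝ) := by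
      exact_mod_cast abs_ratOfNat_le q
    rw [e]
    refine (abs_add_le _ _).trans ?_
    rw [abs_mul, abs_mul]
    have i1 := mul_le_mul hp hi (abs_nonneg _) (Nat.cast_nonneg _)
    have i2 := mul_le_mul hq hj (abs_nonneg _) (Nat.cast_nonneg _)
    push_cast at i1 i2 ⊢
    linarith

theorem abs_clamp_sub_clamp_le (s t : ℝ) : |max 0 (min 1 s) - max 0 (min 1 t)| ≤ |s - t| := by
  refine (abs_max_sub_max_le_max _ _ _ _).trans ?_
  rw [sub_self, abs_zero]
  refine max_le (abs_nonneg _) ((abs_min_sub_min_le_max _ _ _ _).trans ?_)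
  rw [sub_self, abs_zero]
  exact max_le (abs_nonneg _) le_rfl

theorem abs_rampValue_sub_le (w : ℕ) {r s t ε : ℝ} (h : |s - t| ≤ ε) :
    |max 0 (min 1 ((posRat w : ℝ)⁻¹ * (r - s))) - max 0 (min 1 ((posRat w : ℝ)⁻¹ * (r - t)))| ≤
      ((w.unpair.2 : ℝ) + 2) * ε := by
  refine (abs_clamp_sub_clamp_le _ _).trans ?_
  have hw : (0 : ℝ) < posRat w := by exact_mod_cast posRat_pos w
  rw [← mul_sub, abs_mul, abs_of_pos (inv_pos.2 hw)]
  have h2 : |r - s - (r - t)| ≤ ε := by rw [abs_sub_comm] at h; convert h using 2; ring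
  have h3 := inv_posRat_le w
  exact mul_le_mul (by linarith) h2 (abs_nonneg _) (by positivity)

theorem basicFun_idxBump_apply (c k w : ℕ) (y : X) : basicFun X (idxBump c k w) y =
    max 0 (min 1 ((posRat w : ℝ)⁻¹ * ((posRat k : ℝ) + posRat w - dist (BasicPoints.pt c) y))) := by
  rw [basicFun_idxBump, bump_eq _ _ (by exact_mod_cast posRat_pos w)]

/-- The values at `x` and at `y` are two solutions of the same recursion, and at the bumps they
differ by the slope times the distance. -/
theorem abs_basicFun_sub_le (i : ℕ) (x y : X) :
    |basicFun X i x - basicFun X i y| ≤ gauge i * dist x y := by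
  refine (isBasicRec_basicFun x).abs_sub_le (isBasicRec_basicFun y) dist_nonneg ?_ ?_ i
  · simp [basicFun_zero]
  · intro c k w
    rw [basicFun_idxBump_apply, basicFun_idxBump_apply]
    refine abs_rampValue_sub_le w ?_
    rw [dist_comm _ x, dist_comm _ y]
    exact abs_dist_sub_le _ _ _

/-- The zero sequence solves the lattice and linear part of the recursion, so the comparison of two
solutions also yields bounds. -/
theorem abs_basicFun_le (i : ℕ) (x : X) : |basicFun X i x| ≤ gauge i := by
  have h : IsBasicRec fun _ => (0 : ℝ) := ⟨by simp, by simp, by simp⟩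
  have := (isBasicRec_basicFun x).abs_sub_le h zero_le_one (by simp [basicFun_zero]) ?_ i
  · simpa using this
  · intro c k w
    rw [basicFun_idxBump_apply, sub_zero, mul_one, abs_of_nonneg (le_max_left _ _)]
    refine (max_le zero_le_one (min_le_left _ _)).trans ?_
    have : (0 : ℝ) ≤ w.unpair.2 := Nat.cast_nonneg _
    linarith

theorem continuous_basicFun (i : ℕ) : Continuous (basicFun X i) :=
  (LipschitzWith.of_dist_le_mul (K := (gauge i : NNReal)) fun x y => by
    rw [Real.dist_eq]; simpa using abs_basicFun_sub_le i x y).continuous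

/-- One step in the computation of `evalCode`. -/
def evalStep (d : ℕ → ℕ) (L : List ℕ) : ℕ :=
  if L.length = 0 then qmk 1 0 0
  else if (L.length - 1) % 4 = 0 then
    qmax (qmk 0 0 0) (qmin (qmk 1 0 0)
      (qmul (qpos (posInv ((L.length - 1) / 4).unpair.2.unpair.2))
        (qadd (qadd (qpos ((L.length - 1) / 4).unpair.2.unpair.1)
          (qpos ((L.length - 1) / 4).unpair.2.unpair.2))
          (qneg (d ((L.length - 1) / 4).unpair.1)))))
  else if (L.length - 1) % 4 = 1 then
    qmax (L.getD ((L.length - 1) / 4).unpair.1 0) (L.getD ((L.length - 1) / 4).unpair.2 0)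
  else if (L.length - 1) % 4 = 2 then
    qmin (L.getD ((L.length - 1) / 4).unpair.1 0) (L.getD ((L.length - 1) / 4).unpair.2 0)
  else
    qadd
      (qmul ((L.length - 1) / 4).unpair.1.unpair.1
        (L.getD ((L.length - 1) / 4).unpair.2.unpair.1 0))
      (qmul ((L.length - 1) / 4).unpair.1.unpair.2
        (L.getD ((L.length - 1) / 4).unpair.2.unpair.2 0))

/-- The code of the value of a basic function at a point whose distances to the basic points are
coded by `d`. -/
def evalCode (d : ℕ → ℕ) (i : ℕ) : ℕ := evalStep d (courseOfValues (evalStep d) i)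

theorem computable_evalStep {α : Type*} [Primcodable α] {d : α → ℕ → ℕ}
    (hd : Computable fun p : α × ℕ => d p.1 p.2) :
    Computable fun p : α × List ℕ => evalStep (d p.1) p.2 := by
  have hd' : Computable fun p : α × List ℕ => d p.1 ((p.2.length - 1) / 4).unpair.1 :=
    hd.comp (g := fun p : α × List ℕ => (p.1, ((p.2.length - 1) / 4).unpair.1)) (by fun_prop)
  unfold evalStep
  refine computable_ite (by fun_prop) (by fun_prop) (computable_ite (by fun_prop) ?_
    (computable_ite (by fun_prop) (computable_qmax (by fun_prop) (by fun_prop))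
    (computable_ite (by fun_prop) (computable_qmin (by fun_prop) (by fun_prop))
    (computable_qadd (computable_qmul (by fun_prop) (by fun_prop))
      (computable_qmul (by fun_prop) (by fun_prop))))))
  exact computable_qmax (by fun_prop) (computable_qmin (by fun_prop) (computable_qmul (by fun_prop)
    (computable_qadd (computable_qadd (by fun_prop) (by fun_prop)) (computable_qneg hd'))))

theorem computable_evalCode {α : Type*} [Primcodable α] {d : α → ℕ → ℕ}
    (hd : Computable fun p : α × ℕ => d p.1 p.2) :
    Computable fun p : α × ℕ => evalCode (d p.1) p.2 := by
  have h1 := computable_evalStep hd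
  have h2 := computable_courseOfValues (F := fun a => evalStep (d a)) h1
  have h3 : Computable fun p : α × ℕ => (p.1, courseOfValues (evalStep (d p.1)) p.2) :=
    computable_prodMk (by fun_prop) h2
  unfold evalCode
  exact h1.comp h3

theorem evalCode_zero (d : ℕ → ℕ) : evalCode d 0 = qmk 1 0 0 := rfl

theorem evalCode_idxBump (d : ℕ → ℕ) (c k w : ℕ) : evalCode d (idxBump c k w) =
    qmax (qmk 0 0 0) (qmin (qmk 1 0 0)
      (qmul (qpos (posInv w)) (qadd (qadd (qpos k) (qpos w)) (qneg (d c))))) := by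
  have h1 : (4 * Nat.pair c (Nat.pair k w)) % 4 = 0 := by omega
  have h2 : (4 * Nat.pair c (Nat.pair k w)) / 4 = Nat.pair c (Nat.pair k w) := by omega
  simp [evalCode, evalStep, idxBump, length_courseOfValues, h1, h2]

/-- Maxima, minima and linear combinations of codes are exact, so only the distances at the bumps
introduce errors. -/
theorem isBasicRec_evalCode (d : ℕ → ℕ) : IsBasicRec fun i => (ratOfNat (evalCode d i) : ℝ) := by
  refine ⟨fun i j => ?_, fun i j => ?_, fun p q i j => ?_⟩
  · have h1 : (4 * Nat.pair i j + 1) % 4 = 1 := by omega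
    have h2 : (4 * Nat.pair i j + 1) / 4 = Nat.pair i j := by omega
    have h3 := le_four_mul_natPair_left i j
    have h4 := le_four_mul_natPair_right i j
    rw [evalCode, evalStep]
    simp only [length_courseOfValues, idxMax,
      show 4 * Nat.pair i j + 2 - 1 = 4 * Nat.pair i j + 1 by omega, h1, h2, Nat.unpair_pair]
    rw [if_neg (by omega), if_neg (by omega), if_pos trivial,
      getD_courseOfValues _ (by omega), getD_courseOfValues _ (by omega), ratOfNat_qmax,
      Rat.cast_max]
    rfl
  · have h1 : (4 * Nat.pair i j + 2) % 4 = 2 := by omega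
    have h2 : (4 * Nat.pair i j + 2) / 4 = Nat.pair i j := by omega
    have h3 := le_four_mul_natPair_left i j
    have h4 := le_four_mul_natPair_right i j
    rw [evalCode, evalStep]
    simp only [length_courseOfValues, idxMin,
      show 4 * Nat.pair i j + 3 - 1 = 4 * Nat.pair i j + 2 by omega, h1, h2, Nat.unpair_pair]
    rw [if_neg (by omega), if_neg (by omega), if_neg (by omega), if_pos trivial,
      getD_courseOfValues _ (by omega), getD_courseOfValues _ (by omega), ratOfNat_qmin,
      Rat.cast_min]
    rfl
  · have h1 : (4 * Nat.pair (Nat.pair p q) (Nat.pair i j) + 3) % 4 = 3 := by omega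
    have h2 : (4 * Nat.pair (Nat.pair p q) (Nat.pair i j) + 3) / 4 =
      Nat.pair (Nat.pair p q) (Nat.pair i j) := by omega
    have h3 := Nat.left_le_pair i j
    have h4 := Nat.right_le_pair i j
    have h5 := le_four_mul_natPair_right (Nat.pair p q) (Nat.pair i j)
    rw [evalCode, evalStep]
    simp only [length_courseOfValues, idxLin,
      show ∀ n, 4 * n + 4 - 1 = 4 * n + 3 from fun n => by omega, h1, h2, Nat.unpair_pair]
    rw [if_neg (by omega), if_neg (by omega), if_neg (by omega), if_neg (by omega),
      getD_courseOfValues _ (by omega), getD_courseOfValues _ (by omega), ratOfNat_qadd,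
      ratOfNat_qmul, ratOfNat_qmul]
    push_cast
    rfl

/-- The comparison of two solutions again: errors in the distances propagate with the factor `gauge
i`. -/
theorem abs_evalCode_sub_le {d : ℕ → ℕ} {y : X} {ε : ℝ}
    (h : ∀ c, |(ratOfNat (d c) : ℝ) - dist (BasicPoints.pt c) y| ≤ ε) (i : ℕ) :
    |(ratOfNat (evalCode d i) : ℝ) - basicFun X i y| ≤ gauge i * ε := by
  have hε : 0 ≤ ε := (abs_nonneg _).trans (h 0)
  refine (isBasicRec_evalCode d).abs_sub_le (isBasicRec_basicFun y) hε ?_ ?_ i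
  · simpa [basicFun_zero, evalCode_zero] using hε
  · intro c k w
    rw [basicFun_idxBump_apply]
    simp only [evalCode_idxBump, ratOfNat_qmax, ratOfNat_qmin, ratOfNat_qmul, ratOfNat_qadd,
      ratOfNat_qneg, ratOfNat_qpos, ratOfNat_qmk, posRat_posInv]
    have := abs_rampValue_sub_le w (r := (posRat k : ℝ) + posRat w) (h c)
    push_cast
    simpa [← sub_eq_add_neg] using this

end BasicFun

/-- The values of the basic functions at the basic points are uniformly computable. -/
theorem computableReals_basicFun_pt (X : Type u) [MetricSpace X] [BasicPoints X]
    [ComputableMetricSpace X] :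
    ComputableReals fun p : ℕ × ℕ => basicFun X p.1 (BasicPoints.pt p.2) := by
  obtain ⟨g, hg, h⟩ := computableReals_iff_isComputableRealSeq.2
    (ComputableMetricSpace.dist_computable (X := X))
  have hd : Computable fun q : (ℕ × ℕ) × ℕ => g (Nat.pair q.2 q.1.1) q.1.2 :=
    hg.comp (g := fun q : (ℕ × ℕ) × ℕ => (Nat.pair q.2 q.1.1, q.1.2)) (by fun_prop)
  have he := computable_evalCode (d := fun (a : ℕ × ℕ) c => g (Nat.pair c a.1) a.2) hd
  -- The `gauge p.1` additional bits absorb the propagation of errors.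
  refine ⟨fun p k => evalCode (fun c => g (Nat.pair c p.2) (k + gauge p.1)) p.1,
    he.comp (g := fun q : (ℕ × ℕ) × ℕ => ((q.1.2, q.2 + gauge q.1.1), q.1.1)) (by fun_prop),
    fun p k => ?_⟩
  refine (abs_evalCode_sub_le (ε := (2 : ℝ)⁻¹ ^ (k + gauge p.1)) (fun c => ?_) p.1).trans
    (natCast_mul_half_pow_le _ _)
  simpa using h (Nat.pair c p.2) (k + gauge p.1)

/-! ### Finite measures -/

section Measures

instance {X : Type u} [MeasurableSpace X] (μ : FinMeas X) : IsFiniteMeasure μ.toMeasure :=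
  Subtype.property (p := IsFiniteMeasure) μ

theorem FinMeas.ext {X : Type u} [MeasurableSpace X] {μ ν : FinMeas X}
    (h : μ.toMeasure = ν.toMeasure) : μ = ν :=
  Subtype.ext h

theorem pt_toMeasure {X : Type u} [MeasurableSpace X] [BasicPoints X] (n : ℕ) :
    (BasicPoints.pt n : FinMeas X).toMeasure = atomicMeasure X (atoms n) := rfl

/-- Inverts `1 - exp (-δ)` for small values, so that distances of measures bound differences of
integrals. It rests on `exp (-2η) ≤ 1 / (1 + 2η)` and `(1 - η) * (1 + 2η) ≥ 1` for `0 ≤ η ≤ 1/2`. -/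
theorem le_two_mul_of_one_sub_exp_le {δ η : ℝ} (h0 : 0 ≤ η) (hη : η ≤ 1 / 2)
    (h : 1 - Real.exp (-δ) ≤ η) : δ ≤ 2 * η := by
  by_contra! hlt
  have h1 : Real.exp (-δ) < Real.exp (-(2 * η)) := Real.exp_lt_exp.2 (by linarith)
  have h2 : Real.exp (-(2 * η)) * (1 + 2 * η) ≤ 1 := by
    have h3 : 1 + 2 * η ≤ Real.exp (2 * η) := by linarith [Real.add_one_le_exp (2 * η)]
    calc Real.exp (-(2 * η)) * (1 + 2 * η) ≤ Real.exp (-(2 * η)) * Real.exp (2 * η) :=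
          mul_le_mul_of_nonneg_left h3 (Real.exp_pos _).le
      _ = 1 := by rw [← Real.exp_add]; simp
  have h4 : 1 - η < Real.exp (-(2 * η)) := by linarith
  nlinarith

variable {X : Type u} [PseudoMetricSpace X] [BasicPoints X] [MeasurableSpace X]

theorem integrable_basicFun [BorelSpace X] (μ : Measure X) [IsFiniteMeasure μ] (i : ℕ) :
    Integrable (basicFun X i) μ := by
  refine Integrable.of_bound (C := gauge i) ?_ (Eventually.of_forall fun x => ?_)
  · exact (continuous_basicFun i).measurable.aestronglyMeasurable
  · exact abs_basicFun_le i x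

/-- The integrals of a basic function are uniformly continuous in the measure, with a computable
modulus. -/
theorem abs_integral_basicFun_sub_le {μ ν : FinMeas X} {m i : ℕ} (him : i < m)
    (h : dist μ ν ≤ (2 : ℝ)⁻¹ ^ m) :
    |(∫ x, basicFun X i x ∂μ.toMeasure) - ∫ x, basicFun X i x ∂ν.toMeasure| ≤
      2 * 2 ^ i * (2 : ℝ)⁻¹ ^ m := by
  -- A single term of a series of nonnegative numbers is at most its sum.
  have h1 : (2 : ℝ)⁻¹ ^ i * measTerm μ ν i ≤ dist μ ν :=
    (summable_measTerm μ ν).le_tsum i fun j _ => mul_nonneg (by positivity) (measTerm_nonneg _ _ _)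
  have h2 : measTerm μ ν i ≤ 2 ^ i * (2 : ℝ)⁻¹ ^ m := by
    have h3 := mul_le_mul_of_nonneg_left (h1.trans h) (by positivity : (0 : ℝ) ≤ 2 ^ i)
    rwa [← mul_assoc, ← mul_pow, mul_inv_cancel₀ (by norm_num), one_pow, one_mul] at h3
  rw [mul_assoc]
  refine le_two_mul_of_one_sub_exp_le (by positivity) ?_ h2
  -- Here `i < m` places the term in the range in which the exponential is inverted.
  calc (2 : ℝ) ^ i * (2 : ℝ)⁻¹ ^ m ≤ 2 ^ i * (2 : ℝ)⁻¹ ^ (i + 1) :=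
        mul_le_mul_of_nonneg_left (half_pow_le_half_pow him) (by positivity)
    _ = 1 / 2 := by
        rw [pow_succ, ← mul_assoc, ← mul_pow, mul_inv_cancel₀ (by norm_num)]; norm_num

theorem list_map_sum_eq {M : Type*} [AddCommMonoid M] (f : ℕ → M) (l : List ℕ) :
    (l.map f).sum = ∑ j ∈ Finset.range l.length, f (l.getD j 0) := by
  induction l with
  | nil => simp
  | cons a l ih => simp [Finset.sum_range_succ', ih, add_comm]

theorem atomicMeasure_cons {X : Type u} [MeasurableSpace X] [BasicPoints X]
    (k : ℕ) (l : List ℕ) : atomicMeasure X (k :: l) =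
    ENNReal.ofReal (posRat k.unpair.2 : ℝ) • Measure.dirac (BasicPoints.pt k.unpair.1 : X) +
      atomicMeasure X l := by
  simp [atomicMeasure]

theorem integral_basicFun_atomicMeasure [BorelSpace X] (i : ℕ) (l : List ℕ) :
    ∫ x, basicFun X i x ∂(atomicMeasure X l) =
      (l.map fun k => (posRat k.unpair.2 : ℝ) * basicFun X i (BasicPoints.pt k.unpair.1)).sum := by
  induction l with
  | nil => simp [atomicMeasure]
  | cons k l ih =>
    have h1 : IsFiniteMeasure (ENNReal.ofReal (posRat k.unpair.2 : ℝ) •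
        Measure.dirac (BasicPoints.pt k.unpair.1 : X)) :=
      Measure.smul_finite _ ENNReal.ofReal_ne_top
    have h2 := isFiniteMeasure_atomicMeasure (X := X) l
    have h3 : (0 : ℝ) ≤ posRat k.unpair.2 := by exact_mod_cast (posRat_pos _).le
    rw [atomicMeasure_cons, integral_add_measure (integrable_basicFun _ i)
      (integrable_basicFun _ i), ih, integral_smul_measure, integral_dirac' _ _
      (continuous_basicFun i).measurable.stronglyMeasurable, ENNReal.toReal_ofReal h3]
    simp

end Measures

/-! ### Computability of the integrals of basic functions -/

section ComputableIntegrals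

variable {X : Type u} [MetricSpace X] [BasicPoints X] [ComputableMetricSpace X]
  [MeasurableSpace X] [BorelSpace X]

@[fun_prop]
theorem computable_atoms {α : Type*} [Primcodable α] {f : α → ℕ} (hf : Computable f) :
    Computable fun a => atoms (f a) := by
  unfold atoms; fun_prop

/-- The integrals of the basic functions with respect to the basic measures are uniformly
computable. -/
theorem computableReals_integral_pt : ComputableReals fun p : ℕ × ℕ =>
    ∫ x, basicFun X p.1 x ∂(BasicPoints.pt p.2 : FinMeas X).toMeasure := by
  have h1 : ComputableReals fun q : (ℕ × ℕ) × ℕ =>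
      (posRat ((atoms q.1.2).getD q.2 0).unpair.2 : ℝ) *
        basicFun X q.1.1 (BasicPoints.pt ((atoms q.1.2).getD q.2 0).unpair.1) :=
    (ComputableReals.posRat (by fun_prop)).mul ((computableReals_basicFun_pt X).comp
      (g := fun q : (ℕ × ℕ) × ℕ => (q.1.1, ((atoms q.1.2).getD q.2 0).unpair.1)) (by fun_prop))
  have h2 := (ComputableReals.sum (f := fun (a : ℕ × ℕ) j =>
      (posRat ((atoms a.2).getD j 0).unpair.2 : ℝ) *
        basicFun X a.1 (BasicPoints.pt ((atoms a.2).getD j 0).unpair.1)) h1).comp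
      (g := fun p : ℕ × ℕ => (p, (atoms p.2).length)) (by fun_prop)
  refine h2.of_eq fun p => ?_
  rw [pt_toMeasure, integral_basicFun_atomicMeasure, list_map_sum_eq]

/-- The integrals of the basic functions with respect to a computable measure are uniformly
computable. -/
theorem computableReals_integral {μ : FinMeas X} (hμ : IsComputablePoint μ) :
    ComputableReals fun i : ℕ => ∫ x, basicFun X i x ∂μ.toMeasure := by
  obtain ⟨h, hh, H⟩ := hμ
  -- The entry `k + (i + 1)` of the name gives the error `2 * 2 ^ i * 2⁻¹ ^ (k + i + 1) = 2⁻¹ ^ k`.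
  refine ComputableReals.of_approx (F := fun i k =>
    ∫ x, basicFun X i x ∂(BasicPoints.pt (h (k + (i + 1))) : FinMeas X).toMeasure)
    (computableReals_integral_pt.comp (g := fun p : ℕ × ℕ => (p.1, h (p.2 + (p.1 + 1))))
      (by fun_prop)) fun i k => ?_
  refine (abs_integral_basicFun_sub_le (by omega) (H.dist_le _)).trans_eq ?_
  rw [← pow_succ', pow_add _ k, mul_comm, mul_assoc, ← mul_pow, inv_mul_cancel₀ (by norm_num),
    one_pow, mul_one]

end ComputableIntegrals

/-! ### Normalization of basic measures -/

section Normalization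

/-- Addition on codes of positive rationals. -/
def posAdd (x y : ℕ) : ℕ :=
  Nat.pair ((x.unpair.1 + 1) * (y.unpair.2 + 1) + (y.unpair.1 + 1) * (x.unpair.2 + 1) - 1)
    (x.unpair.2 * y.unpair.2 + x.unpair.2 + y.unpair.2)

/-- Multiplication on codes of positive rationals. -/
def posMul (x y : ℕ) : ℕ :=
  Nat.pair (x.unpair.1 * y.unpair.1 + x.unpair.1 + y.unpair.1)
    (x.unpair.2 * y.unpair.2 + x.unpair.2 + y.unpair.2)

theorem posRat_posAdd (x y : ℕ) : posRat (posAdd x y) = posRat x + posRat y := by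
  -- Numerators are stored minus one; this inequality makes the truncated subtraction exact.
  have h : 1 ≤ (x.unpair.1 + 1) * (y.unpair.2 + 1) + (y.unpair.1 + 1) * (x.unpair.2 + 1) := by
    nlinarith [Nat.zero_le (x.unpair.1 * y.unpair.2)]
  rw [posAdd, posRat_natPair, Nat.cast_sub h, posRat, posRat,
    div_add_div _ _ (by positivity) (by positivity)]
  push_cast
  congr 1 <;> ring

theorem posRat_posMul (x y : ℕ) : posRat (posMul x y) = posRat x * posRat y := by
  rw [posMul, posRat_natPair, posRat, posRat, div_mul_div_comm]
  push_cast
  congr 1 <;> ring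

section

variable {α : Type*} [Primcodable α]

@[fun_prop]
theorem computable_posAdd {f g : α → ℕ} (hf : Computable f) (hg : Computable g) :
    Computable fun a => posAdd (f a) (g a) := by
  unfold posAdd; exact computable_natPair (by fun_prop) (by fun_prop)

@[fun_prop]
theorem computable_posMul {f g : α → ℕ} (hf : Computable f) (hg : Computable g) :
    Computable fun a => posMul (f a) (g a) := by
  unfold posMul; exact computable_natPair (by fun_prop) (by fun_prop)

end

/-- The code of the sum of the weights of the head and of the first `j` further entries. -/
def partialMass (n : ℕ) : ℕ → ℕ
  | 0 => n.unpair.1.unpair.2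
  | j + 1 => posAdd (partialMass n j)
      ((Denumerable.ofNat (List ℕ) n.unpair.2).getD j 0).unpair.2

/-- The code of the total mass of a basic measure. -/
def totalMass (n : ℕ) : ℕ := partialMass n (Denumerable.ofNat (List ℕ) n.unpair.2).length

/-- Division of the weight of an entry. -/
def scaleEntry (c k : ℕ) : ℕ := Nat.pair k.unpair.1 (posMul k.unpair.2 (posInv c))

/-- The index of the normalization of a basic measure. -/
def normalizeIdx (n : ℕ) : ℕ :=
  Nat.pair (scaleEntry (totalMass n) n.unpair.1)
    (Encodable.encode ((List.range (Denumerable.ofNat (List ℕ) n.unpair.2).length).map fun j =>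
      scaleEntry (totalMass n) ((Denumerable.ofNat (List ℕ) n.unpair.2).getD j 0)))

theorem computable_totalMass : Computable totalMass := by
  have h : Computable fun p : ℕ × ℕ => partialMass p.1 p.2 :=
    computable_of_rec (f := partialMass) (g := fun n => n.unpair.1.unpair.2)
      (h := fun n j s => posAdd s ((Denumerable.ofNat (List ℕ) n.unpair.2).getD j 0).unpair.2)
      (by fun_prop) (by fun_prop) (fun _ => rfl) (fun _ _ => rfl)
  exact h.comp (g := fun n : ℕ => (n, (Denumerable.ofNat (List ℕ) n.unpair.2).length))
    (by fun_prop)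

@[fun_prop]
theorem computable_encode_list {α : Type*} [Primcodable α] {f : α → List ℕ} (hf : Computable f) :
    Computable fun a => Encodable.encode (f a) :=
  computable_encode hf

theorem computable_normalizeIdx : Computable normalizeIdx := by
  have h0 := computable_totalMass
  have h1 : Computable fun p : ℕ × ℕ => scaleEntry (totalMass p.1)
      ((Denumerable.ofNat (List ℕ) p.1.unpair.2).getD p.2 0) := by
    unfold scaleEntry; fun_prop
  have h2 := (computable_list_range_map (f := fun n j => scaleEntry (totalMass n)
      ((Denumerable.ofNat (List ℕ) n.unpair.2).getD j 0)) h1).comp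
      (g := fun n : ℕ => (n, (Denumerable.ofNat (List ℕ) n.unpair.2).length)) (by fun_prop)
  have h3 : Computable fun n => scaleEntry (totalMass n) n.unpair.1 := by
    unfold scaleEntry; fun_prop
  unfold normalizeIdx
  exact computable_natPair h3 (computable_encode_list h2)

theorem list_range_map_getD (f : ℕ → ℕ) (l : List ℕ) :
    (List.range l.length).map (fun j => f (l.getD j 0)) = l.map f := by
  refine List.ext_getElem (by simp) fun i h1 h2 => ?_
  simp at h1
  simp [h1]

theorem atoms_normalizeIdx (n : ℕ) :
    atoms (normalizeIdx n) = (atoms n).map (scaleEntry (totalMass n)) := by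
  rw [normalizeIdx, list_range_map_getD, atoms, atoms, Nat.unpair_pair, List.map_cons,
    Denumerable.ofNat_encode]

theorem posRat_totalMass (n : ℕ) :
    (posRat (totalMass n) : ℝ) = ((atoms n).map fun k => (posRat k.unpair.2 : ℝ)).sum := by
  have h : ∀ j, (posRat (partialMass n j) : ℝ) = (posRat n.unpair.1.unpair.2 : ℝ) +
      ∑ i ∈ Finset.range j,
        (posRat ((Denumerable.ofNat (List ℕ) n.unpair.2).getD i 0).unpair.2 : ℝ) := by
    intro j
    induction j with
    | zero => simp [partialMass]
    | succ j ih =>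
      rw [partialMass, posRat_posAdd, Finset.sum_range_succ, Rat.cast_add, ih, add_assoc]
  rw [totalMass, h, atoms, List.map_cons, List.sum_cons,
    list_map_sum_eq (fun k => (posRat k.unpair.2 : ℝ))]

variable {X : Type u} [MeasurableSpace X] [BasicPoints X]

theorem atomicMeasure_univ (l : List ℕ) : atomicMeasure X l Set.univ =
    ENNReal.ofReal (l.map fun k => (posRat k.unpair.2 : ℝ)).sum := by
  induction l with
  | nil => simp [atomicMeasure]
  | cons k l ih =>
    have h : atomicMeasure X (k :: l) = ENNReal.ofReal (posRat k.unpair.2 : ℝ) •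
        Measure.dirac (BasicPoints.pt k.unpair.1 : X) + atomicMeasure X l := by
      simp [atomicMeasure]
    have h3 : (0 : ℝ) ≤ posRat k.unpair.2 := by exact_mod_cast (posRat_pos _).le
    have h4 : (0 : ℝ) ≤ (l.map fun k => (posRat k.unpair.2 : ℝ)).sum :=
      List.sum_nonneg (by
        simp only [List.mem_map]
        rintro x ⟨k, -, rfl⟩
        exact_mod_cast (posRat_pos _).le)
    rw [h, Measure.add_apply, ih, List.map_cons, List.sum_cons, ENNReal.ofReal_add h3 h4]
    simp

theorem atomicMeasure_map_scaleEntry (c : ℕ) (l : List ℕ) :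
    atomicMeasure X (l.map (scaleEntry c)) =
      (ENNReal.ofReal (posRat c : ℝ))⁻¹ • atomicMeasure X l := by
  have hc : (0 : ℝ) < posRat c := by exact_mod_cast posRat_pos c
  rw [atomicMeasure, atomicMeasure, List.map_map, List.smul_sum, List.map_map]
  congr 2
  funext k
  have h3 : (0 : ℝ) ≤ posRat k.unpair.2 := by exact_mod_cast (posRat_pos _).le
  simp only [Function.comp, scaleEntry, Nat.unpair_pair, posRat_posMul, posRat_posInv, smul_smul]
  rw [← ENNReal.ofReal_inv_of_pos hc, ← ENNReal.ofReal_mul (inv_nonneg.2 hc.le)]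
  push_cast
  rw [mul_comm]

variable [PseudoMetricSpace X]

/-- The total mass is a positive rational, so dividing by it keeps all weights positive rationals
and yields a basic point of `𝓜(X)` with a computable index. -/
theorem toFinMeas_pt {X : Type u} [MeasurableSpace X] [BasicPoints X] (n : ℕ) :
    (BasicPoints.pt n : ProbMeas X).toFinMeas =
    BasicPoints.pt (normalizeIdx n) := by
  refine FinMeas.ext ?_
  rw [pt_toMeasure, atoms_normalizeIdx, atomicMeasure_map_scaleEntry, posRat_totalMass,
    ← atomicMeasure_univ (X := X)]
  rfl

/-- A computable probability measure is computable as a finite measure. -/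
theorem IsComputablePoint.toFinMeas {μ : ProbMeas X} (hμ : IsComputablePoint μ) :
    IsComputablePoint μ.toFinMeas := by
  obtain ⟨h, hh, H⟩ := hμ
  refine ⟨fun k => normalizeIdx (h k), computable_normalizeIdx.comp hh, ?_, ?_⟩
  · intro i j hij
    -- The metric of `𝓜₁(X)` is induced from `𝓜(X)`, so the conditions on names carry over verbatim.
    rw [← toFinMeas_pt, ← toFinMeas_pt]
    exact H.1 i j hij
  · have := H.2
    rw [tendsto_iff_dist_tendsto_zero] at this ⊢
    simp only [← toFinMeas_pt]
    exact this

end Normalization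

/-! ### Superlevel sets of lower semicomputable functions -/

theorem isPrefix_range {m n : ℕ} (h : m ≤ n) : List.range m <+: List.range n := by
  obtain ⟨k, rfl⟩ := Nat.exists_eq_add_of_le h
  rw [List.range_add]
  exact List.prefix_append _ _

theorem exists_pt_dist_lt {X : Type u} [MetricSpace X] [BasicPoints X]
    [ComputableMetricSpace X] (x : X) {ε : ℝ} (hε : 0 < ε) :
    ∃ c, dist (BasicPoints.pt c : X) x < ε := by
  obtain ⟨c, hc⟩ := (ComputableMetricSpace.dense_pt (X := X)).exists_dist_lt x hε
  exact ⟨c, by rwa [dist_comm]⟩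

theorem dist_pt_computable {X : Type u} [MetricSpace X] [BasicPoints X]
    [ComputableMetricSpace X] :
    ComputableReals fun p : ℕ × ℕ => dist (BasicPoints.pt p.1 : X) (BasicPoints.pt p.2) :=
  ((computableReals_iff_isComputableRealSeq.2
    (ComputableMetricSpace.dist_computable (X := X))).comp
    (g := fun p : ℕ × ℕ => Nat.pair p.1 p.2) (by fun_prop)).of_eq fun p => by simp

section Superlevel

/-- The finite initial segment of a name of `(n, y, z, x)` that is determined by names of `y` and
`z` and by a finite initial segment of a name of `x`. -/
def prefixName (hy hz : ℕ → ℕ) (n : ℕ) (σ : List ℕ) : List ℕ :=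
  (List.range σ.length).map fun i =>
    Nat.pair n (Nat.pair (hy i) (Nat.pair (hz i) (σ.getD i 0)))

theorem computable_prefixName {hy hz : ℕ → ℕ} (hhy : Computable hy) (hhz : Computable hz) :
    Computable fun p : ℕ × List ℕ => prefixName hy hz p.1 p.2 := by
  have h : Computable fun q : (ℕ × List ℕ) × ℕ =>
      Nat.pair q.1.1 (Nat.pair (hy q.2) (Nat.pair (hz q.2) (q.1.2.getD q.2 0))) := by
    fun_prop
  exact (computable_list_range_map (f := fun (p : ℕ × List ℕ) i =>
    Nat.pair p.1 (Nat.pair (hy i) (Nat.pair (hz i) (p.2.getD i 0)))) h).comp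
    (g := fun p : ℕ × List ℕ => (p, p.2.length)) (by fun_prop)

variable {Y : Type u} {Z : Type v} {X : Type w} [PseudoMetricSpace Y] [BasicPoints Y]
  [PseudoMetricSpace Z] [BasicPoints Z] [MetricSpace X] [BasicPoints X]

/-- Beyond the end of `σ` the name continues with basic points supplied by density. Hence what a
machine concludes from `σ` alone holds for all `x` near the entries of `σ`. -/
theorem exists_isCauchyName_extending [ComputableMetricSpace X] (σ : List ℕ) (x : X)
    (h : ∀ i < σ.length, dist (BasicPoints.pt (σ.getD i 0)) x ≤ (2 : ℝ)⁻¹ ^ (i + 1)) :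
    ∃ hx : ℕ → ℕ, IsCauchyName hx x ∧ ∀ i < σ.length, hx i = σ.getD i 0 := by
  choose c hc using fun i : ℕ => exists_pt_dist_lt x
    (by positivity : (0 : ℝ) < (2 : ℝ)⁻¹ ^ (i + 1))
  refine ⟨fun i => if i < σ.length then σ.getD i 0 else c i, isCauchyName_of_dist_le fun i => ?_,
    fun i hi => if_pos hi⟩
  by_cases hi : i < σ.length
  · simpa only [if_pos hi] using h i hi
  · simpa only [if_neg hi] using (hc i).le

/-- The superlevel sets of the sections of a lower semicomputable function at computable points are
unions of semidecidable families of balls, uniformly in the level. -/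
theorem IsLowerSemicomputable.exists_superlevel [ComputableMetricSpace X]
    {f : Y × Z × X → EReal} (hf : IsLowerSemicomputable f) {y : Y} (hy : IsComputablePoint y)
    {z : Z} (hz : IsComputablePoint z) :
    ∃ R : ℕ → ℕ → ℕ → Prop, (Semidecidable fun p : ℕ × ℕ × ℕ => R p.1 p.2.1 p.2.2) ∧
      ∀ q x, (((ratOfNat q : ℝ) : EReal) < f (y, z, x) ↔
        ∃ c b, R q c b ∧ dist (BasicPoints.pt c) x < 1 / ((b : ℝ) + 1)) := by
  obtain ⟨g, ⟨F, ⟨φ, hφ, hmono, hF⟩, H⟩, hgf⟩ := hf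
  obtain ⟨ny, hny, hyn⟩ := hy
  obtain ⟨nz, hnz, hzn⟩ := hz
  have hname : ∀ (n : ℕ) (x : X) (hx : ℕ → ℕ), IsCauchyName hx x → IsCauchyName
      (fun i => Nat.pair n (Nat.pair (ny i) (Nat.pair (nz i) (hx i)))) (n, (y, (z, x))) :=
    fun n x hx hxn => (isCauchyName_natConst n).prod (hyn.prod (hzn.prod hxn))
  have hpre : ∀ (n : ℕ) (σ : List ℕ) (hx : ℕ → ℕ), (∀ i < σ.length, hx i = σ.getD i 0) →
      (List.range σ.length).map
        (fun i => Nat.pair n (Nat.pair (ny i) (Nat.pair (nz i) (hx i)))) =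
      prefixName ny nz n σ := fun n σ hx h =>
    List.map_congr_left fun i hi => by rw [h i (List.mem_range.1 hi)]
  have hφ' : Computable fun p : ℕ × List ℕ × ℕ => φ (prefixName ny nz p.1 p.2.1) p.2.2 :=
    Computable.comp (f := fun p : List ℕ × ℕ => φ p.1 p.2)
      (g := fun p : ℕ × List ℕ × ℕ => (prefixName ny nz p.1 p.2.1, p.2.2)) hφ
      (computable_prodMk ((computable_prefixName hny hnz).comp
        (g := fun p : ℕ × List ℕ × ℕ => (p.1, p.2.1)) (by fun_prop)) (by fun_prop))
  -- The witness is `w = (n, σ, k)`. From the prefix `σ` of a name of `x` alone, the machine outputs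
  -- an approximation of `g n` of precision `k` that exceeds `q` by more than `2⁻ᵏ`. The second
  -- condition ensures that every point of the ball with centre `c` and radius `1 / (b + 1)` has a
  -- name extending `σ`.
  refine ⟨fun q c b => ∃ w : ℕ × List ℕ × ℕ,
    (((φ (prefixName ny nz w.1 w.2.1) w.2.2).isSome &&
      qlt (qadd q (qhalfPow w.2.2)) ((φ (prefixName ny nz w.1 w.2.1) w.2.2).getD 0)) = true) ∧
    ∀ i < w.2.1.length, dist (BasicPoints.pt c : X) (BasicPoints.pt (w.2.1.getD i 0)) +
      (posRat (Nat.pair 0 b) : ℝ) < (2 : ℝ)⁻¹ ^ (i + 1), ?_, ?_⟩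
  · refine Semidecidable.exists (p := fun (p : ℕ × ℕ × ℕ) (w : ℕ × List ℕ × ℕ) => _ ∧ _)
      (Semidecidable.and (Semidecidable.of_bool ?_) (Semidecidable.forall_lt (α := (ℕ × ℕ × ℕ) ×
        ℕ × List ℕ × ℕ) (p := fun v i => dist (BasicPoints.pt v.1.2.1 : X)
          (BasicPoints.pt (v.2.2.1.getD i 0)) + (posRat (Nat.pair 0 v.1.2.2) : ℝ) <
          (2 : ℝ)⁻¹ ^ (i + 1)) ?_ (n := fun v => v.2.2.1.length) (by fun_prop)))
    · have h1 : Computable fun v : (ℕ × ℕ × ℕ) × ℕ × List ℕ × ℕ =>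
          φ (prefixName ny nz v.2.1 v.2.2.1) v.2.2.2 :=
        hφ'.comp (g := fun v : (ℕ × ℕ × ℕ) × ℕ × List ℕ × ℕ => v.2) (by fun_prop)
      exact computable_and (computable_isSome h1)
        (computable_qlt (by fun_prop) (computable_getD h1 (by fun_prop)))
    · exact ComputableReals.semidecidable_lt
        (((dist_pt_computable (X := X)).comp
          (g := fun v : ((ℕ × ℕ × ℕ) × ℕ × List ℕ × ℕ) × ℕ =>
            (v.1.1.2.1, v.1.2.2.1.getD v.2 0)) (by fun_prop)).add
          (ComputableReals.posRat (by fun_prop)))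
        (ComputableReals.half_pow (by fun_prop))
  · intro q x
    rw [hgf, lt_iSup_iff]
    constructor
    · rintro ⟨n, hn⟩
      have hn' : (ratOfNat q : ℝ) < g (n, (y, (z, x))) := by exact_mod_cast hn
      -- This name is twice as accurate as necessary, so its prefixes still serve all points close
      -- to `x`.
      choose hx hhx using fun i : ℕ => exists_pt_dist_lt x
        (by positivity : (0 : ℝ) < (2 : ℝ)⁻¹ ^ (i + 2))
      have hxn : IsCauchyName hx x := isCauchyName_of_dist_le fun i =>
        (hhx i).le.trans (half_pow_le_half_pow (by omega))
      obtain ⟨v, hv, hvn⟩ := H _ _ (hname n x hx hxn)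
      obtain ⟨k, hk⟩ := exists_half_pow_lt (ε := (g (n, (y, (z, x))) - ratOfNat q) / 2)
        (by linarith)
      obtain ⟨m, hm⟩ := (hF _ _).1 hv k
      set σ : List ℕ := (List.range m).map hx with hσ
      have hσl : σ.length = m := by simp [hσ]
      have hσx : ∀ i < σ.length, hx i = σ.getD i 0 := fun i hi => by
        rw [hσl] at hi; simp [hσ, hi]
      have hφσ : φ (prefixName ny nz n σ) k = some (v k) := by
        rw [← hpre n σ hx hσx, hσl]; exact hm
      obtain ⟨c, hc⟩ := exists_pt_dist_lt x (by positivity : (0 : ℝ) < 1 / (((2 ^ (m + 3) - 1 : ℕ) :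
        ℝ) + 1))
      -- The radius is `2⁻¹ ^ (m + 3)`. Two such radii fit into the spare `2⁻¹ ^ (i + 2)` for every
      -- `i < m`: one for the distance of the centre from `x`, one for the ball.
      refine ⟨c, 2 ^ (m + 3) - 1, ⟨(n, σ, k), ?_, ?_⟩, hc⟩
      · simp only [hφσ, Option.isSome_some, Option.getD_some, Bool.true_and, qlt_iff,
          ratOfNat_qadd, ratOfNat_qhalfPow]
        have h1 := (abs_le.1 (hvn.dist_le k)).1
        have h2 : (BasicPoints.pt (v k) : ℝ) = ratOfNat (v k) := rfl
        rw [h2] at h1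
        have h3 : ((ratOfNat q + 2⁻¹ ^ k : ℚ) : ℝ) < ((ratOfNat (v k) : ℚ) : ℝ) := by
          push_cast; linarith
        exact_mod_cast h3
      · intro i hi
        have hi' : i < m := hσl ▸ hi
        have h1 : (1 : ℝ) / (((2 ^ (m + 3) - 1 : ℕ) : ℝ) + 1) = (2 : ℝ)⁻¹ ^ (m + 3) := by
          rw [Nat.cast_sub Nat.one_le_two_pow]; simp
        have h2 : (posRat (Nat.pair 0 (2 ^ (m + 3) - 1)) : ℝ) = (2 : ℝ)⁻¹ ^ (m + 3) := by
          rw [posRat_natPair, ← h1]; push_cast; ring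
        rw [h1] at hc
        show dist (BasicPoints.pt c : X) (BasicPoints.pt (σ.getD i 0)) + _ < _
        rw [h2, ← hσx i hi]
        have h3 := dist_triangle_right (BasicPoints.pt c : X) (BasicPoints.pt (hx i)) x
        have h4 := hhx i
        have h5 : (2 : ℝ)⁻¹ ^ (m + 3) + (2 : ℝ)⁻¹ ^ (m + 3) ≤ (2 : ℝ)⁻¹ ^ (i + 2) := by
          rw [half_pow_add_half_pow]; exact half_pow_le_half_pow (by omega)
        have h6 := half_pow_add_half_pow (i + 1)
        linarith
    · rintro ⟨c, b, ⟨⟨n, σ, k⟩, hw, hball⟩, hcx⟩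
      refine ⟨n, ?_⟩
      simp only [Bool.and_eq_true, qlt_iff, ratOfNat_qadd, ratOfNat_qhalfPow] at hw
      obtain ⟨v', hv'⟩ := Option.isSome_iff_exists.1 hw.1
      have hlt := hw.2
      rw [hv', Option.getD_some] at hlt
      -- Since `x` lies in the ball, it has a name starting with `σ`.
      obtain ⟨hx, hxn, hxσ⟩ := exists_isCauchyName_extending σ x fun i hi => by
        have h1 := hball i hi
        have h2 : (posRat (Nat.pair 0 b) : ℝ) = 1 / ((b : ℝ) + 1) := by
          rw [posRat_natPair]; push_cast; ring
        rw [h2] at h1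
        have h3 := dist_triangle_left (BasicPoints.pt (σ.getD i 0)) x (BasicPoints.pt c : X)
        linarith
      obtain ⟨v, hv, hvn⟩ := H _ _ (hname n x hx hxn)
      obtain ⟨m, hm⟩ := (hF _ _).1 hv k
      have hpσ : φ (prefixName ny nz n σ) k = some v' := hv'
      rw [← hpre n σ hx hxσ] at hpσ
      -- Of the two prefixes that produce an output one extends the other, and outputs persist under
      -- extension.
      have hvv : v k = v' := by
        rcases le_total m σ.length with hle | hle
        · have := hmono _ _ k _ (List.IsPrefix.map _ (isPrefix_range hle)) hm
          rw [this] at hpσ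
          exact Option.some.inj hpσ
        · have := hmono _ _ k _ (List.IsPrefix.map _ (isPrefix_range hle)) hpσ
          rw [this] at hm
          exact (Option.some.inj hm).symm
      have h1 := (abs_le.1 (hvn.dist_le k)).2
      have h2 : (BasicPoints.pt (v k) : ℝ) = ratOfNat v' := by rw [hvv]; rfl
      rw [h2] at h1
      have h3 : ((ratOfNat q + 2⁻¹ ^ k : ℚ) : ℝ) < ((ratOfNat v' : ℚ) : ℝ) := by exact_mod_cast hlt
      push_cast at h3
      have h4 : (ratOfNat q : ℝ) < g (n, (y, (z, x))) := by linarith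
      exact_mod_cast h4

end Superlevel

/-! ### Monotone approximation by basic functions -/

/-- The index of a rational constant. -/
def idxConst (q : ℕ) : ℕ := idxLin q 0 0 0

/-- The index of a positive rational multiple. -/
def idxSmul (q i : ℕ) : ℕ := idxLin (qpos q) 0 i 0

/-- The index of a sum. -/
def idxAdd (i j : ℕ) : ℕ := idxLin (qmk 1 0 0) (qmk 1 0 0) i j

/-- The index of the positive part of a difference. -/
def idxSubPos (i j : ℕ) : ℕ := idxMax (idxConst 0) (idxLin (qmk 1 0 0) (qmk 0 1 0) i j)

/-- The index of the `m`-th lower approximation to the indicator function of a ball. -/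
def idxBall (c ρ m : ℕ) : ℕ :=
  idxBump c (posMul ρ (Nat.pair m (m + 1))) (posMul ρ (Nat.pair 0 (m + 1)))

/-- The index of the maximum of the first `k` members of a sequence of nonnegative functions. -/
def supIdx (e : ℕ → ℕ) : ℕ → ℕ
  | 0 => idxConst 0
  | k + 1 => idxMax (supIdx e k) (e k)

section

variable {α : Type*} [Primcodable α]

@[fun_prop]
theorem computable_idxConst {f : α → ℕ} (hf : Computable f) :
    Computable fun a => idxConst (f a) := by
  unfold idxConst; fun_prop

@[fun_prop]
theorem computable_idxSmul {f g : α → ℕ} (hf : Computable f) (hg : Computable g) :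
    Computable fun a => idxSmul (f a) (g a) := by
  unfold idxSmul; fun_prop

@[fun_prop]
theorem computable_idxAdd {f g : α → ℕ} (hf : Computable f) (hg : Computable g) :
    Computable fun a => idxAdd (f a) (g a) := by
  unfold idxAdd; fun_prop

@[fun_prop]
theorem computable_idxSubPos {f g : α → ℕ} (hf : Computable f) (hg : Computable g) :
    Computable fun a => idxSubPos (f a) (g a) := by
  unfold idxSubPos; fun_prop

@[fun_prop]
theorem computable_idxBall {f g h : α → ℕ} (hf : Computable f) (hg : Computable g)
    (hh : Computable h) : Computable fun a => idxBall (f a) (g a) (h a) := by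
  unfold idxBall; fun_prop

theorem computable_supIdx {e : α → ℕ → ℕ} (he : Computable fun p : α × ℕ => e p.1 p.2) :
    Computable fun p : α × ℕ => supIdx (e p.1) p.2 :=
  computable_of_rec (f := fun a => supIdx (e a)) (g := fun _ => idxConst 0)
    (h := fun a k s => idxMax s (e a k)) (by fun_prop)
    (computable_idxMax (by fun_prop)
      (he.comp (g := fun p : α × ℕ × ℕ => (p.1, p.2.1)) (by fun_prop)))
    (fun _ => rfl) (fun _ _ => rfl)

end

section

variable {X : Type u} [PseudoMetricSpace X] [BasicPoints X]

theorem basicFun_idxConst (q : ℕ) (x : X) : basicFun X (idxConst q) x = ratOfNat q := by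
  rw [idxConst, basicFun_idxLin, basicFun_zero]
  -- The code `0` denotes the rational number `0`, so the second summand vanishes.
  simp [ratOfNat]

theorem basicFun_idxConst_zero (x : X) : basicFun X (idxConst 0) x = 0 := by
  rw [basicFun_idxConst]; simp [ratOfNat]

theorem basicFun_idxSmul (q i : ℕ) (x : X) :
    basicFun X (idxSmul q i) x = posRat q * basicFun X i x := by
  rw [idxSmul, basicFun_idxLin, ratOfNat_qpos]
  simp [ratOfNat]

theorem basicFun_idxAdd (i j : ℕ) (x : X) :
    basicFun X (idxAdd i j) x = basicFun X i x + basicFun X j x := by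
  simp [idxAdd, basicFun_idxLin]

theorem basicFun_idxSubPos (i j : ℕ) (x : X) :
    basicFun X (idxSubPos i j) x = max 0 (basicFun X i x - basicFun X j x) := by
  rw [idxSubPos, basicFun_idxMax]
  simp only [basicFun_idxConst_zero, basicFun_idxLin]
  simp [← sub_eq_add_neg]

/-- The `m`-th bump is `1` up to radius `ρ (m + 1) / (m + 2)` and reaches `0` exactly at radius `ρ`,
where the plateaus exhaust the open ball. -/
theorem iSup_basicFun_idxBall (c ρ : ℕ) (x : X) :
    ⨆ m, ENNReal.ofReal (basicFun X (idxBall c ρ m) x) =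
      (Metric.ball (BasicPoints.pt c : X) (posRat ρ : ℝ)).indicator 1 x := by
  have hρ : (0 : ℝ) < posRat ρ := by exact_mod_cast posRat_pos ρ
  have e1 : ∀ m : ℕ, (posRat (posMul ρ (Nat.pair m (m + 1))) : ℝ) =
      posRat ρ * (((m : ℝ) + 1) / (m + 2)) := fun m => by
    rw [posRat_posMul, posRat_natPair]; push_cast; ring
  have e2 : ∀ m : ℕ, (posRat (posMul ρ (Nat.pair 0 (m + 1))) : ℝ) =
      posRat ρ * (1 / (m + 2)) := fun m => by
    rw [posRat_posMul, posRat_natPair]; push_cast; ring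
  have e3 : ∀ m : ℕ, (posRat ρ : ℝ) * (((m : ℝ) + 1) / (m + 2)) + posRat ρ * (1 / (m + 2)) =
      posRat ρ := fun m => by
    field_simp; ring
  have e4 : ∀ m : ℕ, (0 : ℝ) < posRat ρ * (1 / (m + 2)) := fun m => by positivity
  have e5 : ∀ m : ℕ, basicFun X (idxBall c ρ m) x = max 0 (min 1 (
      ((posRat ρ : ℝ) * (1 / (m + 2)))⁻¹ * (posRat ρ - dist (BasicPoints.pt c) x))) := fun m => by
    rw [idxBall, basicFun_idxBump_apply, e1, e2, e3]
  by_cases hx : x ∈ Metric.ball (BasicPoints.pt c : X) (posRat ρ : ℝ)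
  · rw [Set.indicator_of_mem hx, Pi.one_apply]
    rw [Metric.mem_ball, dist_comm] at hx
    refine le_antisymm (iSup_le fun m => ?_) ?_
    · rw [e5]
      refine ENNReal.ofReal_le_one.2 (max_le zero_le_one (min_le_left _ _))
    · obtain ⟨m, hm⟩ := exists_nat_gt ((posRat ρ : ℝ) / (posRat ρ - dist (BasicPoints.pt c) x))
      refine le_iSup_of_le m ?_
      rw [e5, min_eq_left, max_eq_right zero_le_one, ENNReal.ofReal_one]
      have h1 : (0 : ℝ) < posRat ρ - dist (BasicPoints.pt c) x := by linarith
      rw [div_lt_iff₀ h1] at hm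
      rw [inv_mul_eq_div, one_le_div (e4 m), mul_one_div, div_le_iff₀ (by positivity)]
      nlinarith
  · rw [Set.indicator_of_notMem hx]
    rw [Metric.mem_ball, dist_comm] at hx
    refine le_antisymm (iSup_le fun m => ?_) zero_le
    rw [e5, max_eq_left, ENNReal.ofReal_zero]
    exact (min_le_right _ _).trans
      (mul_nonpos_of_nonneg_of_nonpos (inv_nonneg.2 (e4 m).le) (by linarith))

/-- `T` is the supremum of a computable increasing sequence of nonnegative basic functions. -/
structure IsLowerApprox (e : ℕ → ℕ) (T : X → ℝ≥0∞) : Prop where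
  computable : Computable e
  nonneg : ∀ k x, 0 ≤ basicFun X (e k) x
  mono : ∀ x, Monotone fun k => basicFun X (e k) x
  iSup_eq : ∀ x, T x = ⨆ k, ENNReal.ofReal (basicFun X (e k) x)

theorem supIdx_nonneg {e : ℕ → ℕ} (k : ℕ) (x : X) : 0 ≤ basicFun X (supIdx e k) x := by
  induction k with
  | zero => rw [supIdx, basicFun_idxConst_zero]
  | succ k ih => rw [supIdx, basicFun_idxMax]; exact le_max_of_le_left ih

theorem supIdx_mono (e : ℕ → ℕ) (x : X) : Monotone fun k => basicFun X (supIdx e k) x :=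
  monotone_nat_of_le_succ fun k => by
    rw [supIdx, basicFun_idxMax]; exact le_max_left _ _

theorem iSup_supIdx (e : ℕ → ℕ) (x : X) :
    ⨆ k, ENNReal.ofReal (basicFun X (supIdx e k) x) =
      ⨆ k, ENNReal.ofReal (basicFun X (e k) x) := by
  refine le_antisymm (iSup_le fun k => ?_) (iSup_le fun k => le_iSup_of_le (k + 1) ?_)
  · induction k with
    | zero => rw [supIdx, basicFun_idxConst_zero, ENNReal.ofReal_zero]; exact zero_le
    | succ k ih =>
      rw [supIdx, basicFun_idxMax, ENNReal.ofReal_max]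
      exact max_le ih (le_iSup (fun k => ENNReal.ofReal (basicFun X (e k) x)) k)
  · rw [supIdx, basicFun_idxMax]
    exact ENNReal.ofReal_le_ofReal (le_max_right _ _)

theorem isLowerApprox_supIdx {e : ℕ → ℕ} (he : Computable e) {T : X → ℝ≥0∞}
    (hT : ∀ x, T x = ⨆ k, ENNReal.ofReal (basicFun X (e k) x)) : IsLowerApprox (supIdx e) T :=
  ⟨(computable_supIdx (e := fun _ : Unit => e) (he.comp (by fun_prop))).comp
    (g := fun k => ((), k)) (by fun_prop), supIdx_nonneg, supIdx_mono e,
    fun x => (hT x).trans (iSup_supIdx e x).symm⟩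

theorem IsLowerApprox.ofReal_le {e : ℕ → ℕ} {T : X → ℝ≥0∞} (h : IsLowerApprox e T) (k : ℕ) (x : X) :
    ENNReal.ofReal (basicFun X (e k) x) ≤ T x := by
  rw [h.iSup_eq]; exact le_iSup (fun k => ENNReal.ofReal (basicFun X (e k) x)) k

theorem IsLowerApprox.lt_iff {e : ℕ → ℕ} {T : X → ℝ≥0∞} (h : IsLowerApprox e T) {r : ℝ}
    (hr : 0 ≤ r) (x : X) : ENNReal.ofReal r < T x ↔ ∃ k, r < basicFun X (e k) x := by
  rw [h.iSup_eq, lt_iSup_iff]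
  exact exists_congr fun k => ENNReal.ofReal_lt_ofReal_iff_of_nonneg hr

end

theorem exists_posRat_btwn {a b : ℝ≥0∞} (h : a < b) :
    ∃ q, a ≤ ENNReal.ofReal (posRat q : ℝ) ∧ ENNReal.ofReal (posRat q : ℝ) < b := by
  obtain ⟨r, hr0, har, hrb⟩ := ENNReal.lt_iff_exists_rat_btwn.1 h
  have hr1 : (0 : ℝ) ≤ (r : ℝ) := by exact_mod_cast hr0
  have e : ∀ s : ℚ, ((Real.toNNReal (s : ℝ) : NNReal) : ℝ≥0∞) = ENNReal.ofReal (s : ℝ) :=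
    fun s => rfl
  rw [e] at har hrb
  have hr2 : 0 < (r : ℝ) := by
    rcases hr1.lt_or_eq with h | h
    · exact h
    · rw [← h] at har; simp at har
  obtain ⟨q, hq⟩ := exists_posRat (q := r) (by exact_mod_cast hr2)
  exact ⟨q, by rw [hq]; exact har.le, by rw [hq]; exact hrb⟩

/-- The section of a lower semicomputable function at computable points is the supremum of a
computable increasing sequence of basic functions. -/
theorem IsLowerSemicomputable.exists_isLowerApprox {Y : Type u} {Z : Type v} {X : Type w}
    [PseudoMetricSpace Y] [BasicPoints Y] [PseudoMetricSpace Z] [BasicPoints Z] [MetricSpace X]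
    [BasicPoints X] [ComputableMetricSpace X] {t : Y × Z × X → ℝ≥0∞}
    (ht : IsLowerSemicomputable fun p => (t p : EReal)) {y : Y} (hy : IsComputablePoint y)
    {z : Z} (hz : IsComputablePoint z) :
    ∃ e, IsLowerApprox e fun x => t (y, z, x) := by
  obtain ⟨R, ⟨test, htest, hR⟩, hlt⟩ := ht.exists_superlevel hy hz
  have hcoe : ∀ q x, ENNReal.ofReal (posRat q : ℝ) < t (y, z, x) ↔
      ∃ c b, R (qpos q) c b ∧ dist (BasicPoints.pt c) x < 1 / ((b : ℝ) + 1) := fun q x => by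
    rw [← hlt, ratOfNat_qpos, ← EReal.coe_ennreal_lt_coe_ennreal_iff, EReal.coe_ennreal_ofReal,
      max_eq_left (by exact_mod_cast (posRat_pos q).le)]
  -- Here `s` codes `(q, c, b, k, m)`. If `k` witnesses that the ball given by `c` and `b` lies in
  -- `{T > q}`, take `q` times the `m`-th approximation to its indicator function, otherwise `0`.
  let e : ℕ → ℕ := fun s =>
    bif test (qpos s.unpair.1, s.unpair.2.unpair.1, s.unpair.2.unpair.2.unpair.1)
        s.unpair.2.unpair.2.unpair.2.unpair.1 then
      idxSmul s.unpair.1 (idxBall s.unpair.2.unpair.1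
        (Nat.pair 0 s.unpair.2.unpair.2.unpair.1) s.unpair.2.unpair.2.unpair.2.unpair.2)
    else idxConst 0
  have he : Computable e := by
    refine computable_cond (htest.comp (g := fun s : ℕ => ((qpos s.unpair.1, s.unpair.2.unpair.1,
      s.unpair.2.unpair.2.unpair.1), s.unpair.2.unpair.2.unpair.2.unpair.1)) (by fun_prop))
      (by fun_prop) (by fun_prop)
  have hball : ∀ b : ℕ, (posRat (Nat.pair 0 b) : ℝ) = 1 / ((b : ℝ) + 1) := fun b => by
    rw [posRat_natPair]; push_cast; ring
  refine ⟨supIdx e, isLowerApprox_supIdx he fun x => ?_⟩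
  have hsm : ∀ q c b : ℕ, ⨆ m, ENNReal.ofReal (basicFun X (idxSmul q
      (idxBall c (Nat.pair 0 b) m)) x) = ENNReal.ofReal (posRat q : ℝ) *
      (Metric.ball (BasicPoints.pt c : X) (1 / ((b : ℝ) + 1))).indicator 1 x := fun q c b => by
    rw [← hball, ← iSup_basicFun_idxBall, ENNReal.mul_iSup]
    refine iSup_congr fun m => ?_
    rw [basicFun_idxSmul, ENNReal.ofReal_mul (by exact_mod_cast (posRat_pos q).le)]
  -- `T x` is the supremum of the positive rationals below it: each of them is contributed by an
  -- accepted ball around `x`, and accepted balls contribute nothing larger.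
  refine le_antisymm (le_of_forall_lt fun a ha => ?_) (iSup_le fun s => ?_)
  · obtain ⟨a', haa', ha'⟩ := exists_between ha
    obtain ⟨q, hq1, hq2⟩ := exists_posRat_btwn ha'
    obtain ⟨c, b, hRb, hd⟩ := (hcoe q x).1 hq2
    obtain ⟨k, hk⟩ := (hR (qpos q, c, b)).1 hRb
    refine (haa'.trans_le hq1).trans_le ?_
    have h1 : ENNReal.ofReal (posRat q : ℝ) = ⨆ m, ENNReal.ofReal (basicFun X (idxSmul q
        (idxBall c (Nat.pair 0 b) m)) x) := by
      rw [hsm, Set.indicator_of_mem (by rwa [Metric.mem_ball, dist_comm]), Pi.one_apply, mul_one]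
    rw [h1]
    refine iSup_le fun m => le_iSup_of_le
      (Nat.pair q (Nat.pair c (Nat.pair b (Nat.pair k m)))) (le_of_eq ?_)
    simp [e, hk]
  · by_cases hs : test (qpos s.unpair.1, s.unpair.2.unpair.1, s.unpair.2.unpair.2.unpair.1)
        s.unpair.2.unpair.2.unpair.2.unpair.1 = true
    · have h1 : e s = idxSmul s.unpair.1 (idxBall s.unpair.2.unpair.1
        (Nat.pair 0 s.unpair.2.unpair.2.unpair.1) s.unpair.2.unpair.2.unpair.2.unpair.2) := by
        simp only [e, hs, cond_true]
      rw [h1]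
      refine (le_iSup (fun m => ENNReal.ofReal (basicFun X (idxSmul s.unpair.1
        (idxBall s.unpair.2.unpair.1 (Nat.pair 0 s.unpair.2.unpair.2.unpair.1) m)) x)) _).trans ?_
      rw [hsm]
      by_cases hx : x ∈ Metric.ball (BasicPoints.pt s.unpair.2.unpair.1 : X)
          (1 / ((s.unpair.2.unpair.2.unpair.1 : ℝ) + 1))
      · rw [Set.indicator_of_mem hx, Pi.one_apply, mul_one]
        refine ((hcoe _ x).2 ⟨_, _, (hR _).2 ⟨_, hs⟩, ?_⟩).le
        rwa [Metric.mem_ball, dist_comm] at hx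
      · rw [Set.indicator_of_notMem hx, mul_zero]
        exact zero_le
    · have h1 : e s = idxConst 0 := by
        simp only [e, Bool.eq_false_iff.2 hs, cond_false]
      rw [h1, basicFun_idxConst_zero, ENNReal.ofReal_zero]
      exact zero_le

/-! ### Integrals along monotone approximations -/

section Integrals

variable {X : Type u} [MetricSpace X] [BasicPoints X] [MeasurableSpace X] [BorelSpace X]

theorem lintegral_ofReal_basicFun (μ : Measure X) [IsFiniteMeasure μ] {i : ℕ}
    (hi : ∀ x, 0 ≤ basicFun X i x) :
    ∫⁻ x, ENNReal.ofReal (basicFun X i x) ∂μ = ENNReal.ofReal (∫ x, basicFun X i x ∂μ) :=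
  (ofReal_integral_eq_lintegral_ofReal (integrable_basicFun μ i) (Eventually.of_forall hi)).symm

theorem IsLowerApprox.measurable {e : ℕ → ℕ} {T : X → ℝ≥0∞} (h : IsLowerApprox e T) :
    Measurable T := by
  rw [funext h.iSup_eq]
  exact Measurable.iSup fun k => (continuous_basicFun (e k)).measurable.ennreal_ofReal

variable {e : ℕ → ℕ} {T : X → ℝ≥0∞} (μ : Measure X) [IsFiniteMeasure μ]

theorem IsLowerApprox.lintegral_eq (h : IsLowerApprox e T) :
    ∫⁻ x, T x ∂μ = ⨆ k, ENNReal.ofReal (∫ x, basicFun X (e k) x ∂μ) := by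
  simp only [h.iSup_eq]
  rw [lintegral_iSup (fun k => (continuous_basicFun (e k)).measurable.ennreal_ofReal)
    (fun k l hkl x => ENNReal.ofReal_le_ofReal (h.mono x hkl))]
  exact iSup_congr fun k => lintegral_ofReal_basicFun μ (h.nonneg k)

/-- Monotone convergence. The clause `N ≤ k` ensures that a rate found by search leads to a cofinal
subsequence. -/
theorem IsLowerApprox.exists_sub_lt (h : IsLowerApprox e T) {ε : ℝ} (hε : 0 < ε) (N : ℕ) :
    ∃ k, N ≤ k ∧ (∫⁻ x, T x ∂μ).toReal - ∫ x, basicFun X (e k) x ∂μ < ε := by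
  have hmono : Monotone fun k => ∫ x, basicFun X (e k) x ∂μ := fun k l hkl =>
    integral_mono (integrable_basicFun μ _) (integrable_basicFun μ _) fun x => h.mono x hkl
  have h1 : ∃ k, (∫⁻ x, T x ∂μ).toReal - ε < ∫ x, basicFun X (e k) x ∂μ := by
    by_contra! hc
    have h2 : ∫⁻ x, T x ∂μ ≤ ENNReal.ofReal ((∫⁻ x, T x ∂μ).toReal - ε) := by
      conv_lhs => rw [h.lintegral_eq μ]
      exact iSup_le fun k => ENNReal.ofReal_le_ofReal (hc k)
    -- Nonnegative integrals lie below this number, so `ENNReal.ofReal` does not truncate it.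
    have h0 : (0 : ℝ) ≤ (∫⁻ x, T x ∂μ).toReal - ε :=
      (integral_nonneg (h.nonneg 0)).trans (hc 0)
    have h3 := ENNReal.toReal_le_of_le_ofReal h0 h2
    linarith
  obtain ⟨k, hk⟩ := h1
  refine ⟨max N k, le_max_left _ _, ?_⟩
  have := hmono (le_max_right N k)
  simp only at this
  linarith

/-- If the integral is computable, then so is the rate of convergence of the approximation. -/
theorem IsLowerApprox.exists_rate [ComputableMetricSpace X] (h : IsLowerApprox e T)
    {ν : FinMeas X} (hν : IsComputablePoint ν)
    (hI : ComputableReals fun _ : ℕ × ℕ => (∫⁻ x, T x ∂ν.toMeasure).toReal) :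
    ∃ K : ℕ → ℕ, Computable K ∧ ∀ l, l ≤ K l ∧
      (∫⁻ x, T x ∂ν.toMeasure).toReal - ∫ x, basicFun X (e (K l)) x ∂ν.toMeasure <
        (2 : ℝ)⁻¹ ^ l := by
  have hc := h.computable
  refine Semidecidable.choice (p := fun l k => l ≤ k ∧ (∫⁻ x, T x ∂ν.toMeasure).toReal -
    ∫ x, basicFun X (e k) x ∂ν.toMeasure < (2 : ℝ)⁻¹ ^ l) ?_
    fun l => h.exists_sub_lt _ (by positivity) l
  refine Semidecidable.and ?_ (ComputableReals.semidecidable_lt (hI.sub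
    ((computableReals_integral hν).comp (g := fun p : ℕ × ℕ => e p.2) (by fun_prop)))
    (ComputableReals.half_pow (by fun_prop)))
  have := Semidecidable.of_bool (q := fun p : ℕ × ℕ => decide (p.1 ≤ p.2)) (by fun_prop)
  simpa using this

end Integrals

/-! ### Effectively open sets from basic functions -/

section EffectivelyOpen

variable {X : Type u} [MetricSpace X] [BasicPoints X] [ComputableMetricSpace X]

/-- Unions of computable sequences of superlevel sets of basic functions are effectively open. -/
theorem isEffectivelyOpenSeq_superlevel {d c : ℕ → ℕ → ℕ}
    (hd : Computable fun p : ℕ × ℕ => d p.1 p.2) (hc : Computable fun p : ℕ × ℕ => c p.1 p.2) :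
    IsEffectivelyOpenSeq fun n =>
      {x : X | ∃ s, (ratOfNat (c n s) : ℝ) < basicFun X (d n s) x} := by
  -- By the Lipschitz bound `gauge`, this inequality at the centre puts the whole ball of radius `1
  -- / (b + 1)` into the superlevel set.
  have hR : Semidecidable fun p : ℕ × ℕ × ℕ => ∃ s, (ratOfNat (c p.1 s) : ℝ) +
      gauge (d p.1 s) * posRat (Nat.pair 0 p.2.2) < basicFun X (d p.1 s) (BasicPoints.pt p.2.1) := by
    have hc' : Computable fun q : (ℕ × ℕ × ℕ) × ℕ => c q.1.1 q.2 :=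
      hc.comp (g := fun q : (ℕ × ℕ × ℕ) × ℕ => (q.1.1, q.2)) (by fun_prop)
    have hd' : Computable fun q : (ℕ × ℕ × ℕ) × ℕ => d q.1.1 q.2 :=
      hd.comp (g := fun q : (ℕ × ℕ × ℕ) × ℕ => (q.1.1, q.2)) (by fun_prop)
    exact Semidecidable.exists (p := fun (p : ℕ × ℕ × ℕ) s => (ratOfNat (c p.1 s) : ℝ) +
      gauge (d p.1 s) * posRat (Nat.pair 0 p.2.2) < basicFun X (d p.1 s) (BasicPoints.pt p.2.1))
      (ComputableReals.semidecidable_lt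
        ((ComputableReals.ratOfNat hc').add ((ComputableReals.natCast (computable_gauge hd')).mul
          (ComputableReals.posRat (by fun_prop))))
        ((computableReals_basicFun_pt X).comp
          (g := fun q : (ℕ × ℕ × ℕ) × ℕ => (d q.1.1 q.2, q.1.2.1)) (by fun_prop)))
  obtain ⟨test, htest, hR⟩ := hR
  have hb : ∀ b : ℕ, (posRat (Nat.pair 0 b) : ℝ) = 1 / ((b : ℝ) + 1) := fun b => by
    rw [posRat_natPair]; push_cast; ring
  -- The set of balls has to be decidable, whereas the condition above is only semidecidable. The
  -- radius `1 / (b + 1)` is therefore written as the unreduced fraction `(k + 1) / ((k + 1) * (b +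
  -- 1))`, whose numerator records a witness `k` that can be checked.
  let B : ℕ → Bool := fun i =>
    decide ((i.unpair.2.unpair.2 + 1) % (i.unpair.2.unpair.1 + 1) = 0) &&
      test (i.unpair.1.unpair.1, i.unpair.1.unpair.2,
        (i.unpair.2.unpair.2 + 1) / (i.unpair.2.unpair.1 + 1) - 1) i.unpair.2.unpair.1
  have hB : Computable B := computable_and (by fun_prop)
    (htest.comp (g := fun i : ℕ => ((i.unpair.1.unpair.1, i.unpair.1.unpair.2,
      (i.unpair.2.unpair.2 + 1) / (i.unpair.2.unpair.1 + 1) - 1), i.unpair.2.unpair.1))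
      (by fun_prop))
  refine ⟨⋃ i ∈ {i | B i = true}, basicBall (ℕ × X) i, ⟨{i | B i = true},
    Computable.computablePred (p := fun i => B i = true) (hB.of_eq fun i => by simp), rfl⟩,
    fun n => ?_⟩
  ext x
  simp only [Set.mem_ofPred_eq, Set.mem_iUnion, exists_prop]
  constructor
  · rintro ⟨s, hs⟩
    -- The factor `2` pays for moving from `x` to the centre and for the variation over the ball.
    obtain ⟨b, hb1⟩ := exists_nat_gt
      (2 * (gauge (d n s) : ℝ) / (basicFun X (d n s) x - ratOfNat (c n s)))
    have h1 : 0 < basicFun X (d n s) x - ratOfNat (c n s) := by linarith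
    rw [div_lt_iff₀ h1] at hb1
    have hbp : (0 : ℝ) < (b : ℝ) + 1 := by positivity
    obtain ⟨p, hp⟩ := exists_pt_dist_lt x (by positivity : (0 : ℝ) < 1 / ((b : ℝ) + 1))
    have h2 : 2 * ((gauge (d n s) : ℝ) * (1 / ((b : ℝ) + 1))) <
        basicFun X (d n s) x - ratOfNat (c n s) := by
      rw [mul_one_div, ← mul_div_assoc, div_lt_iff₀ hbp]
      nlinarith
    have h3 : (gauge (d n s) : ℝ) * dist (BasicPoints.pt p) x ≤
        gauge (d n s) * (1 / ((b : ℝ) + 1)) :=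
      mul_le_mul_of_nonneg_left hp.le (Nat.cast_nonneg _)
    have h4 := (abs_le.1 (abs_basicFun_sub_le (d n s) (BasicPoints.pt p) x)).1
    obtain ⟨k, hk⟩ := (hR (n, p, b)).1 ⟨s, by simp only [hb]; linarith⟩
    have h5 : (k + 1) * (b + 1) - 1 + 1 = (k + 1) * (b + 1) :=
      Nat.sub_add_cancel (Nat.mul_pos (Nat.succ_pos _) (Nat.succ_pos _))
    refine ⟨Nat.pair (Nat.pair n p) (Nat.pair k ((k + 1) * (b + 1) - 1)), ?_, ?_⟩
    · simp only [B, Nat.unpair_pair, h5, Nat.mul_mod_right,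
        Nat.mul_div_cancel_left _ (Nat.succ_pos k), Nat.add_sub_cancel]
      simpa using hk
    · have h6 : (posRat (Nat.pair k ((k + 1) * (b + 1) - 1)) : ℝ) = 1 / ((b : ℝ) + 1) := by
        have h7 : (((k + 1) * (b + 1) - 1 : ℕ) : ℚ) + 1 = ((k : ℚ) + 1) * (b + 1) := by
          exact_mod_cast h5
        rw [posRat_natPair, h7]
        push_cast
        field_simp
      have h8 : (BasicPoints.pt (Nat.pair n p) : ℕ × X) = (n, BasicPoints.pt p) := by
        show ((BasicPoints.pt (Nat.pair n p).unpair.1 : ℕ),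
          (BasicPoints.pt (Nat.pair n p).unpair.2 : X)) = _
        rw [Nat.unpair_pair]; rfl
      rw [basicBall, Nat.unpair_pair, h8, h6, Metric.mem_ball, Prod.dist_eq, dist_self,
        dist_comm x, max_lt_iff]
      exact ⟨by positivity, hp⟩
  · rintro ⟨i, hi, hx⟩
    simp only [B, Bool.and_eq_true, decide_eq_true_eq] at hi
    obtain ⟨hi1, hi2⟩ := hi
    obtain ⟨s, hs⟩ := (hR _).2 ⟨_, hi2⟩
    set b := (i.unpair.2.unpair.2 + 1) / (i.unpair.2.unpair.1 + 1) - 1 with hbdef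
    have h1 : i.unpair.2.unpair.2 + 1 = (i.unpair.2.unpair.1 + 1) * (b + 1) := by
      obtain ⟨t, ht⟩ := Nat.dvd_of_mod_eq_zero hi1
      have ht0 : 0 < t := Nat.pos_of_ne_zero fun h => by simp [h] at ht
      have hbt : b + 1 = t := by
        rw [hbdef, ht, Nat.mul_div_cancel_left _ (Nat.succ_pos _)]
        exact Nat.sub_add_cancel ht0
      rw [hbt, ← ht]
    have h2 : (posRat i.unpair.2 : ℝ) = 1 / ((b : ℝ) + 1) := by
      have h3 : ((i.unpair.2.unpair.2 : ℕ) : ℚ) + 1 =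
          ((i.unpair.2.unpair.1 : ℚ) + 1) * (b + 1) := by exact_mod_cast h1
      rw [posRat, h3]
      push_cast
      field_simp
    rw [basicBall, h2, Metric.mem_ball, Prod.dist_eq, max_lt_iff] at hx
    obtain ⟨hx1, hx2⟩ := hx
    have h4 : (1 : ℝ) / ((b : ℝ) + 1) ≤ 1 := by
      rw [div_le_one (by positivity)]
      simp
    -- A ball of radius at most `1` in `ℕ` consists of its centre alone.
    have h5 : n = i.unpair.1.unpair.1 := by
      have h6 : dist n i.unpair.1.unpair.1 < 1 := hx1.trans_le h4
      by_contra hne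
      have := Nat.pairwise_one_le_dist hne
      linarith
    have h7 : dist x (BasicPoints.pt i.unpair.1.unpair.2 : X) < 1 / ((b : ℝ) + 1) := hx2
    simp only [← h5, hb] at hs
    refine ⟨s, ?_⟩
    have h8 := (abs_le.1 (abs_basicFun_sub_le (d n s) x (BasicPoints.pt i.unpair.1.unpair.2))).1
    have h9 := mul_le_mul_of_nonneg_left h7.le (Nat.cast_nonneg (α := ℝ) (gauge (d n s)))
    linarith

end EffectivelyOpen

/-! ### Integrals of truncations -/

section Truncation

variable {X : Type u} [MeasurableSpace X]

/-- The integral of the truncation of a function at a level. -/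
noncomputable def truncIntegral (μ : Measure X) (T : X → ℝ≥0∞) (q : ℝ) : ℝ :=
  (∫⁻ x, min (T x) (ENNReal.ofReal q) ∂μ).toReal

variable (μ : Measure X) [IsFiniteMeasure μ] {T : X → ℝ≥0∞}

theorem lintegral_min_ne_top (q : ℝ) : ∫⁻ x, min (T x) (ENNReal.ofReal q) ∂μ ≠ ∞ := by
  refine ne_top_of_le_ne_top ?_ (lintegral_mono fun x => min_le_right _ _)
  rw [lintegral_const]
  exact ENNReal.mul_ne_top ENNReal.ofReal_ne_top (measure_ne_top _ _)

/-- Pointwise, `min(T, q) - min(T, p)` is at most `q - p` and vanishes where `T ≤ p`. -/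
theorem truncIntegral_sub_le (hT : Measurable T) {p q : ℝ} (hp : 0 ≤ p) (hpq : p ≤ q) :
    truncIntegral μ T q - truncIntegral μ T p ≤ (q - p) * μ.real {x | ENNReal.ofReal p < T x} := by
  have hm : MeasurableSet {x | ENNReal.ofReal p < T x} := measurableSet_lt measurable_const hT
  have h1 : ∫⁻ x, min (T x) (ENNReal.ofReal q) ∂μ ≤ ∫⁻ x, min (T x) (ENNReal.ofReal p) ∂μ +
      ENNReal.ofReal (q - p) * μ {x | ENNReal.ofReal p < T x} := by
    rw [← lintegral_indicator_const hm,
      ← lintegral_add_right _ (measurable_const.indicator hm)]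
    refine lintegral_mono fun x => ?_
    by_cases hx : ENNReal.ofReal p < T x
    · rw [Set.indicator_of_mem (by exact hx), min_eq_right hx.le,
        ← ENNReal.ofReal_add hp (by linarith), add_sub_cancel]
      exact min_le_right _ _
    · rw [Set.indicator_of_notMem (by exact hx), add_zero, min_eq_left (not_lt.1 hx)]
      exact min_le_left _ _
  have h2 := ENNReal.toReal_mono (ENNReal.add_ne_top.2 ⟨lintegral_min_ne_top μ p,
    ENNReal.mul_ne_top ENNReal.ofReal_ne_top (measure_ne_top _ _)⟩) h1
  rw [ENNReal.toReal_add (lintegral_min_ne_top μ p)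
    (ENNReal.mul_ne_top ENNReal.ofReal_ne_top (measure_ne_top _ _)), ENNReal.toReal_mul,
    ENNReal.toReal_ofReal (by linarith)] at h2
  simp only [truncIntegral, Measure.real]
  linarith

/-- Pointwise, `min(T, q) - min(T, p)` is nonnegative and equals `q - p` where `T ≥ q`. -/
theorem le_truncIntegral_sub (hT : Measurable T) {p q : ℝ} (hp : 0 ≤ p) (hpq : p ≤ q) :
    (q - p) * μ.real {x | ENNReal.ofReal q ≤ T x} ≤ truncIntegral μ T q - truncIntegral μ T p := by
  have hm : MeasurableSet {x | ENNReal.ofReal q ≤ T x} := measurableSet_le measurable_const hT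
  have h1 : ∫⁻ x, min (T x) (ENNReal.ofReal p) ∂μ +
      ENNReal.ofReal (q - p) * μ {x | ENNReal.ofReal q ≤ T x} ≤
      ∫⁻ x, min (T x) (ENNReal.ofReal q) ∂μ := by
    rw [← lintegral_indicator_const hm,
      ← lintegral_add_right _ (measurable_const.indicator hm)]
    refine lintegral_mono fun x => ?_
    by_cases hx : ENNReal.ofReal q ≤ T x
    · rw [Set.indicator_of_mem (by exact hx), min_eq_right hx,
        min_eq_right ((ENNReal.ofReal_le_ofReal hpq).trans hx),
        ← ENNReal.ofReal_add hp (by linarith), add_sub_cancel]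
    · rw [Set.indicator_of_notMem (by exact hx), add_zero]
      exact min_le_min_left _ (ENNReal.ofReal_le_ofReal hpq)
  have h2 := ENNReal.toReal_mono (lintegral_min_ne_top μ q) h1
  rw [ENNReal.toReal_add (lintegral_min_ne_top μ p)
    (ENNReal.mul_ne_top ENNReal.ofReal_ne_top (measure_ne_top _ _)), ENNReal.toReal_mul,
    ENNReal.toReal_ofReal (by linarith)] at h2
  simp only [truncIntegral, Measure.real]
  linarith

end Truncation

/-! ### Computability of the integrals of truncations -/

section TruncationComputable

variable {X : Type u} [MetricSpace X] [BasicPoints X] [MeasurableSpace X] [BorelSpace X]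
  {e : ℕ → ℕ} {T : X → ℝ≥0∞}

/-- Truncation does not increase distances: if `f ≤ T`, then `0 ≤ min(T, q) - min(f, q) ≤ T - f`.
The error is thus independent of the level `q`. -/
theorem IsLowerApprox.abs_truncIntegral_sub_le (h : IsLowerApprox e T) (μ : Measure X)
    [IsFiniteMeasure μ] (hT : ∫⁻ x, T x ∂μ ≠ ∞) (k : ℕ) {q : ℕ} (hq : 0 ≤ ratOfNat q) :
    |(∫ x, basicFun X (idxMin (e k) (idxConst q)) x ∂μ) - truncIntegral μ T (ratOfNat q : ℝ)| ≤
      (∫⁻ x, T x ∂μ).toReal - ∫ x, basicFun X (e k) x ∂μ := by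
  have hq' : (0 : ℝ) ≤ ratOfNat q := by exact_mod_cast hq
  have hf : ∀ x, basicFun X (idxMin (e k) (idxConst q)) x =
      min (basicFun X (e k) x) (ratOfNat q) := fun x => by
    rw [basicFun_idxMin]; simp only [basicFun_idxConst]
  have hpos : ∀ x, 0 ≤ basicFun X (idxMin (e k) (idxConst q)) x := fun x => by
    rw [hf]; exact le_min (h.nonneg k x) hq'
  have h0 : ∀ x, ENNReal.ofReal (basicFun X (idxMin (e k) (idxConst q)) x) =
      min (ENNReal.ofReal (basicFun X (e k) x)) (ENNReal.ofReal (ratOfNat q)) := fun x => by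
    rw [hf, ENNReal.ofReal_min]
  have h1 : ENNReal.ofReal (∫ x, basicFun X (idxMin (e k) (idxConst q)) x ∂μ) ≤
      ∫⁻ x, min (T x) (ENNReal.ofReal (ratOfNat q)) ∂μ := by
    rw [← lintegral_ofReal_basicFun μ hpos]
    refine lintegral_mono fun x => ?_
    rw [h0]
    exact min_le_min_right _ (h.ofReal_le k x)
  -- Stated with sums, to avoid truncated subtraction in `ℝ≥0∞`.
  have h2 : ∫⁻ x, min (T x) (ENNReal.ofReal (ratOfNat q)) ∂μ +
      ENNReal.ofReal (∫ x, basicFun X (e k) x ∂μ) ≤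
      ENNReal.ofReal (∫ x, basicFun X (idxMin (e k) (idxConst q)) x ∂μ) + ∫⁻ x, T x ∂μ := by
    rw [← lintegral_ofReal_basicFun μ hpos, ← lintegral_ofReal_basicFun μ (h.nonneg k),
      ← lintegral_add_right _ h.measurable,
      ← lintegral_add_right _ (continuous_basicFun (e k)).measurable.ennreal_ofReal]
    refine lintegral_mono fun x => ?_
    rw [h0]
    have hle := h.ofReal_le k x
    rcases le_total (ENNReal.ofReal (ratOfNat q)) (ENNReal.ofReal (basicFun X (e k) x)) with h3 | h3
    · rw [min_eq_right h3, min_eq_right (h3.trans hle)]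
      exact add_le_add_right hle _
    · rw [min_eq_left h3, add_comm]
      exact add_le_add_right (min_le_left _ _) _
  have i1 : 0 ≤ ∫ x, basicFun X (idxMin (e k) (idxConst q)) x ∂μ := integral_nonneg hpos
  have i2 : 0 ≤ ∫ x, basicFun X (e k) x ∂μ := integral_nonneg (h.nonneg k)
  have h3 := (ENNReal.ofReal_le_iff_le_toReal (lintegral_min_ne_top μ _)).1 h1
  have h4 := ENNReal.toReal_mono (ENNReal.add_ne_top.2 ⟨ENNReal.ofReal_ne_top, hT⟩) h2
  rw [ENNReal.toReal_add (lintegral_min_ne_top μ _) ENNReal.ofReal_ne_top,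
    ENNReal.toReal_add ENNReal.ofReal_ne_top hT, ENNReal.toReal_ofReal i1,
    ENNReal.toReal_ofReal i2] at h4
  rw [abs_sub_comm, truncIntegral, abs_of_nonneg (by linarith)]
  linarith

/-- The integrals of the truncations are computable if the integral is. -/
theorem IsLowerApprox.computableReals_truncIntegral [ComputableMetricSpace X]
    (h : IsLowerApprox e T) {ν : FinMeas X} (hν : IsComputablePoint ν)
    (hT : ∫⁻ x, T x ∂ν.toMeasure ≠ ∞)
    (hI : ComputableReals fun _ : ℕ × ℕ => (∫⁻ x, T x ∂ν.toMeasure).toReal)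
    {α : Type*} [Primcodable α] {c : α → ℕ} (hc : Computable c) (hc0 : ∀ a, 0 ≤ ratOfNat (c a)) :
    ComputableReals fun a => truncIntegral ν.toMeasure T (ratOfNat (c a) : ℝ) := by
  obtain ⟨K, hK, hKI⟩ := h.exists_rate hν hI
  have he := h.computable
  refine ComputableReals.of_approx (F := fun a k =>
    ∫ x, basicFun X (idxMin (e (K k)) (idxConst (c a))) x ∂ν.toMeasure)
    ((computableReals_integral hν).comp
      (g := fun p : α × ℕ => idxMin (e (K p.2)) (idxConst (c p.1))) (by fun_prop)) fun a k => ?_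
  exact (h.abs_truncIntegral_sub_le _ hT _ (hc0 a)).trans (hKI k).2.le

end TruncationComputable

/-! ### Levels at which the distribution function is nearly continuous -/

/-- The code of the sum of the first `i` of the positive rationals coded by a quadruple `s`. -/
def cut (s : ℕ) : ℕ → ℕ
  | 0 => qpos s.unpair.1
  | 1 => qadd (qpos s.unpair.1) (qpos s.unpair.2.unpair.1)
  | 2 => qadd (qadd (qpos s.unpair.1) (qpos s.unpair.2.unpair.1)) (qpos s.unpair.2.unpair.2.unpair.1)
  | _ => qadd (qadd (qadd (qpos s.unpair.1) (qpos s.unpair.2.unpair.1))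
      (qpos s.unpair.2.unpair.2.unpair.1)) (qpos s.unpair.2.unpair.2.unpair.2)

theorem cut_zero_eq (s : ℕ) : cut s 0 = qpos s.unpair.1 := rfl

theorem cut_one_eq (s : ℕ) : cut s 1 = qadd (cut s 0) (qpos s.unpair.2.unpair.1) := rfl

theorem cut_two_eq (s : ℕ) : cut s 2 = qadd (cut s 1) (qpos s.unpair.2.unpair.2.unpair.1) := rfl

theorem cut_three_eq (s : ℕ) : cut s 3 = qadd (cut s 2) (qpos s.unpair.2.unpair.2.unpair.2) := rfl

section

variable {α : Type*} [Primcodable α] {f : α → ℕ}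

theorem computable_cut_zero (hf : Computable f) : Computable fun a => cut (f a) 0 := by
  simp only [cut_zero_eq]; fun_prop

theorem computable_cut_one (hf : Computable f) : Computable fun a => cut (f a) 1 := by
  simp only [cut_one_eq]
  exact computable_qadd (computable_cut_zero hf) (by fun_prop)

theorem computable_cut_two (hf : Computable f) : Computable fun a => cut (f a) 2 := by
  simp only [cut_two_eq]
  exact computable_qadd (computable_cut_one hf) (by fun_prop)

theorem computable_cut_three (hf : Computable f) : Computable fun a => cut (f a) 3 := by
  simp only [cut_three_eq]
  exact computable_qadd (computable_cut_two hf) (by fun_prop)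

end

theorem cut_zero (s : ℕ) : ratOfNat (cut s 0) = posRat s.unpair.1 := by
  rw [cut_zero_eq, ratOfNat_qpos]

theorem cut_zero_pos (s : ℕ) : 0 < ratOfNat (cut s 0) := by
  rw [cut_zero]; exact posRat_pos _

theorem cut_one (s : ℕ) :
    ratOfNat (cut s 1) = ratOfNat (cut s 0) + posRat s.unpair.2.unpair.1 := by
  rw [cut_one_eq, ratOfNat_qadd, ratOfNat_qpos]

theorem cut_two (s : ℕ) :
    ratOfNat (cut s 2) = ratOfNat (cut s 1) + posRat s.unpair.2.unpair.2.unpair.1 := by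
  rw [cut_two_eq, ratOfNat_qadd, ratOfNat_qpos]

theorem cut_three (s : ℕ) :
    ratOfNat (cut s 3) = ratOfNat (cut s 2) + posRat s.unpair.2.unpair.2.unpair.2 := by
  rw [cut_three_eq, ratOfNat_qadd, ratOfNat_qpos]

attribute [irreducible] cut

theorem cut_zero_lt_one (s : ℕ) : ratOfNat (cut s 0) < ratOfNat (cut s 1) := by
  rw [cut_one]; linarith [posRat_pos s.unpair.2.unpair.1]

theorem cut_one_lt_two (s : ℕ) : ratOfNat (cut s 1) < ratOfNat (cut s 2) := by
  rw [cut_two]; linarith [posRat_pos s.unpair.2.unpair.2.unpair.1]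

theorem cut_two_lt_three (s : ℕ) : ratOfNat (cut s 2) < ratOfNat (cut s 3) := by
  rw [cut_three]; linarith [posRat_pos s.unpair.2.unpair.2.unpair.2]

theorem exists_cut {a b c d : ℚ} (ha : 0 < a) (hab : a < b) (hbc : b < c) (hcd : c < d) :
    ∃ s, ratOfNat (cut s 0) = a ∧ ratOfNat (cut s 1) = b ∧ ratOfNat (cut s 2) = c ∧
      ratOfNat (cut s 3) = d := by
  obtain ⟨i, hi⟩ := exists_posRat ha
  obtain ⟨j, hj⟩ := exists_posRat (sub_pos.2 hab)
  obtain ⟨k, hk⟩ := exists_posRat (sub_pos.2 hbc)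
  obtain ⟨l, hl⟩ := exists_posRat (sub_pos.2 hcd)
  have h0 : ratOfNat (cut (Nat.pair i (Nat.pair j (Nat.pair k l))) 0) = a := by
    rw [cut_zero, Nat.unpair_pair, hi]
  have h1 : ratOfNat (cut (Nat.pair i (Nat.pair j (Nat.pair k l))) 1) = b := by
    rw [cut_one, h0]; simp [hj]
  have h2 : ratOfNat (cut (Nat.pair i (Nat.pair j (Nat.pair k l))) 2) = c := by
    rw [cut_two, h1]; simp [hk]
  have h3 : ratOfNat (cut (Nat.pair i (Nat.pair j (Nat.pair k l))) 3) = d := by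
    rw [cut_three, h2]; simp [hl]
  exact ⟨_, h0, h1, h2, h3⟩

section Levels

variable {X : Type u} [MeasurableSpace X]

/-- The slope of the integral of the truncation. -/
noncomputable def truncSlope (μ : Measure X) (T : X → ℝ≥0∞) (p q : ℝ) : ℝ :=
  (truncIntegral μ T q - truncIntegral μ T p) * (q - p)⁻¹

variable (μ : Measure X) [IsFiniteMeasure μ] {T : X → ℝ≥0∞}

theorem truncSlope_le (hT : Measurable T) {p q : ℝ} (hp : 0 ≤ p) (hpq : p < q) :
    truncSlope μ T p q ≤ μ.real {x | ENNReal.ofReal p < T x} := by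
  rw [truncSlope, ← div_eq_mul_inv, div_le_iff₀ (by linarith), mul_comm]
  exact truncIntegral_sub_le μ hT hp hpq.le

theorem le_truncSlope (hT : Measurable T) {p q : ℝ} (hp : 0 ≤ p) (hpq : p < q) :
    μ.real {x | ENNReal.ofReal q ≤ T x} ≤ truncSlope μ T p q := by
  rw [truncSlope, ← div_eq_mul_inv, le_div_iff₀ (by linarith), mul_comm]
  exact le_truncIntegral_sub μ hT hp hpq.le

/-- In every interval there are levels around which the distribution function of `T` varies
little. -/
theorem exists_cut_slope_lt (hT : Measurable T) {r s : ℝ} (hr : 0 < r) (hrs : r < s) {ε : ℝ}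
    (hε : 0 < ε) : ∃ k : ℕ, r < ratOfNat (cut k 0) ∧ (ratOfNat (cut k 3) : ℝ) < s ∧
      truncSlope μ T (ratOfNat (cut k 0)) (ratOfNat (cut k 1)) -
        truncSlope μ T (ratOfNat (cut k 2)) (ratOfNat (cut k 3)) < ε := by
  have hanti : Antitone fun t : ℝ => μ.real {x | ENNReal.ofReal t < T x} := fun t t' h =>
    measureReal_mono fun x hx => (ENNReal.ofReal_le_ofReal h).trans_lt hx
  -- A monotone function has at most countably many discontinuities, so every interval contains a
  -- level `t` at which the distribution function is continuous.
  have hcount := hanti.countable_not_continuousAt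
  obtain ⟨t, ht, hrt, hts⟩ := (hcount.dense_compl ℝ).exists_between hrs
  have hcont : ContinuousAt (fun t : ℝ => μ.real {x | ENNReal.ofReal t < T x}) t := by
    simpa using ht
  obtain ⟨δ, hδ, hδt⟩ := Metric.continuousAt_iff.1 hcont (ε / 2) (by linarith)
  -- All four rationals are placed in `(t, t + δ)`. The difference of the slopes is at most `μ{T >
  -- a} - μ{T > d}`, and both measures are within `ε / 2` of the value at `t`.
  obtain ⟨a, ha1, ha2⟩ := exists_rat_btwn (lt_min (show t < s from hts) (lt_add_of_pos_right t hδ))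
  obtain ⟨b, hb1, hb2⟩ := exists_rat_btwn ha2
  obtain ⟨c, hc1, hc2⟩ := exists_rat_btwn hb2
  obtain ⟨d, hd1, hd2⟩ := exists_rat_btwn hc2
  obtain ⟨k, h0, h1, h2, h3⟩ := exists_cut (a := a) (b := b) (c := c) (d := d)
    (by exact_mod_cast hr.trans (hrt.trans ha1)) (by exact_mod_cast hb1) (by exact_mod_cast hc1)
    (by exact_mod_cast hd1)
  refine ⟨k, by rw [h0]; exact hrt.trans ha1, by rw [h3]; exact hd2.trans_le (min_le_left _ _), ?_⟩
  have ha0 : (0 : ℝ) ≤ a := (hr.trans (hrt.trans ha1)).le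
  have hdδ : (d : ℝ) < t + δ := hd2.trans_le (min_le_right _ _)
  have i1 := truncSlope_le μ hT ha0 hb1
  have i2 := le_truncSlope μ hT (ha0.trans (hb1.trans hc1).le) hd1
  have i3 : μ.real {x | ENNReal.ofReal d < T x} ≤ μ.real {x | ENNReal.ofReal d ≤ T x} :=
    measureReal_mono fun x (hx : ENNReal.ofReal d < T x) => hx.le
  have i4 := hδt (x := (a : ℝ)) (by rw [Real.dist_eq, abs_of_pos (by linarith)]; linarith)
  have i5 := hδt (x := (d : ℝ)) (by rw [Real.dist_eq, abs_of_pos (by linarith)]; linarith)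
  rw [Real.dist_eq] at i4 i5
  have i6 := (abs_lt.1 i4).2
  have i7 := (abs_lt.1 i5).1
  rw [h0, h1, h2, h3]
  linarith

end Levels

/-! ### From an integral test to a sequential test -/

section SchnorrTest

variable {X : Type u} [MetricSpace X] [BasicPoints X] [MeasurableSpace X] [BorelSpace X]
  [ComputableMetricSpace X] {e : ℕ → ℕ} {T : X → ℝ≥0∞}

/-- Slopes of the integral of the truncation are computable. -/
theorem IsLowerApprox.computableReals_truncSlope
    (h : IsLowerApprox e T) {ν : FinMeas X} (hν : IsComputablePoint ν)
    (hT : ∫⁻ x, T x ∂ν.toMeasure ≠ ∞)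
    (hI : ComputableReals fun _ : ℕ × ℕ => (∫⁻ x, T x ∂ν.toMeasure).toReal)
    {α : Type*} [Primcodable α] {c d w : α → ℕ} (hc : Computable c) (hd : Computable d)
    (hw : Computable w) (hc0 : ∀ a, 0 ≤ ratOfNat (c a))
    (hcd : ∀ a, ratOfNat (d a) = ratOfNat (c a) + posRat (w a)) :
    ComputableReals fun a =>
      truncSlope ν.toMeasure T (ratOfNat (c a) : ℝ) (ratOfNat (d a) : ℝ) := by
  have hd0 : ∀ a, 0 ≤ ratOfNat (d a) := fun a => by
    rw [hcd]; exact add_nonneg (hc0 a) (posRat_pos _).le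
  -- The length of the interval is given as a positive rational, whose inverse is computed exactly.
  refine (((h.computableReals_truncIntegral hν hT hI hd hd0).sub
    (h.computableReals_truncIntegral hν hT hI hc hc0)).mul
    (ComputableReals.posRat (c := fun a => posInv (w a)) (by fun_prop))).of_eq fun a => ?_
  rw [truncSlope, posRat_posInv, hcd]
  push_cast
  rw [add_sub_cancel_left]

/-- A nonnegative function that is approximated from below by a computable sequence of basic
functions and has a computable integral is finite at all Schnorr random points. -/
theorem IsLowerApprox.lt_top_of_isSchnorrRandom (h : IsLowerApprox e T) {ν : FinMeas X}
    (hν : IsComputablePoint ν) (hT : ∫⁻ x, T x ∂ν.toMeasure ≠ ∞)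
    (hI : ComputableReals fun _ : ℕ × ℕ => (∫⁻ x, T x ∂ν.toMeasure).toReal) {x : X}
    (hx : IsSchnorrRandom ν.toMeasure x) : T x < ∞ := by
  set μ := ν.toMeasure with hμ
  have he := h.computable
  have hTm := h.measurable
  have hpos0 : ∀ s, 0 ≤ ratOfNat (cut s 0) := fun s => (cut_zero_pos s).le
  have hpos : ∀ s, 0 ≤ ratOfNat (cut s 2) := fun s =>
    (hpos0 s).trans ((cut_zero_lt_one s).trans (cut_one_lt_two s)).le
  have hslope : Semidecidable fun p : (ℕ × ℕ) × ℕ =>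
      truncSlope μ T (ratOfNat (cut p.2 0)) (ratOfNat (cut p.2 1)) -
        truncSlope μ T (ratOfNat (cut p.2 2)) (ratOfNat (cut p.2 3)) < (2 : ℝ)⁻¹ ^ p.1.1 :=
    ComputableReals.semidecidable_lt
      ((h.computableReals_truncSlope hν hT hI (computable_cut_zero (by fun_prop))
        (computable_cut_one (by fun_prop)) (w := fun p : (ℕ × ℕ) × ℕ => p.2.unpair.2.unpair.1)
        (by fun_prop) (fun p => hpos0 _) fun p => cut_one _).sub
      (h.computableReals_truncSlope hν hT hI (computable_cut_two (by fun_prop))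
        (computable_cut_three (by fun_prop))
        (w := fun p : (ℕ × ℕ) × ℕ => p.2.unpair.2.unpair.2.unpair.2)
        (by fun_prop) (fun p => hpos _) fun p => cut_three _))
      (ComputableReals.half_pow (by fun_prop))
  -- A quadruple is written `a < b < c < d`. The next one lies inside the interval `(b, c)` of the
  -- current one, with slopes over `[a, b]` and `[c, d]` that differ by less than `2⁻ʲ`.
  obtain ⟨next, hnext, hn⟩ := Semidecidable.choice (p := fun (a : ℕ × ℕ) s =>
      (ratOfNat (cut a.2 1) : ℝ) < ratOfNat (cut s 0) ∧
      (ratOfNat (cut s 3) : ℝ) < ratOfNat (cut a.2 2) ∧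
      truncSlope μ T (ratOfNat (cut s 0)) (ratOfNat (cut s 1)) -
        truncSlope μ T (ratOfNat (cut s 2)) (ratOfNat (cut s 3)) < (2 : ℝ)⁻¹ ^ a.1)
    (Semidecidable.and (ComputableReals.semidecidable_lt
        (ComputableReals.ratOfNat (computable_cut_one (by fun_prop)))
        (ComputableReals.ratOfNat (computable_cut_zero (by fun_prop))))
      (Semidecidable.and (ComputableReals.semidecidable_lt
        (ComputableReals.ratOfNat (computable_cut_three (by fun_prop)))
        (ComputableReals.ratOfNat (computable_cut_two (by fun_prop)))) hslope))
    fun a => exists_cut_slope_lt μ hTm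
      (by exact_mod_cast (cut_zero_pos a.2).trans (cut_zero_lt_one a.2))
      (by exact_mod_cast cut_one_lt_two a.2) (by positivity)
  obtain ⟨C, hC⟩ := exists_nat_ge (∫⁻ x, T x ∂μ).toReal
  -- The initial quadruple has first entry `(C + 1) * 2ⁿ`, with the numerator stored minus one.
  let J : ℕ → ℕ → ℕ := fun n j =>
    Nat.rec (Nat.pair (Nat.pair ((C + 1) * 2 ^ n - 1) 0) 0) (fun i s => next (i, s)) j
  have hJ : Computable fun p : ℕ × ℕ => J p.1 p.2 :=
    computable_of_rec (f := J) (g := fun n => Nat.pair (Nat.pair ((C + 1) * 2 ^ n - 1) 0) 0)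
      (h := fun n i s => next (i, s)) (by fun_prop) (by fun_prop) (fun _ => rfl) (fun _ _ => rfl)
  have hJs : ∀ n j, J n (j + 1) = next (j, J n j) := fun _ _ => rfl
  have hJ1 : ∀ n, Monotone fun j => (ratOfNat (cut (J n j) 1) : ℝ) := fun n =>
    monotone_nat_of_le_succ fun j => by
      have h1 := (hn (j, J n j)).1
      have h2 : (ratOfNat (cut (J n (j + 1)) 0) : ℝ) < ratOfNat (cut (J n (j + 1)) 1) := by
        exact_mod_cast cut_zero_lt_one _
      rw [← hJs] at h1
      exact (h1.trans h2).le
  have hJ2 : ∀ n, Antitone fun j => (ratOfNat (cut (J n j) 2) : ℝ) := fun n =>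
    antitone_nat_of_succ_le fun j => by
      have h1 := (hn (j, J n j)).2.1
      have h2 : (ratOfNat (cut (J n (j + 1)) 2) : ℝ) < ratOfNat (cut (J n (j + 1)) 3) := by
        exact_mod_cast cut_two_lt_three _
      rw [← hJs] at h1
      exact (h2.trans h1).le
  have hJ12 : ∀ n i j, (ratOfNat (cut (J n i) 1) : ℝ) ≤ ratOfNat (cut (J n j) 2) := fun n i j => by
    have h1 := hJ1 n (le_max_left i j)
    have h2 := hJ2 n (le_max_right i j)
    have h3 : (ratOfNat (cut (J n (max i j)) 1) : ℝ) < ratOfNat (cut (J n (max i j)) 2) := by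
      exact_mod_cast cut_one_lt_two _
    exact h1.trans (h3.le.trans h2)
  -- This is the union over `j` of the sets `{T > c}`, where `c` is the third entry of the `j`-th
  -- quadruple. For every `j` it lies between `{T > c}` and `{T ≥ b}`.
  let U : ℕ → Set X := fun n =>
    {y | ∃ s : ℕ, (ratOfNat (cut (J n s.unpair.1) 2) : ℝ) < basicFun X (e s.unpair.2) y}
  have hU : ∀ n y, y ∈ U n ↔ ∃ j, ENNReal.ofReal (ratOfNat (cut (J n j) 2)) < T y := fun n y => by
    have hj : ∀ j, ENNReal.ofReal (ratOfNat (cut (J n j) 2)) < T y ↔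
        ∃ k, (ratOfNat (cut (J n j) 2) : ℝ) < basicFun X (e k) y := fun j =>
      h.lt_iff (by exact_mod_cast hpos _) y
    simp only [hj]
    exact ⟨fun ⟨s, hs⟩ => ⟨_, _, hs⟩, fun ⟨j, k, hk⟩ => ⟨Nat.pair j k, by simpa using hk⟩⟩
  have hUsub : ∀ n j, U n ⊆ {y | ENNReal.ofReal (ratOfNat (cut (J n j) 1)) ≤ T y} :=
    fun n j y hy => by
      obtain ⟨i, hi⟩ := (hU n y).1 hy
      exact (ENNReal.ofReal_le_ofReal (hJ12 n j i)).trans hi.le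
  have hsubU : ∀ n j, {y | ENNReal.ofReal (ratOfNat (cut (J n j) 2)) < T y} ⊆ U n :=
    fun n j y hy => (hU n y).2 ⟨j, hy⟩
  have htest : IsSchnorrSequentialTest μ U := by
    refine ⟨?_, fun n => ?_, ?_⟩
    · exact isEffectivelyOpenSeq_superlevel (d := fun _ s => e s.unpair.2)
        (c := fun n s => cut (J n s.unpair.1) 2) (by fun_prop) (computable_cut_two
          (hJ.comp (g := fun p : ℕ × ℕ => (p.1, p.2.unpair.1)) (by fun_prop)))
    · have h1 : ((C : ℝ) + 1) * 2 ^ n ≤ ratOfNat (cut (J n 0) 1) := by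
        have h2 : ratOfNat (cut (J n 0) 0) = ((C : ℚ) + 1) * 2 ^ n := by
          have h3 : (C + 1) * 2 ^ n - 1 + 1 = (C + 1) * 2 ^ n :=
            Nat.sub_add_cancel (Nat.mul_pos (Nat.succ_pos _) (by positivity))
          have h4 : (((C + 1) * 2 ^ n - 1 : ℕ) : ℚ) + 1 = ((C : ℚ) + 1) * 2 ^ n := by
            exact_mod_cast h3
          show ratOfNat (cut (Nat.pair (Nat.pair ((C + 1) * 2 ^ n - 1) 0) 0) 0) = _
          rw [cut_zero, Nat.unpair_pair, posRat_natPair, h4]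
          simp
        have h5 := cut_zero_lt_one (J n 0)
        rw [h2] at h5
        exact_mod_cast h5.le
      -- Markov's inequality, as `T ≥ (C + 1) * 2ⁿ` on `U n` and `∫ T ≤ C`.
      have h2 : ENNReal.ofReal (((C : ℝ) + 1) * 2 ^ n) * μ (U n) ≤ ENNReal.ofReal ((C : ℝ) + 1) := by
        refine (mul_le_mul_right ((measure_mono (hUsub n 0)).trans (measure_mono
          (t := {y | ENNReal.ofReal (((C : ℝ) + 1) * 2 ^ n) ≤ T y})
          fun y hy => (ENNReal.ofReal_le_ofReal h1).trans hy)) _).trans ?_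
        refine (mul_meas_ge_le_lintegral hTm _).trans ?_
        rw [← ENNReal.ofReal_toReal hT]
        exact ENNReal.ofReal_le_ofReal (by linarith)
      have h3 := ENNReal.toReal_mono ENNReal.ofReal_ne_top h2
      rw [ENNReal.toReal_mul, ENNReal.toReal_ofReal (by positivity),
        ENNReal.toReal_ofReal (by positivity), mul_assoc] at h3
      have h4 : 2 ^ n * (μ (U n)).toReal ≤ 1 :=
        le_of_mul_le_mul_left (by linarith) (by positivity : (0 : ℝ) < C + 1)
      rw [← ENNReal.ofReal_toReal (measure_ne_top μ (U n))]
      refine ENNReal.ofReal_le_ofReal ?_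
      rwa [inv_pow, ← one_div, le_div_iff₀ (by positivity), mul_comm]
    · refine computableReals_iff_isComputableRealSeq.1 (ComputableReals.of_approx (F := fun n j =>
        truncSlope μ T (ratOfNat (cut (J n (j + 1)) 2)) (ratOfNat (cut (J n (j + 1)) 3)))
        (h.computableReals_truncSlope hν hT hI (α := ℕ × ℕ)
          (computable_cut_two (hJ.comp (g := fun p : ℕ × ℕ => (p.1, p.2 + 1)) (by fun_prop)))
          (computable_cut_three (hJ.comp (g := fun p : ℕ × ℕ => (p.1, p.2 + 1)) (by fun_prop)))
          (w := fun p : ℕ × ℕ => (J p.1 (p.2 + 1)).unpair.2.unpair.2.unpair.2)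
          (by have := hJ.comp (g := fun p : ℕ × ℕ => (p.1, p.2 + 1)) (by fun_prop)
              fun_prop)
          (fun p => hpos _) fun p => cut_three _) fun n j => ?_)
      have h1 := (hn (j, J n j)).2.2
      rw [← hJs] at h1
      have h2 := truncSlope_le μ hTm (p := (ratOfNat (cut (J n (j + 1)) 2) : ℝ))
        (q := ratOfNat (cut (J n (j + 1)) 3)) (by exact_mod_cast hpos _)
        (by exact_mod_cast cut_two_lt_three _)
      have h3 := le_truncSlope μ hTm (p := (ratOfNat (cut (J n (j + 1)) 0) : ℝ))
        (q := ratOfNat (cut (J n (j + 1)) 1)) (by exact_mod_cast hpos0 _)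
        (by exact_mod_cast cut_zero_lt_one _)
      have h4 : μ.real _ ≤ μ.real (U n) := measureReal_mono (hsubU n (j + 1))
      have h5 : μ.real (U n) ≤ μ.real _ := measureReal_mono (hUsub n (j + 1))
      show |_ - μ.real (U n)| ≤ _
      rw [abs_sub_comm, abs_of_nonneg (by linarith)]
      linarith
  by_contra htop
  -- A point with `T x = ∞` lies above all levels, hence in every `U n`.
  refine hx U htest (Set.mem_iInter.2 fun n => (hU n x).2 ⟨0, ?_⟩)
  rw [not_lt, top_le_iff] at htop
  rw [htop]
  exact ENNReal.ofReal_lt_top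

end SchnorrTest

/-- Schnorr random points are uniformly Schnorr random relative to every computable oracle. -/
theorem IsSchnorrRandom.isUniformlySchnorrRandom {A : Type v} {X : Type u} [MetricSpace A]
    [BasicPoints A] [MetricSpace X] [BasicPoints X] [ComputableMetricSpace X] [MeasurableSpace X]
    [BorelSpace X] {a : A} (ha : IsComputablePoint a) {ν : FinMeas X} (hν : IsComputablePoint ν)
    {x : X} (hx : IsSchnorrRandom ν.toMeasure x) : IsUniformlySchnorrRandom a ν x := by
  intro t ht
  obtain ⟨e, he⟩ := ht.lowerSemicomputable.exists_isLowerApprox ha hν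
  have hp : IsComputablePoint (a, ν) := by
    obtain ⟨h, hh, H⟩ := ha
    obtain ⟨k, hk, K⟩ := hν
    exact ⟨fun i => Nat.pair (h i) (k i), by fun_prop, H.prod K⟩
  exact he.lt_top_of_isSchnorrRandom hν (ht.lintegral_lt_top a ν).ne
    (ht.lintegral_computable.isComputablePoint hp).computableReals hx

/-! ### Sums of indicator functions of effectively open sets -/

/-- The index of the sum of the first `k` members of a sequence. -/
def sumIdx (e : ℕ → ℕ) : ℕ → ℕ
  | 0 => idxConst 0
  | k + 1 => idxAdd (sumIdx e k) (e k)

theorem computable_sumIdx {α : Type*} [Primcodable α] {e : α → ℕ → ℕ}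
    (he : Computable fun p : α × ℕ => e p.1 p.2) :
    Computable fun p : α × ℕ => sumIdx (e p.1) p.2 :=
  computable_of_rec (f := fun a => sumIdx (e a)) (g := fun _ => idxConst 0)
    (h := fun a k s => idxAdd s (e a k)) (by fun_prop)
    (computable_idxAdd (by fun_prop)
      (he.comp (g := fun p : α × ℕ × ℕ => (p.1, p.2.1)) (by fun_prop)))
    (fun _ => rfl) (fun _ _ => rfl)

theorem basicFun_sumIdx {X : Type u} [PseudoMetricSpace X] [BasicPoints X] (e : ℕ → ℕ) (k : ℕ)
    (x : X) : basicFun X (sumIdx e k) x = ∑ n ∈ Finset.range k, basicFun X (e n) x := by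
  induction k with
  | zero => rw [sumIdx, basicFun_idxConst_zero, Finset.range_zero, Finset.sum_empty]
  | succ k ih => rw [sumIdx, basicFun_idxAdd, ih, Finset.sum_range_succ]

/-- By monotonicity the diagonal, with `k` terms at stage `k`, is cofinal among all pairs of a
length and a stage. -/
theorem tsum_iSup_of_monotone {a : ℕ → ℕ → ℝ≥0∞} (ha : ∀ n, Monotone (a n)) :
    ∑' n, ⨆ k, a n k = ⨆ k, ∑ n ∈ Finset.range k, a n k := by
  refine le_antisymm ?_ (iSup_le fun k => ?_)
  · rw [ENNReal.tsum_eq_iSup_nat]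
    refine iSup_le fun N => ?_
    rw [ENNReal.finsetSum_iSup_of_monotone ha]
    refine iSup_le fun k => le_iSup_of_le (max N k) ?_
    refine (Finset.sum_le_sum_of_subset (Finset.range_mono (le_max_left N k))).trans ?_
    exact Finset.sum_le_sum fun n _ => ha n (le_max_right N k)
  · exact (Finset.sum_le_sum fun n _ => le_iSup (a n) k).trans (ENNReal.sum_le_tsum _)

/-- Makes it decidable whether a ball of `ℕ × X` meets the section at `n`. One of the two truncated
differences is zero, so their sum is `|n - m|`. -/
theorem dist_nat_lt_iff (n m k : ℕ) : dist n m < (posRat k : ℝ) ↔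
    ((n - m) + (m - n)) * (k.unpair.2 + 1) < k.unpair.1 + 1 := by
  have h : dist n m = (((n - m) + (m - n) : ℕ) : ℝ) := by
    rw [Nat.dist_eq]
    rcases le_total n m with h | h
    · rw [abs_of_nonpos (sub_nonpos.2 (by exact_mod_cast h)), Nat.sub_eq_zero_of_le h, zero_add,
        Nat.cast_sub h]; ring
    · rw [abs_of_nonneg (sub_nonneg.2 (by exact_mod_cast h)), Nat.sub_eq_zero_of_le h, add_zero,
        Nat.cast_sub h]
  rw [h, posRat]
  push_cast
  rw [lt_div_iff₀ (by positivity)]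
  exact_mod_cast Iff.rfl

section

variable {X : Type u} [MetricSpace X] [BasicPoints X]

theorem IsEffectivelyOpenSeq.isOpen {U : ℕ → Set X} (hU : IsEffectivelyOpenSeq U) (n : ℕ) :
    IsOpen (U n) := by
  obtain ⟨V, ⟨S, -, rfl⟩, hV⟩ := hU
  rw [hV]
  exact (isOpen_biUnion fun i _ => Metric.isOpen_ball).preimage
    (by fun_prop : Continuous fun y : X => (n, y))

/-- The indicator functions of a uniformly effectively open sequence are suprema of uniformly
computable sequences of basic functions. -/
theorem IsEffectivelyOpenSeq.exists_family {U : ℕ → Set X} (hU : IsEffectivelyOpenSeq U) :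
    ∃ e : ℕ → ℕ → ℕ, (Computable fun p : ℕ × ℕ => e p.1 p.2) ∧
      ∀ n y, (U n).indicator 1 y = ⨆ s, ENNReal.ofReal (basicFun X (e n s) y) := by
  classical
  obtain ⟨V, ⟨S, hS, rfl⟩, hV⟩ := hU
  have hSc : Computable fun n => decide (n ∈ S) := by
    obtain ⟨f, hf⟩ := ComputablePred.computable_iff.1 hS
    refine hf.1.of_eq fun n => ?_
    have := congrFun hf.2 n
    by_cases h : n ∈ S <;> simp_all
  -- Here `s` codes a ball of `ℕ × X` and a stage of its approximation. For the maximum metric, the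
  -- section at `n` is the ball in `X` if `n` is within the radius, and empty otherwise.
  let e : ℕ → ℕ → ℕ := fun n s =>
    bif decide (s.unpair.1 ∈ S) && decide (((n - s.unpair.1.unpair.1.unpair.1) +
        (s.unpair.1.unpair.1.unpair.1 - n)) * (s.unpair.1.unpair.2.unpair.2 + 1) <
        s.unpair.1.unpair.2.unpair.1 + 1) then
      idxBall s.unpair.1.unpair.1.unpair.2 s.unpair.1.unpair.2 s.unpair.2
    else idxConst 0
  have he : Computable fun p : ℕ × ℕ => e p.1 p.2 :=
    computable_cond (computable_and
      (hSc.comp (g := fun p : ℕ × ℕ => p.2.unpair.1) (by fun_prop))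
      (computable_decide_lt (by fun_prop) (by fun_prop))) (by fun_prop) (by fun_prop)
  have hmem : ∀ n y, y ∈ U n ↔ ∃ i ∈ S, ((n - i.unpair.1.unpair.1) +
      (i.unpair.1.unpair.1 - n)) * (i.unpair.2.unpair.2 + 1) < i.unpair.2.unpair.1 + 1 ∧
      y ∈ Metric.ball (BasicPoints.pt i.unpair.1.unpair.2 : X) (posRat i.unpair.2 : ℝ) := by
    intro n y
    rw [hV]
    simp only [Set.mem_ofPred_eq, Set.mem_iUnion, exists_prop, ← dist_nat_lt_iff, basicBall,
      Metric.mem_ball, Prod.dist_eq, max_lt_iff]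
    rfl
  refine ⟨e, he, fun n y => le_antisymm ?_ (iSup_le fun s => ?_)⟩
  · by_cases hy : y ∈ U n
    · obtain ⟨i, hi, hin, hiy⟩ := (hmem n y).1 hy
      rw [Set.indicator_of_mem hy]
      have h1 := iSup_basicFun_idxBall i.unpair.1.unpair.2 i.unpair.2 y
      rw [Set.indicator_of_mem hiy] at h1
      rw [Pi.one_apply] at h1 ⊢
      rw [← h1]
      refine iSup_le fun m => le_iSup_of_le (Nat.pair i m) (le_of_eq ?_)
      simp only [e, Nat.unpair_pair, hi, hin, decide_true, Bool.and_self, cond_true]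
    · rw [Set.indicator_of_notMem hy]
      exact zero_le
  · by_cases hs : s.unpair.1 ∈ S ∧ ((n - s.unpair.1.unpair.1.unpair.1) +
        (s.unpair.1.unpair.1.unpair.1 - n)) * (s.unpair.1.unpair.2.unpair.2 + 1) <
        s.unpair.1.unpair.2.unpair.1 + 1
    · have h1 : e n s = idxBall s.unpair.1.unpair.1.unpair.2 s.unpair.1.unpair.2 s.unpair.2 := by
        simp only [e, hs.1, hs.2, decide_true, Bool.and_self, cond_true]
      rw [h1]
      refine (le_iSup (fun m => ENNReal.ofReal (basicFun X
        (idxBall s.unpair.1.unpair.1.unpair.2 s.unpair.1.unpair.2 m) y)) _).trans ?_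
      rw [iSup_basicFun_idxBall]
      refine Set.indicator_le_indicator_of_subset (fun z hz => ?_) (fun _ => zero_le) y
      exact (hmem n z).2 ⟨_, hs.1, hs.2, hz⟩
    · have h1 : e n s = idxConst 0 := by
        simp only [e, ← Bool.decide_and, decide_eq_false hs, cond_false]
      rw [h1, basicFun_idxConst_zero, ENNReal.ofReal_zero]
      exact zero_le

/-- The sum of the indicator functions of a uniformly effectively open sequence is approximated
from below by a computable sequence of basic functions. -/
theorem IsEffectivelyOpenSeq.exists_isLowerApprox {U : ℕ → Set X} (hU : IsEffectivelyOpenSeq U) :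
    ∃ e, IsLowerApprox e fun y => ∑' n, (U n).indicator 1 y := by
  obtain ⟨e, he, heU⟩ := hU.exists_family
  have hsup := computable_supIdx he
  have hsum : Computable fun k => sumIdx (fun n => supIdx (e n) k) k :=
    (computable_sumIdx (e := fun k n => supIdx (e n) k)
      (hsup.comp (g := fun p : ℕ × ℕ => (p.2, p.1)) (by fun_prop))).comp
      (g := fun k : ℕ => (k, k)) (by fun_prop)
  -- The `k`-th function adds the `k`-th monotone approximations of the first `k` indicators.
  refine ⟨fun k => sumIdx (fun n => supIdx (e n) k) k, hsum, fun k y => ?_, fun y k l hkl => ?_,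
    fun y => ?_⟩
  · rw [basicFun_sumIdx]
    exact Finset.sum_nonneg fun n _ => supIdx_nonneg _ _
  · simp only [basicFun_sumIdx]
    refine (Finset.sum_le_sum fun n _ => supIdx_mono (e n) y hkl).trans ?_
    exact Finset.sum_le_sum_of_subset_of_nonneg (Finset.range_mono hkl)
      fun n _ _ => supIdx_nonneg _ _
  · simp only [heU, ← iSup_supIdx (e _) y]
    rw [tsum_iSup_of_monotone fun n k l hkl => ENNReal.ofReal_le_ofReal (supIdx_mono (e n) y hkl)]
    refine iSup_congr fun k => ?_
    rw [basicFun_sumIdx, ENNReal.ofReal_sum_of_nonneg fun n _ => supIdx_nonneg _ _]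

end

/-! ### From a sequential test to a rapidly converging series -/

section

variable {X : Type u} [MetricSpace X] [BasicPoints X] [MeasurableSpace X] [BorelSpace X]

theorem tsum_half_pow_nat_add (c : ℝ) (k : ℕ) :
    ∑' n : ℕ, c * (2 : ℝ)⁻¹ ^ (n + k) = 2 * c * (2 : ℝ)⁻¹ ^ k := by
  simp only [pow_add, ← mul_assoc]
  rw [tsum_mul_right, tsum_mul_left, tsum_geometric_of_lt_one (by norm_num) (by norm_num)]
  norm_num
  ring

theorem summable_half_pow_nat_add (c : ℝ) (k : ℕ) :
    Summable fun n : ℕ => c * (2 : ℝ)⁻¹ ^ (n + k) := by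
  simp only [pow_add]
  exact ((summable_geometric_of_lt_one (by norm_num) (by norm_num)).mul_right _).mul_left _

/-- Sums of rapidly decreasing series are approximated by their partial sums. -/
theorem abs_sum_range_sub_tsum_le {r : ℕ → ℝ} (h0 : ∀ n, 0 ≤ r n) {c : ℝ}
    (h : ∀ n, r n ≤ c * (2 : ℝ)⁻¹ ^ n) (k : ℕ) :
    |∑ n ∈ Finset.range k, r n - ∑' n, r n| ≤ 2 * c * (2 : ℝ)⁻¹ ^ k := by
  have hs : Summable r := Summable.of_nonneg_of_le h0 h (by simpa using summable_half_pow_nat_add c 0)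
  rw [← hs.sum_add_tsum_nat_add k, abs_sub_comm, add_sub_cancel_left,
    abs_of_nonneg (tsum_nonneg fun n => h0 _), ← tsum_half_pow_nat_add]
  exact ((summable_nat_add_iff k).2 hs).tsum_le_tsum (fun n => h _) (summable_half_pow_nat_add c k)

theorem IsSchnorrSequentialTest.lintegral_eq {μ : Measure X} {U : ℕ → Set X}
    (hU : IsSchnorrSequentialTest μ U) :
    ∫⁻ y, ∑' n, (U n).indicator 1 y ∂μ = ∑' n, μ (U n) := by
  have hm : ∀ n, MeasurableSet (U n) := fun n => (hU.effectivelyOpen.isOpen n).measurableSet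
  rw [lintegral_tsum fun n => (measurable_one.indicator (hm n)).aemeasurable]
  exact tsum_congr fun n => lintegral_indicator_one (hm n)

theorem IsSchnorrSequentialTest.toReal_le {X : Type u} [MetricSpace X] [BasicPoints X]
    [MeasurableSpace X] {μ : Measure X} {U : ℕ → Set X}
    (hU : IsSchnorrSequentialTest μ U) (n : ℕ) : (μ (U n)).toReal ≤ 1 * (2 : ℝ)⁻¹ ^ n := by
  rw [one_mul]
  exact ENNReal.toReal_le_of_le_ofReal (by positivity) (hU.measure_le n)

/-- The integral is `∑ μ(U n)`. Its terms are computable, and `μ(U n) ≤ 2⁻ⁿ` gives a computable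
bound on the tails. -/
theorem IsSchnorrSequentialTest.computableReals_lintegral {μ : Measure X} [IsFiniteMeasure μ]
    {U : ℕ → Set X} (hU : IsSchnorrSequentialTest μ U) {α : Type*} [Primcodable α] :
    ComputableReals fun _ : α => (∫⁻ y, ∑' n, (U n).indicator 1 y ∂μ).toReal := by
  rw [hU.lintegral_eq, ENNReal.tsum_toReal_eq fun n => measure_ne_top _ _]
  have h1 := computableReals_iff_isComputableRealSeq.2 hU.measure_computable
  have h2 := ComputableReals.sum (f := fun (_ : Unit) n => (μ (U n)).toReal)
    (h1.comp (g := fun p : Unit × ℕ => p.2) (by fun_prop))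
  refine ComputableReals.of_approx (F := fun _ k =>
    ∑ n ∈ Finset.range (k + 1), (μ (U n)).toReal)
    (h2.comp (g := fun p : α × ℕ => ((), p.2 + 1)) (by fun_prop)) fun _ k => ?_
  refine (abs_sum_range_sub_tsum_le (fun n => ENNReal.toReal_nonneg) hU.toReal_le _).trans_eq ?_
  rw [← half_pow_add_half_pow]; ring

/-- A function that is approximated from below and has a computable integral is dominated, up to a
bounded function, by a computable series of basic functions with rapidly decreasing integrals. -/
theorem IsLowerApprox.exists_series [ComputableMetricSpace X] {e : ℕ → ℕ} {T : X → ℝ≥0∞}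
    (h : IsLowerApprox e T) {ν : FinMeas X} (hν : IsComputablePoint ν)
    (hT : ∫⁻ x, T x ∂ν.toMeasure ≠ ∞)
    (hI : ComputableReals fun _ : ℕ × ℕ => (∫⁻ x, T x ∂ν.toMeasure).toReal) :
    ∃ w : ℕ → ℕ, Computable w ∧ (∀ l x, 0 ≤ basicFun X (w l) x) ∧
      (∀ l, ∫ x, basicFun X (w l) x ∂ν.toMeasure ≤ (2 : ℝ)⁻¹ ^ l) ∧
      ∀ x, T x = ∞ → ∑' l, ENNReal.ofReal (basicFun X (w l) x) = ∞ := by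
  obtain ⟨K, hK, hKI⟩ := h.exists_rate hν hI
  have he := h.computable
  have hw0 : ∀ l x, 0 ≤ basicFun X (idxSubPos (e (K (l + 1))) (e (K l))) x := fun l x => by
    rw [basicFun_idxSubPos]; exact le_max_left _ _
  -- The rate `K` need not be monotone, hence the positive part of the difference.
  refine ⟨fun l => idxSubPos (e (K (l + 1))) (e (K l)), by fun_prop, hw0, fun l => ?_,
    fun x hx => ?_⟩
  · have h1 : ENNReal.ofReal (∫ x, basicFun X (idxSubPos (e (K (l + 1))) (e (K l))) x
        ∂ν.toMeasure) + ENNReal.ofReal (∫ x, basicFun X (e (K l)) x ∂ν.toMeasure) ≤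
        ∫⁻ x, T x ∂ν.toMeasure := by
      rw [← lintegral_ofReal_basicFun _ (hw0 l), ← lintegral_ofReal_basicFun _ (h.nonneg _),
        ← lintegral_add_right _ (continuous_basicFun _).measurable.ennreal_ofReal]
      refine lintegral_mono fun x => ?_
      rw [← ENNReal.ofReal_add (hw0 l x) (h.nonneg _ x), basicFun_idxSubPos, ← max_add_add_right,
        zero_add, sub_add_cancel, ENNReal.ofReal_max]
      exact max_le (h.ofReal_le _ x) (h.ofReal_le _ x)
    have i1 : 0 ≤ ∫ x, basicFun X (idxSubPos (e (K (l + 1))) (e (K l))) x ∂ν.toMeasure :=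
      integral_nonneg (hw0 l)
    have i2 : 0 ≤ ∫ x, basicFun X (e (K l)) x ∂ν.toMeasure := integral_nonneg (h.nonneg _)
    have h2 := ENNReal.toReal_mono hT h1
    rw [ENNReal.toReal_add ENNReal.ofReal_ne_top ENNReal.ofReal_ne_top, ENNReal.toReal_ofReal i1,
      ENNReal.toReal_ofReal i2] at h2
    linarith [(hKI l).2]
  · by_contra hS
    -- Telescoping. As `n ≤ K n`, this bounds `T x` by one finite value plus the series, so the
    -- series diverges where `T` is infinite.
    have h1 : ∀ n, basicFun X (e (K n)) x ≤ basicFun X (e (K 0)) x +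
        ∑ l ∈ Finset.range n, basicFun X (idxSubPos (e (K (l + 1))) (e (K l))) x := by
      intro n
      induction n with
      | zero => simp
      | succ n ih =>
        rw [Finset.sum_range_succ]
        have h2 : basicFun X (e (K (n + 1))) x - basicFun X (e (K n)) x ≤
            basicFun X (idxSubPos (e (K (n + 1))) (e (K n))) x := by
          rw [basicFun_idxSubPos]; exact le_max_right _ _
        linarith
    have h3 : T x ≤ ENNReal.ofReal (basicFun X (e (K 0)) x) +
        ∑' l, ENNReal.ofReal (basicFun X (idxSubPos (e (K (l + 1))) (e (K l))) x) := by
      rw [h.iSup_eq]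
      refine iSup_le fun k => ?_
      refine (ENNReal.ofReal_le_ofReal ((h.mono x (hKI k).1).trans (h1 k))).trans ?_
      rw [ENNReal.ofReal_add (h.nonneg _ x) (Finset.sum_nonneg fun l _ => hw0 l x),
        ENNReal.ofReal_sum_of_nonneg fun l _ => hw0 l x]
      exact add_le_add_right (ENNReal.sum_le_tsum _) _
    rw [hx, top_le_iff] at h3
    exact ENNReal.add_ne_top.2 ⟨ENNReal.ofReal_ne_top, hS⟩ h3

end

/-! ### Computable maps from computable moduli of continuity -/

/-- A real-valued function is computable if it has computable approximations at the basic points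
with a modulus of continuity that is computable from a rough location of the argument. -/
theorem isComputableMap_of_modulus {Z : Type u} [PseudoMetricSpace Z] [BasicPoints Z] {f : Z → ℝ}
    {E : ℕ → ℕ → ℝ} (hE : ComputableReals fun p : ℕ × ℕ => E p.1 p.2) {m : ℕ → ℕ → ℕ}
    (hm : Computable fun p : ℕ × ℕ => m p.1 p.2)
    (h : ∀ z s k i, dist (BasicPoints.pt s) z ≤ (2 : ℝ)⁻¹ ^ 1 →
      dist (BasicPoints.pt i) z ≤ (2 : ℝ)⁻¹ ^ m s k → |E i k - f z| ≤ (2 : ℝ)⁻¹ ^ k) :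
    IsComputableMap f := by
  obtain ⟨g, hg, hgE⟩ := hE
  -- Entry `1` of the name locates the argument within `1/2`, which determines the entry to be used.
  -- Two errors of size `2⁻¹ ^ (k + 2)` add up to the `2⁻¹ ^ (k + 1)` allowed for a name.
  let out : (ℕ → ℕ) → ℕ → ℕ := fun h k => g (h (m (h 1) (k + 2)), k + 2) (k + 2)
  let φ : List ℕ → ℕ → Option ℕ := fun σ k =>
    bif decide (1 < σ.length) && decide (m (σ.getD 1 0) (k + 2) < σ.length) then
      some (g (σ.getD (m (σ.getD 1 0) (k + 2)) 0, k + 2) (k + 2)) else none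
  have hm' : Computable fun p : List ℕ × ℕ => m (p.1.getD 1 0) (p.2 + 2) :=
    hm.comp (g := fun p : List ℕ × ℕ => (p.1.getD 1 0, p.2 + 2)) (by fun_prop)
  have hφ : Computable₂ φ := by
    show Computable fun p : List ℕ × ℕ => φ p.1 p.2
    refine computable_cond (computable_and (computable_decide_lt (by fun_prop) (by fun_prop))
      (computable_decide_lt hm' (by fun_prop))) (Computable.option_some.comp ?_) (by fun_prop)
    exact hg.comp (g := fun p : List ℕ × ℕ =>
      ((p.1.getD (m (p.1.getD 1 0) (p.2 + 2)) 0, p.2 + 2), p.2 + 2)) (by fun_prop)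
  have hφ_eq : ∀ (h : ℕ → ℕ) (l k : ℕ), φ ((List.range l).map h) k =
      if 1 < l ∧ m (h 1) (k + 2) < l then some (out h k) else none := by
    intro h l k
    by_cases h1 : 1 < l
    · by_cases h2 : m (h 1) (k + 2) < l
      · simp [φ, out, h1, h2]
      · simp [φ, h1, h2]
    · simp [φ, h1]
  -- Every list is an initial segment of a sequence, so the formula for `φ` on such segments also
  -- yields its monotonicity.
  have hφ_list : ∀ σ : List ℕ, σ = (List.range σ.length).map fun i => σ.getD i 0 := fun σ => by
    refine List.ext_getElem (by simp) fun i h1 h2 => ?_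
    simp [h1]
  refine ⟨fun h => Part.some (out h), ⟨φ, hφ, fun σ τ k v hστ hσ => ?_, fun h g' => ?_⟩,
    fun z h' hz => ⟨out h', Part.mem_some _, ?_⟩⟩
  · have hget : ∀ i < σ.length, τ.getD i 0 = σ.getD i 0 := fun i hi => by
      obtain ⟨ρ, rfl⟩ := hστ
      exact List.getD_append _ _ _ _ hi
    rw [hφ_list σ, hφ_eq] at hσ
    rw [hφ_list τ, hφ_eq]
    have hlen := hστ.length_le
    by_cases h1 : 1 < σ.length ∧ m (σ.getD 1 0) (k + 2) < σ.length
    · rw [if_pos h1] at hσ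
      rw [if_pos (by rw [hget 1 h1.1]; omega), ← hσ]
      simp only [out, hget 1 h1.1, hget _ h1.2]
    · rw [if_neg h1] at hσ
      exact absurd hσ (by simp)
  · simp only [hφ_eq, Part.mem_some_iff]
    constructor
    · rintro rfl k
      exact ⟨max 1 (m (h 1) (k + 2)) + 1, if_pos (by omega)⟩
    · intro H
      funext k
      obtain ⟨l, hl⟩ := H k
      by_cases h1 : 1 < l ∧ m (h 1) (k + 2) < l
      · rw [if_pos h1] at hl; exact (Option.some.inj hl).symm
      · rw [if_neg h1] at hl; exact absurd hl (by simp)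
  · refine isCauchyName_of_dist_le fun k => ?_
    have h1 := h z (h' 1) (k + 2) (h' (m (h' 1) (k + 2))) (hz.dist_le 1) (hz.dist_le _)
    have h2 := hgE (h' (m (h' 1) (k + 2)), k + 2) (k + 2)
    show |(ratOfNat (out h' k) : ℝ) - f z| ≤ _
    refine (abs_sub_le _ _ _).trans ((add_le_add h2 h1).trans_eq ?_)
    rw [← half_pow_add_half_pow (k + 1)]

/-! ### A uniform Schnorr integral test from a rapidly converging series -/

section UniformTest

/-- A cutoff that is `1` below `2⁻ˡ` and vanishes above `2 * 2⁻ˡ`. -/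
noncomputable def cutoff (l : ℕ) (A : ℝ) : ℝ := max 0 (min 1 (2 - 2 ^ l * A))

theorem cutoff_nonneg (l : ℕ) (A : ℝ) : 0 ≤ cutoff l A := le_max_left _ _

theorem cutoff_le_one (l : ℕ) (A : ℝ) : cutoff l A ≤ 1 := max_le zero_le_one (min_le_left _ _)

theorem two_pow_mul_half_pow (l : ℕ) : (2 : ℝ) ^ l * (2 : ℝ)⁻¹ ^ l = 1 := by
  rw [← mul_pow, mul_inv_cancel₀ (by norm_num), one_pow]

theorem cutoff_eq_one {l : ℕ} {A : ℝ} (h : A ≤ (2 : ℝ)⁻¹ ^ l) : cutoff l A = 1 := by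
  have h1 := mul_le_mul_of_nonneg_left h (by positivity : (0 : ℝ) ≤ 2 ^ l)
  rw [two_pow_mul_half_pow] at h1
  rw [cutoff, min_eq_left (by linarith), max_eq_right zero_le_one]

theorem abs_cutoff_sub_le (l : ℕ) (A B : ℝ) : |cutoff l A - cutoff l B| ≤ 2 ^ l * |A - B| := by
  refine (abs_clamp_sub_clamp_le _ _).trans_eq ?_
  rw [← abs_of_pos (by positivity : (0 : ℝ) < 2 ^ l), ← abs_mul, abs_sub_comm,
    abs_of_pos (by positivity : (0 : ℝ) < 2 ^ l)]
  congr 1; ring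

theorem cutoff_eq_zero {l : ℕ} {A : ℝ} (h : 2 * (2 : ℝ)⁻¹ ^ l ≤ A) : cutoff l A = 0 := by
  have h1 := mul_le_mul_of_nonneg_left h (by positivity : (0 : ℝ) ≤ 2 ^ l)
  rw [mul_left_comm, two_pow_mul_half_pow] at h1
  rw [cutoff, max_eq_left]
  exact (min_le_right _ _).trans (by linarith)

/-- The bound does not depend on `A`, hence the series of integrals converges uniformly over all
finite measures. -/
theorem cutoff_mul_le (l : ℕ) {A : ℝ} (hA : 0 ≤ A) : cutoff l A * A ≤ 2 * (2 : ℝ)⁻¹ ^ l := by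
  rcases le_total A (2 * (2 : ℝ)⁻¹ ^ l) with h | h
  · exact (mul_le_of_le_one_left hA (cutoff_le_one l A)).trans h
  · rw [cutoff_eq_zero h, zero_mul]; positivity

/-- The cutoff has slope up to `2 ^ l`, but the smaller argument is at most `2 * 2⁻ˡ` unless both
products vanish. This contributes `2`, and the factor `A` contributes `1`, so the Lipschitz constant
is independent of `l`. -/
theorem abs_cutoff_mul_sub_le (l : ℕ) {A B : ℝ} (hA : 0 ≤ A) (hB : 0 ≤ B) :
    |cutoff l A * A - cutoff l B * B| ≤ 3 * |A - B| := by
  wlog h : B ≤ A generalizing A B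
  · rw [abs_sub_comm, abs_sub_comm A]
    exact this hB hA (le_of_not_ge h)
  rcases le_total B (2 * (2 : ℝ)⁻¹ ^ l) with h1 | h1
  · have e : cutoff l A * A - cutoff l B * B =
      cutoff l A * (A - B) + (cutoff l A - cutoff l B) * B := by ring
    rw [e]
    refine (abs_add_le _ _).trans ?_
    rw [abs_mul, abs_mul, abs_of_nonneg (cutoff_nonneg l A), abs_of_nonneg hB]
    have i1 : cutoff l A * |A - B| ≤ |A - B| :=
      mul_le_of_le_one_left (abs_nonneg _) (cutoff_le_one l A)
    have i2 : |cutoff l A - cutoff l B| * B ≤ 2 ^ l * |A - B| * (2 * (2 : ℝ)⁻¹ ^ l) :=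
      mul_le_mul (abs_cutoff_sub_le l A B) h1 hB (by positivity)
    have i3 : (2 : ℝ) ^ l * |A - B| * (2 * (2 : ℝ)⁻¹ ^ l) = 2 * |A - B| := by
      rw [show (2 : ℝ) ^ l * |A - B| * (2 * (2 : ℝ)⁻¹ ^ l) =
        2 * |A - B| * (2 ^ l * (2 : ℝ)⁻¹ ^ l) by ring, two_pow_mul_half_pow, mul_one]
    linarith
  · rw [cutoff_eq_zero h1, cutoff_eq_zero (h1.trans h)]
    simp

theorem ComputableReals.cutoff {α : Type*} [Primcodable α] {l : α → ℕ} (hl : Computable l)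
    {A : α → ℝ} (hA : ComputableReals A) : ComputableReals fun a => cutoff (l a) (A a) := by
  have h0 : ComputableReals fun _ : α => (0 : ℝ) := (ComputableReals.ratCast 0).of_eq (by simp)
  have h1 : ComputableReals fun _ : α => (1 : ℝ) := (ComputableReals.ratCast 1).of_eq (by simp)
  have h2 : ComputableReals fun _ : α => (2 : ℝ) := (ComputableReals.ratCast 2).of_eq (by simp)
  have h3 : ComputableReals fun a => (2 : ℝ) ^ l a :=
    (ComputableReals.natCast (c := fun a => 2 ^ l a)
      (computable_pow (by fun_prop) hl)).of_eq (by simp)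
  exact h0.max (h1.min (h2.sub (h3.mul hA)))

variable {A : Type v} {X : Type u} [MetricSpace X] [BasicPoints X] [MeasurableSpace X]

/-- The `l`-th term of the test, as a function of a measure and a point. -/
noncomputable def testTerm (w : ℕ → ℕ) (l : ℕ) (ρ : FinMeas X) (x : X) : ℝ :=
  cutoff l (∫ y, basicFun X (w l) y ∂ρ.toMeasure) * basicFun X (w l) x

/-- The test: a series of basic functions, where each term is cut off as its integral becomes
large. -/
noncomputable def seriesTest (A : Type v) (X : Type u) [MetricSpace X] [BasicPoints X]
    [MeasurableSpace X] (w : ℕ → ℕ) (p : A × FinMeas X × X) : ℝ≥0∞ :=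
  ∑' l, ENNReal.ofReal (testTerm w l p.2.1 p.2.2)

variable {w : ℕ → ℕ}

theorem testTerm_nonneg (hw0 : ∀ l (x : X), 0 ≤ basicFun X (w l) x) (l : ℕ) (ρ : FinMeas X)
    (x : X) : 0 ≤ testTerm w l ρ x :=
  mul_nonneg (cutoff_nonneg _ _) (hw0 l x)

/-- The real partial sums are the sequence that exhibits the test as lower semicomputable. -/
theorem seriesTest_eq_iSup (hw0 : ∀ l (x : X), 0 ≤ basicFun X (w l) x) (p : A × FinMeas X × X) :
    (seriesTest A X w p : EReal) =
      ⨆ n : ℕ, ((∑ l ∈ Finset.range n, testTerm w l p.2.1 p.2.2 : ℝ) : EReal) := by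
  have h1 : ∀ n : ℕ, ((∑ l ∈ Finset.range n, testTerm w l p.2.1 p.2.2 : ℝ) : EReal) =
      ((∑ l ∈ Finset.range n, ENNReal.ofReal (testTerm w l p.2.1 p.2.2) : ℝ≥0∞) : EReal) := by
    intro n
    rw [← ENNReal.ofReal_sum_of_nonneg fun l _ => testTerm_nonneg hw0 l _ _,
      EReal.coe_ennreal_ofReal, max_eq_left]
    exact Finset.sum_nonneg fun l _ => testTerm_nonneg hw0 l _ _
  simp only [h1]
  rw [seriesTest, ENNReal.tsum_eq_iSup_nat]
  refine le_antisymm ?_ (iSup_le fun n => ?_)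
  · refine le_of_forall_lt fun c hc => ?_
    by_contra hcon
    rw [not_lt] at hcon
    have h2 : (⨆ n : ℕ, ∑ l ∈ Finset.range n, ENNReal.ofReal (testTerm w l p.2.1 p.2.2)) ≤
        c.toENNReal := by
      refine iSup_le fun n => ?_
      rw [← EReal.toENNReal_coe (x := ∑ l ∈ Finset.range n,
        ENNReal.ofReal (testTerm w l p.2.1 p.2.2))]
      exact EReal.toENNReal_le_toENNReal ((le_iSup (fun n : ℕ => ((∑ l ∈ Finset.range n,
        ENNReal.ofReal (testTerm w l p.2.1 p.2.2) : ℝ≥0∞) : EReal)) n).trans hcon)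
    have h0 : 0 ≤ c := le_trans (by simp) ((le_iSup (fun n : ℕ => ((∑ l ∈ Finset.range n,
        ENNReal.ofReal (testTerm w l p.2.1 p.2.2) : ℝ≥0∞) : EReal)) 0).trans hcon)
    have h3 := EReal.coe_ennreal_le_coe_ennreal_iff.2 h2
    rw [EReal.coe_toENNReal h0] at h3
    exact absurd hc (not_lt.2 h3)
  · exact EReal.coe_ennreal_le_coe_ennreal_iff.2 (le_iSup (fun n : ℕ =>
      ∑ l ∈ Finset.range n, ENNReal.ofReal (testTerm w l p.2.1 p.2.2)) n)

/-- The product rule: the cutoff is `2 ^ l`-Lipschitz in an integral that moves by at most `2 * 2 ^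
w l * 2⁻ᵐ`, and `gauge (w l)` bounds both the basic function and its slope. -/
theorem abs_testTerm_sub_le (l : ℕ) {m : ℕ} (hm : w l < m) {ρ ρ' : FinMeas X} {x x' : X}
    (hρ : dist ρ ρ' ≤ (2 : ℝ)⁻¹ ^ m) (hx : dist x x' ≤ (2 : ℝ)⁻¹ ^ m) :
    |testTerm w l ρ x - testTerm w l ρ' x'| ≤
      (((2 ^ l * (2 * 2 ^ w l) + 1) * gauge (w l) : ℕ) : ℝ) * (2 : ℝ)⁻¹ ^ m := by
  have h1 := abs_integral_basicFun_sub_le hm hρ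
  have h2 := (abs_cutoff_sub_le l _ _).trans
    (mul_le_mul_of_nonneg_left h1 (by positivity : (0 : ℝ) ≤ 2 ^ l))
  have h3 := (abs_basicFun_sub_le (w l) x x').trans
    (mul_le_mul_of_nonneg_left hx (Nat.cast_nonneg _))
  have h4 := abs_basicFun_le (w l) x
  unfold testTerm
  set c := cutoff l (∫ y, basicFun X (w l) y ∂ρ.toMeasure)
  set c' := cutoff l (∫ y, basicFun X (w l) y ∂ρ'.toMeasure) with hc'
  have e : c * basicFun X (w l) x - c' * basicFun X (w l) x' =
    (c - c') * basicFun X (w l) x + c' * (basicFun X (w l) x - basicFun X (w l) x') := by ring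
  rw [e]
  refine (abs_add_le _ _).trans ?_
  rw [abs_mul, abs_mul, abs_of_nonneg (cutoff_nonneg l _ : 0 ≤ c')]
  have i1 := mul_le_mul h2 h4 (abs_nonneg _) (by positivity)
  have i2 := mul_le_of_le_one_left (abs_nonneg (basicFun X (w l) x - basicFun X (w l) x'))
    (cutoff_le_one l _ : c' ≤ 1)
  refine (add_le_add i1 (i2.trans h3)).trans_eq ?_
  push_cast
  ring

variable [BorelSpace X]

theorem lintegral_testTerm (hw0 : ∀ l (x : X), 0 ≤ basicFun X (w l) x) (l : ℕ) (ρ : FinMeas X) :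
    ∫⁻ x, ENNReal.ofReal (testTerm w l ρ x) ∂ρ.toMeasure =
      ENNReal.ofReal (cutoff l (∫ y, basicFun X (w l) y ∂ρ.toMeasure) *
        ∫ y, basicFun X (w l) y ∂ρ.toMeasure) := by
  simp only [testTerm, ENNReal.ofReal_mul (cutoff_nonneg _ _)]
  rw [lintegral_const_mul _ (continuous_basicFun _).measurable.ennreal_ofReal,
    lintegral_ofReal_basicFun _ (hw0 l)]

theorem lintegral_seriesTest (hw0 : ∀ l (x : X), 0 ≤ basicFun X (w l) x) (a : A)
    (ρ : FinMeas X) : ∫⁻ x, seriesTest A X w (a, ρ, x) ∂ρ.toMeasure =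
      ∑' l, ENNReal.ofReal (cutoff l (∫ y, basicFun X (w l) y ∂ρ.toMeasure) *
        ∫ y, basicFun X (w l) y ∂ρ.toMeasure) := by
  have hm : ∀ l, AEMeasurable (fun x => ENNReal.ofReal (testTerm w l ρ x)) ρ.toMeasure :=
    fun l => (((continuous_basicFun (w l)).measurable.const_mul _).ennreal_ofReal).aemeasurable
  simp only [seriesTest]
  rw [lintegral_tsum hm]
  exact tsum_congr fun l => lintegral_testTerm hw0 l ρ

variable [ComputableMetricSpace X] [MetricSpace A] [BasicPoints A]

theorem computable_sum_range {f : ℕ → ℕ} (hf : Computable f) :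
    Computable fun n => ∑ l ∈ Finset.range n, f l :=
  (computable_natSum (α := Unit) (f := fun _ l => f l) (hf.comp Computable.snd)).comp
    ((Computable.const ()).pair Computable.id)

theorem computable_two_mul_two_pow (hw : Computable w) : Computable fun l => 2 * 2 ^ w l :=
  computable_mul (Computable.const 2) (computable_pow (Computable.const 2) hw)

theorem computable_testModulus (hw : Computable w) :
    Computable fun l => (2 ^ l * (2 * 2 ^ w l) + 1) * gauge (w l) :=
  computable_mul (computable_add (computable_mul (computable_pow (Computable.const 2) Computable.id)
    (computable_two_mul_two_pow hw)) (Computable.const 1)) (computable_gauge hw)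

theorem computableReals_testTerm_pt (hw : Computable w) : ComputableReals fun q : ℕ × ℕ × ℕ =>
    testTerm w q.1 (BasicPoints.pt q.2.1 : FinMeas X) (BasicPoints.pt q.2.2 : X) := by
  unfold testTerm
  exact (ComputableReals.cutoff Computable.fst (computableReals_integral_pt.comp
    (g := fun q : ℕ × ℕ × ℕ => (w q.1, q.2.1)) (by fun_prop))).mul
    ((computableReals_basicFun_pt X).comp
      (g := fun q : ℕ × ℕ × ℕ => (w q.1, q.2.2)) (by fun_prop))

theorem computableReals_cutoff_mul_integral_pt (hw : Computable w) :
    ComputableReals fun q : ℕ × ℕ =>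
      cutoff q.1 (∫ y, basicFun X (w q.1) y ∂(BasicPoints.pt q.2 : FinMeas X).toMeasure) *
        ∫ y, basicFun X (w q.1) y ∂(BasicPoints.pt q.2 : FinMeas X).toMeasure := by
  have h1 := (computableReals_integral_pt (X := X)).comp (g := fun q : ℕ × ℕ => (w q.1, q.2))
    (by fun_prop)
  exact (ComputableReals.cutoff Computable.fst h1).mul h1

theorem isComputableMap_partialSum (hw : Computable w) : IsComputableMap
    fun p : ℕ × (A × FinMeas X × X) => ∑ l ∈ Finset.range p.1, testTerm w l p.2.2.1 p.2.2.2 := by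
  let E : ℕ → ℕ → ℝ := fun i _ => ∑ l ∈ Finset.range i.unpair.1,
    testTerm w l (BasicPoints.pt i.unpair.2.unpair.2.unpair.1 : FinMeas X)
      (BasicPoints.pt i.unpair.2.unpair.2.unpair.2 : X)
  have hE : ComputableReals fun p : ℕ × ℕ => E p.1 p.2 := by
    have h1 := (computableReals_testTerm_pt (X := X) hw).comp (g := fun q : ℕ × ℕ =>
      (q.2, q.1.unpair.2.unpair.2.unpair.1, q.1.unpair.2.unpair.2.unpair.2)) (by fun_prop)
    have h2 := ComputableReals.sum (α := ℕ) (f := fun i l =>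
      testTerm w l (BasicPoints.pt i.unpair.2.unpair.2.unpair.1 : FinMeas X)
        (BasicPoints.pt i.unpair.2.unpair.2.unpair.2 : X)) h1
    exact h2.comp (g := fun p : ℕ × ℕ => (p.1, p.1.unpair.1)) (by fun_prop)
  obtain ⟨D, hD, hD'⟩ : ∃ D : ℕ → ℕ, Computable D ∧
      ∀ n, ∑ l ∈ Finset.range n, (2 ^ l * (2 * 2 ^ w l) + 1) * gauge (w l) = D n :=
    ⟨_, computable_sum_range (computable_testModulus hw), fun _ => rfl⟩
  obtain ⟨W, hW, hW'⟩ : ∃ W : ℕ → ℕ, Computable W ∧ ∀ n, ∑ l ∈ Finset.range n, (w l + 1) = W n :=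
    ⟨_, computable_sum_range (computable_add hw (Computable.const 1)), fun _ => rfl⟩
  -- The rough location determines the number `n` of terms, since naturals within `1/2` coincide. `W
  -- n` exceeds every `w l` in use, as required for comparing integrals; `D n` absorbs the sum of
  -- the Lipschitz constants; and `1` forces the approximating index to have first component `n`.
  refine isComputableMap_of_modulus hE
    (m := fun s k => k + W s.unpair.1 + 1 + D s.unpair.1) (by fun_prop) ?_
  rintro ⟨n, a, ρ, x⟩ s k i hs hi
  have hnat : ∀ j r, dist (BasicPoints.pt j : ℕ × (A × FinMeas X × X)) (n, a, ρ, x) ≤ r →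
      dist j.unpair.1 n ≤ r ∧
      dist (BasicPoints.pt j.unpair.2.unpair.2.unpair.1 : FinMeas X) ρ ≤ r ∧
      dist (BasicPoints.pt j.unpair.2.unpair.2.unpair.2 : X) x ≤ r := by
    intro j r hj
    simp only [Prod.dist_eq, max_le_iff] at hj
    exact ⟨hj.1, hj.2.2.1, hj.2.2.2⟩
  have heq : ∀ j, dist j n ≤ (2 : ℝ)⁻¹ ^ 1 → j = n := fun j hj => by
    by_contra hne
    have := Nat.pairwise_one_le_dist hne
    norm_num at hj
    linarith
  have hsn := heq _ (hnat s _ hs).1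
  rw [hsn] at hi
  obtain ⟨hi1, hi2, hi3⟩ := hnat i _ hi
  have hin := heq _ (hi1.trans (half_pow_le_half_pow (by omega)))
  simp only [E, hin]
  rw [← Finset.sum_sub_distrib]
  refine (Finset.abs_sum_le_sum_abs _ _).trans ?_
  refine (Finset.sum_le_sum fun l hl => abs_testTerm_sub_le l ?_ hi2 hi3).trans ?_
  · have h1 : w l + 1 ≤ W n := hW' n ▸
      Finset.single_le_sum (f := fun l => w l + 1) (fun _ _ => Nat.zero_le _) hl
    omega
  · rw [← Finset.sum_mul, ← Nat.cast_sum, hD']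
    refine (natCast_mul_half_pow_le (D n) _).trans (half_pow_le_half_pow (by omega))

theorem isComputableMap_integral_seriesTest (hw : Computable w)
    (hw0 : ∀ l (x : X), 0 ≤ basicFun X (w l) x) : IsComputableMap fun p : A × FinMeas X =>
      ∑' l, cutoff l (∫ y, basicFun X (w l) y ∂p.2.toMeasure) *
        ∫ y, basicFun X (w l) y ∂p.2.toMeasure := by
  let I : ℕ → FinMeas X → ℝ := fun l ρ => ∫ y, basicFun X (w l) y ∂ρ.toMeasure
  have hI0 : ∀ l ρ, 0 ≤ I l ρ := fun l ρ => integral_nonneg (hw0 l)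
  -- The tail after `k + 3` terms is at most `2 * 2 * 2⁻¹ ^ (k + 3) = 2⁻¹ ^ (k + 1)`, which leaves
  -- as much for the error in the finite sum.
  let E : ℕ → ℕ → ℝ := fun i k => ∑ l ∈ Finset.range (k + 3),
    cutoff l (I l (BasicPoints.pt i.unpair.2)) * I l (BasicPoints.pt i.unpair.2)
  have hE : ComputableReals fun p : ℕ × ℕ => E p.1 p.2 := by
    have h1 : ComputableReals fun q : ℕ × ℕ => cutoff q.2 (I q.2 (BasicPoints.pt q.1.unpair.2)) *
        I q.2 (BasicPoints.pt q.1.unpair.2) :=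
      (computableReals_cutoff_mul_integral_pt (X := X) hw).comp
        (g := fun q : ℕ × ℕ => (q.2, q.1.unpair.2)) (by fun_prop)
    have h2 := ComputableReals.sum (α := ℕ) (f := fun i l =>
      cutoff l (I l (BasicPoints.pt i.unpair.2)) * I l (BasicPoints.pt i.unpair.2)) h1
    exact h2.comp (g := fun p : ℕ × ℕ => (p.1, p.2 + 3)) (by fun_prop)
  obtain ⟨D, hD, hD'⟩ : ∃ D : ℕ → ℕ, Computable D ∧
      ∀ n, ∑ l ∈ Finset.range n, 3 * (2 * 2 ^ w l) = D n :=
    ⟨_, computable_sum_range (computable_mul (Computable.const 3) (computable_two_mul_two_pow hw)),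
      fun _ => rfl⟩
  obtain ⟨W, hW, hW'⟩ : ∃ W : ℕ → ℕ, Computable W ∧ ∀ n, ∑ l ∈ Finset.range n, (w l + 1) = W n :=
    ⟨_, computable_sum_range (computable_add hw (Computable.const 1)), fun _ => rfl⟩
  refine isComputableMap_of_modulus hE
    (m := fun _ k => k + W (k + 3) + 1 + D (k + 3)) (by fun_prop) ?_
  rintro ⟨a, ρ⟩ s k i - hi
  have hi2 : dist (BasicPoints.pt i.unpair.2 : FinMeas X) ρ ≤
      (2 : ℝ)⁻¹ ^ (k + W (k + 3) + 1 + D (k + 3)) := (max_le_iff.1 hi).2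
  have h1 := abs_sum_range_sub_tsum_le (r := fun l => cutoff l (I l ρ) * I l ρ)
    (fun l => mul_nonneg (cutoff_nonneg _ _) (hI0 l ρ)) (fun l => cutoff_mul_le l (hI0 l ρ)) (k + 3)
  have h2 : |E i k - ∑ l ∈ Finset.range (k + 3), cutoff l (I l ρ) * I l ρ| ≤
      (2 : ℝ)⁻¹ ^ (k + 1) := by
    simp only [E]
    rw [← Finset.sum_sub_distrib]
    refine (Finset.abs_sum_le_sum_abs _ _).trans ?_
    have h3 : ∀ l ∈ Finset.range (k + 3), |cutoff l (I l (BasicPoints.pt i.unpair.2)) *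
        I l (BasicPoints.pt i.unpair.2) - cutoff l (I l ρ) * I l ρ| ≤
        ((3 * (2 * 2 ^ w l) : ℕ) : ℝ) * (2 : ℝ)⁻¹ ^ (k + W (k + 3) + 1 + D (k + 3)) := fun l hl => by
      have h4 : w l + 1 ≤ W (k + 3) := hW' (k + 3) ▸
        Finset.single_le_sum (f := fun l => w l + 1) (fun _ _ => Nat.zero_le _) hl
      refine (abs_cutoff_mul_sub_le l (hI0 _ _) (hI0 _ _)).trans ?_
      have h5 := abs_integral_basicFun_sub_le (X := X) (i := w l) (by omega) hi2
      push_cast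
      rw [mul_assoc]
      exact mul_le_mul_of_nonneg_left h5 (by norm_num)
    refine (Finset.sum_le_sum h3).trans ?_
    rw [← Finset.sum_mul, ← Nat.cast_sum, hD']
    exact (natCast_mul_half_pow_le (D (k + 3)) _).trans (half_pow_le_half_pow (by omega))
  have h6 : 2 * 2 * (2 : ℝ)⁻¹ ^ (k + 3) = (2 : ℝ)⁻¹ ^ (k + 1) := by
    rw [← half_pow_add_half_pow (k + 1), ← half_pow_add_half_pow (k + 1 + 1)]; ring
  rw [h6] at h1
  rw [← half_pow_add_half_pow k]
  exact (abs_sub_le _ _ _).trans (add_le_add h2 h1)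

/-- The series test is a uniform Schnorr integral test. -/
theorem isUniformSchnorrIntegralTest_seriesTest (hw : Computable w)
    (hw0 : ∀ l (x : X), 0 ≤ basicFun X (w l) x) :
    IsUniformSchnorrIntegralTest (seriesTest A X w) := by
  have hI0 : ∀ l (ρ : FinMeas X), 0 ≤ ∫ y, basicFun X (w l) y ∂ρ.toMeasure :=
    fun l ρ => integral_nonneg (hw0 l)
  have hnn : ∀ l (ρ : FinMeas X), 0 ≤ cutoff l (∫ y, basicFun X (w l) y ∂ρ.toMeasure) *
      ∫ y, basicFun X (w l) y ∂ρ.toMeasure := fun l ρ => mul_nonneg (cutoff_nonneg _ _) (hI0 l ρ)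
  have hs : ∀ ρ : FinMeas X, Summable fun l => cutoff l (∫ y, basicFun X (w l) y ∂ρ.toMeasure) *
      ∫ y, basicFun X (w l) y ∂ρ.toMeasure := fun ρ =>
    Summable.of_nonneg_of_le (fun l => hnn l ρ) (fun l => cutoff_mul_le l (hI0 l ρ))
      (by simpa using summable_half_pow_nat_add 2 0)
  have hlin : ∀ (a : A) (ρ : FinMeas X), ∫⁻ x, seriesTest A X w (a, ρ, x) ∂ρ.toMeasure =
      ENNReal.ofReal (∑' l, cutoff l (∫ y, basicFun X (w l) y ∂ρ.toMeasure) *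
        ∫ y, basicFun X (w l) y ∂ρ.toMeasure) := fun a ρ => by
    rw [lintegral_seriesTest hw0, ENNReal.ofReal_tsum_of_nonneg (fun l => hnn l ρ) (hs ρ)]
  refine ⟨⟨_, isComputableMap_partialSum hw, seriesTest_eq_iSup hw0⟩, fun a ρ => ?_, ?_⟩
  · rw [hlin]; exact ENNReal.ofReal_lt_top
  · have := isComputableMap_integral_seriesTest (A := A) hw hw0
    refine Eq.subst (motive := IsComputableMap) (funext fun p => ?_) this
    rw [hlin, ENNReal.toReal_ofReal (tsum_nonneg fun l => hnn l p.2)]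

/-- Uniformly Schnorr random points, relative to any oracle, are Schnorr random. -/
theorem IsUniformlySchnorrRandom.isSchnorrRandom {a : A} {ν : FinMeas X}
    (hν : IsComputablePoint ν) {x : X} (hx : IsUniformlySchnorrRandom a ν x) :
    IsSchnorrRandom ν.toMeasure x := by
  intro U hU hxU
  obtain ⟨e, he⟩ := hU.effectivelyOpen.exists_isLowerApprox
  have hfin : ∫⁻ y, ∑' n, (U n).indicator 1 y ∂ν.toMeasure ≠ ∞ := by
    rw [hU.lintegral_eq]
    refine ne_top_of_le_ne_top ENNReal.ofReal_ne_top (ENNReal.tsum_le_tsum hU.measure_le |>.trans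
      (ENNReal.ofReal_tsum_of_nonneg (fun n => by positivity)
        (summable_geometric_of_lt_one (by norm_num) (by norm_num))).ge)
  obtain ⟨w, hw, hw0, hwI, hwtop⟩ := he.exists_series hν hfin hU.computableReals_lintegral
  refine (hx _ (isUniformSchnorrIntegralTest_seriesTest hw hw0)).ne ?_
  -- At `ν` itself all integrals are small enough for the cutoffs to equal `1`.
  have h1 : ∀ l, testTerm w l ν x = basicFun X (w l) x := fun l => by
    rw [testTerm, cutoff_eq_one (hwI l), one_mul]
  simp only [seriesTest, h1]
  refine hwtop x ?_
  have h2 : ∀ n, (U n).indicator (1 : X → ℝ≥0∞) x = 1 := fun n => by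
    rw [Set.indicator_of_mem (Set.mem_iInter.1 hxU n), Pi.one_apply]
  simp only [h2]
  exact ENNReal.tsum_const_eq_top_of_ne_zero one_ne_zero

end UniformTest

end CompAnalysis

/-- Both implications hold for computable finite measures; it remains to translate a name of `μ` in
`𝓜₁(X)` into one in `𝓜(X)`. -/
theorem mainTheorem9 {A X : Type*}
    [MetricSpace A] [CompAnalysis.BasicPoints A] [CompAnalysis.ComputableMetricSpace A]
    [MetricSpace X] [CompAnalysis.BasicPoints X] [CompAnalysis.ComputableMetricSpace X]
    [MeasurableSpace X] [BorelSpace X]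
    (μ : CompAnalysis.ProbMeas X) (hμ : CompAnalysis.IsComputablePoint μ)
    (a : A) (ha : CompAnalysis.IsComputablePoint a) (x : X) :
    CompAnalysis.IsUniformlySchnorrRandom a μ.toFinMeas x ↔
      CompAnalysis.IsSchnorrRandom μ.toMeasure x :=
  ⟨fun h => h.isSchnorrRandom hμ.toFinMeas,
    fun h => CompAnalysis.IsSchnorrRandom.isUniformlySchnorrRandom ha hμ.toFinMeas h⟩
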